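/- **Setting.** A triple $\mathcal F=(X,\omega,f)$ over an open set $B\subseteq\mathbb R^3$ consists of a connected symplectic 6-manifold $(X,\omega)$ and a proper $C^\infty$ map $f$ from $X$ onto $B$ with connected fibres. Let $Crit(f)$ be the set of points where $f_*$ is not surjective. It is assumed that the fibres of $f|_{X\setminus Crit(f)}$ are Lagrangian, connected and non-empty, with local sections through every point, and that $Crit(f)\cap f^{-1}(b)$ is connected (possibly empty) for each $b\in B$. *Normal forms.* On $\mathbb R^6$ with coordinates $x_j,y_j$, $\omega_0=\sum_j dx_j\wedge dy_j$ and $z_j=x_j+iy_j$ put - $\kappa=1$: $q=(\mathrm{Im}\,z_1z_2z_3,\ |z_1|^2-|z_2|^2,\ |z_1|^2-|z_3|^2)$, and let $\Delta$ be the set of $b$ with $b_1=0$ such that $b_2=b_3\ge 0$, or $b_2=0\ge b_3$, or $b_3=0\ge b_2$; - $\kappa=2$: $q=(x_1y_1+x_2y_2,\ x_1y_2-x_2y_1,\ x_3)$ with $y_3\in\mathbb R/\mathbb Z$, and let $\Delta=\{b_1=b_2=0\}$. We write $\mathcal F\in\mathcal L(\kappa)$, with normalising coordinates $y$ (a diffeomorphism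 from $B$ onto an open subset of $\mathbb R^3$) and base point $b_0\in B$, if $f(Crit(f))=y^{-1}(\Delta)$ is connected and contains $b_0$, $y(b_0)=0$ in case $\kappa=1$, and there is a symplectomorphism $\psi$ from a neighbourhood $U$ of $Crit(f)$ with $f(U)=B$ onto an open subset of $(\mathbb R^6,\omega_0)$ (for $\kappa=2$: of $\mathbb R^5\times\mathbb R/\mathbb Z$) such that $y\circ f|_U=q\circ\psi$. *Periods.* The period lattice of $f$ at $b$ is the set of covectors $v\mapsto-\int_\gamma\iota(\tilde v)\omega$, with $\gamma$ a loop in $f^{-1}(b)\setminus Crit(f)$ and $\tilde v$ a lift of $v$ along $\gamma$. The reference singular form $\tau_0$, a closed multivalued 1-form on $\mathbb R^3\setminus\Delta$, is - $\kappa=2$: $\tau_0=-\log|s|\,db_1+\mathrm{Arg}(s)\,db_2$, $s=b_1+ib_2$; - $\kappa=1$: with $P_b(x)=x(x-b_2)(x-b_3)-b_1^2$ and $\zeta_c(b)$ the largest real solution of $P_b(x)=c$ ($c=0,1$), $$\tau_0=\Big(-\int_{\zeta_0}^{\zeta_1}\frac{dx}{\sqrt{P_b(x)}}+\frac{\zeta_1}{1+b_1^2}\Big)db_1+\alpha_2\,db_2+\alpha_3\,db_3,\qquad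 \alpha_k=-\frac{b_1}2\int_{\zeta_0}^{\zeta_1}\frac{dx}{(x-b_k)\sqrt{P_b(x)}}\ \bmod\pi .$$ In both cases the branch is fixed once and for all, continuous along segments parallel to the $b_1$-axis that avoid $\Delta$ (principal $\mathrm{Arg}$ for $\kappa=2$). The singular period of $\mathcal F$ is $\tau_1=y^*\tau_0+dH$, where $H\in C^\infty(B)$ is such that over $B\setminus y^{-1}(\Delta)$ the period lattice is generated by $\tau_1,\tau_2,\tau_3$, with $\tau_2=\pi\,dy_2$, $\tau_3=\pi\,dy_3$ for $\kappa=1$ and $\tau_2=2\pi\,dy_2$, $\tau_3=dy_3$ for $\kappa=2$. *Flatness.* A smooth function is flat at a set if it and all its partial derivatives vanish there; a map $\varphi=(\varphi_1,\varphi_2,\varphi_3)$ is tangent to the identity at a set if each $\varphi_i(b)-b_i$ is flat there. Two elements of $\mathcal L(\kappa)$ over the same $B$, with the same discriminant locus $f(Crit(f))$ and with normalising coordinates that agree to infinite order along it, and with singular periods given by $H$ and $H'$, are formally equivalent if $H-H'$ is, up to an additive constant, flat at this locus. **Proposition.** Let $\kappa\in\{1,2\}$. 1. Let $\mathcal F=(X,\omega,f)$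 and $\mathcal F'=(X',\omega',f')$ in $\mathcal L(\kappa)$ over $B$, both with normalising coordinates $b=(b_1,b_2,b_3)$, base point $b_0$, and periods $\tau_i,\tau_i'$, be formally equivalent. Then there is a $C^\infty$-diffeomorphism $\varphi$ between two open neighbourhoods of $b_0$ in $B$ that fixes $b_0$, is tangent to the identity at $\Delta$, preserves $\Delta$, and satisfies $\varphi^*\tau_i'=\tau_i$ off $\Delta$ for $i=1,2,3$. 2. Conversely, let $\mathcal F,\mathcal F'\in\mathcal L(\kappa)$ over $B$ and $B'$ have the normalising coordinates $b=(b_1,b_2,b_3)$, the same base point $b_0$, and singular periods $\tau_0+dH$ and $\tau_0+dH'$. Let $\varphi:B\to B'$ be a diffeomorphism that is tangent to the identity at $\Delta\cap B$ and such that $\varphi^*\tau_i'=\tau_i$ for $i=1,2,3$ (as forms on the complement of $\Delta$; in particular $\varphi(b)\in\Delta$ if and only if $b\in\Delta$). Then $(X',\omega',\varphi^{-1}\circ f')$ is in $\mathcal L(\kappa)$ over $B$, with normalising coordinates $\varphi$ and singular period $\varphi^*\tau_0+d(H'\circ\varphi)$, and $\mathcal F$ is formally equivalent to it, i.e. $H-H'\circ\varphi$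 is, up to an additive constant, flat at $\Delta\cap B$. -/

import Mathlib

open Set Topology
open scoped ContDiff Manifold

universe u v

/-- The space `ℝ³` in which the bases of the fibrations live. -/
abbrev E3 := EuclideanSpace ℝ (Fin 3)

/-- The model space `ℝ⁶`; coordinates `0, 1, 2` are `x₁, x₂, x₃` and `3, 4, 5` are
`y₁, y₂, y₃`. -/
abbrev E6 := EuclideanSpace ℝ (Fin 6)

noncomputable section

/-! ### Symplectic six-manifolds and Lagrangian fibrations -/

section SymplecticForm

variable {X : Type u} [TopologicalSpace X] [ChartedSpace E6 X]

/-- A 2-form on `X` written in the chart `e`, i.e. its pull-back under `e.symm`. -/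
def formInChart (η : ∀ x : X, TangentSpace 𝓘(ℝ, E6) x [⋀^Fin 2]→L[ℝ] ℝ)
    (e : OpenPartialHomeomorph X E6) (p : E6) : E6 [⋀^Fin 2]→L[ℝ] ℝ :=
  (η (e.symm p)).compContinuousLinearMap (mfderiv 𝓘(ℝ, E6) 𝓘(ℝ, E6) e.symm p)

/-- Symplectic form: a smooth, closed, nondegenerate 2-form. Smoothness and closedness are
tested in the charts of the atlas. -/
structure IsSymplecticForm
    (η : ∀ x : X, TangentSpace 𝓘(ℝ, E6) x [⋀^Fin 2]→L[ℝ] ℝ) : Prop where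
  smooth : ∀ e ∈ atlas E6 X, ContDiffOn ℝ ∞ (formInChart η e) e.target
  closed : ∀ e ∈ atlas E6 X, ∀ p ∈ e.target, extDeriv (formInChart η e) p = 0
  nondegenerate : ∀ (x : X) (u : TangentSpace 𝓘(ℝ, E6) x),
    (∀ w : TangentSpace 𝓘(ℝ, E6) x, η x ![u, w] = 0) → u = 0

end SymplecticForm

/-- A triple `(X, ω, f)`: a connected symplectic 6-manifold together with a map to `ℝ³`
(the conditions on `f` are imposed in `IsAdmissibleLagrangianFibration`). -/
structure FibrationTriple where
  /-- the total space -/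
  X : Type u
  [topX : TopologicalSpace X]
  [t2X : T2Space X]
  [secondX : SecondCountableTopology X]
  [connX : ConnectedSpace X]
  [chartedX : ChartedSpace E6 X]
  [manifoldX : IsManifold 𝓘(ℝ, E6) ∞ X]
  /-- the symplectic form -/
  form : ∀ x : X, TangentSpace 𝓘(ℝ, E6) x [⋀^Fin 2]→L[ℝ] ℝ
  symplectic : IsSymplecticForm form
  /-- the fibration map -/
  f : X → E3

attribute [instance] FibrationTriple.topX FibrationTriple.t2X FibrationTriple.secondX
  FibrationTriple.connX FibrationTriple.chartedX FibrationTriple.manifoldX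

namespace FibrationTriple

variable (F : FibrationTriple.{u})

/-- The triple `(X, ω, g ∘ f)`. -/
def comp (g : E3 → E3) : FibrationTriple.{u} := { F with f := g ∘ F.f }

/-- The differential of the fibration map. -/
def df (x : F.X) : TangentSpace 𝓘(ℝ, E6) x →L[ℝ] E3 := mfderiv 𝓘(ℝ, E6) 𝓘(ℝ, E3) F.f x

/-- `Crit(f)`, the set of points where the differential of `f` is not surjective. -/
def crit : Set F.X := {x | ¬ Function.Surjective (F.df x)}

/-- `f : (X, ω) → B` is an admissible Lagrangian fibration: a proper smooth map onto `B` with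
connected fibres; `f` restricted to `X \ Crit(f)` has Lagrangian, connected, non-empty fibres
and local sections through every point; the critical points on each fibre form a connected
(possibly empty) set. -/
structure IsAdmissibleLagrangianFibration (B : Set E3) : Prop where
  isOpen_base : IsOpen B
  smooth : ContMDiff 𝓘(ℝ, E6) 𝓘(ℝ, E3) ∞ F.f
  range_subset : range F.f ⊆ B
  proper : ∀ K ⊆ B, IsCompact K → IsCompact (F.f ⁻¹' K)
  connected_fibre : ∀ b ∈ B, IsConnected (F.f ⁻¹' {b})
  lagrangian : ∀ x ∉ F.crit, ∀ u w : TangentSpace 𝓘(ℝ, E6) x,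
    F.df x u = 0 → F.df x w = 0 → F.form x ![u, w] = 0
  connected_crit : ∀ b ∈ B, IsPreconnected (F.crit ∩ F.f ⁻¹' {b})
  connected_regular_fibre : ∀ b ∈ B, IsConnected (F.f ⁻¹' {b} \ F.crit)
  local_section : ∀ x ∉ F.crit, ∃ W : Set E3, IsOpen W ∧ F.f x ∈ W ∧ W ⊆ B ∧ ∃ σ : E3 → F.X,
    ContMDiffOn 𝓘(ℝ, E3) 𝓘(ℝ, E6) ∞ σ W ∧ σ (F.f x) = x ∧ ∀ b ∈ W, F.f (σ b) = b

/-- `l` is a period of `f` at `b`: there is a smooth loop `γ` in the fibre over `b`, avoiding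
`Crit(f)`, such that `l v = - ∫_γ ι(ṽ) ω` for every `v` and every lift `ṽ` of `v` along `γ`
(the integral does not depend on the lift). The set of all periods at `b` is the stalk of the
period lattice at `b`: every class of `H₁` of the connected manifold `f⁻¹(b) \ Crit(f)` is
represented by a loop. -/
def IsPeriod (b : E3) (l : E3 →L[ℝ] ℝ) : Prop :=
  ∃ γ : ℝ → F.X, ContMDiff 𝓘(ℝ, ℝ) 𝓘(ℝ, E6) ∞ γ ∧ (∀ t, γ (t + 1) = γ t) ∧
    (∀ t, F.f (γ t) = b ∧ γ t ∉ F.crit) ∧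
    ∀ (v : E3) (w : ∀ t, TangentSpace 𝓘(ℝ, E6) (γ t)), (∀ t, F.df (γ t) (w t) = v) →
      l v = -∫ t in (0 : ℝ)..1,
        F.form (γ t) ![w t, mfderiv 𝓘(ℝ, ℝ) 𝓘(ℝ, E6) γ t (1 : ℝ)]

end FibrationTriple

/-! ### The two normal forms -/

/-- The two families: `oneTwo` is `κ = 1`, singular fibre of type `(1,2)`; `twoTwo` is `κ = 2`,
singular fibre of type `(2,2)`. -/
inductive SingularityType
  | oneTwo
  | twoTwo

/-- The standard symplectic form `∑ dxⱼ ∧ dyⱼ` on `ℝ⁶`. -/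
def stdSymplectic (u w : E6) : ℝ :=
  (u 0 * w 3 - u 3 * w 0) + (u 1 * w 4 - u 4 * w 1) + (u 2 * w 5 - u 5 * w 2)

/-- The complex coordinate `zⱼ = xⱼ + i yⱼ`, `j = 0, 1, 2`. -/
def zcoord (p : E6) (j : Fin 3) : ℂ := ⟨p (Fin.castAdd 3 j), p (Fin.natAdd 3 j)⟩

namespace SingularityType

/-- The normal form of the fibration map. For `κ = 1` it is the Harvey-Lawson map
`(Im z₁z₂z₃, |z₁|² - |z₂|², |z₁|² - |z₃|²)`. For `κ = 2` it is the focus-focus map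
`(x₁y₁ + x₂y₂, x₁y₂ - x₂y₁, r)`, with `r = x₃` and `θ = y₃`. -/
def model : SingularityType → E6 → E3
  | oneTwo, p =>
      !₂[(zcoord p 0 * zcoord p 1 * zcoord p 2).im,
        ‖zcoord p 0‖ ^ 2 - ‖zcoord p 1‖ ^ 2, ‖zcoord p 0‖ ^ 2 - ‖zcoord p 2‖ ^ 2]
  | twoTwo, p => !₂[p 0 * p 3 + p 1 * p 4, p 0 * p 4 - p 1 * p 3, p 2]

/-- When two points of `ℝ⁶` are the same point of the normal form: for `κ = 2` the coordinate
`θ = y₃` lives in `ℝ / ℤ`. -/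
def SamePoint : SingularityType → E6 → E6 → Prop
  | oneTwo, p, p' => p = p'
  | twoTwo, p, p' => ∃ n : ℤ, p' = p + (n : ℝ) • EuclideanSpace.single 5 (1 : ℝ)

/-- The discriminant locus of the normal form. For `κ = 1`, the cone over three points in the
plane `b₁ = 0`; for `κ = 2`, the line `b₁ = b₂ = 0`. -/
def disc : SingularityType → Set E3
  | oneTwo => {b | b 0 = 0 ∧
      ((b 1 = b 2 ∧ 0 ≤ b 1) ∨ (b 1 = 0 ∧ b 2 ≤ 0) ∨ (b 2 = 0 ∧ b 1 ≤ 0))}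
  | twoTwo => {b | b 0 = 0 ∧ b 1 = 0}

end SingularityType

open SingularityType

/-- `(X, ω, f)` is a Lagrangian fibration over `B` of type `κ`, with base point `b₀` and
normalising coordinates `y` on `B`: a whole neighbourhood `U = Ψ(V)` of `Crit(f)`, with
`f(U) = B`, is symplectomorphic, via `Ψ`, to an open subset `V` of `ℝ⁶` (if `κ = 1`) or of
`ℝ⁵ × ℝ/ℤ` (if `κ = 2`) in such a way that `y ∘ f` becomes the normal form, and the
discriminant locus `f(Crit(f))` is the standard one in the coordinates `y`. -/
structure IsFibrationOfType (κ : SingularityType) (B : Set E3) (b₀ : E3) (y : E3 → E3)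
    (F : FibrationTriple.{u}) : Prop where
  admissible : F.IsAdmissibleLagrangianFibration B
  coord_smooth : ContDiffOn ℝ ∞ y B
  coord_injOn : InjOn y B
  coord_fderiv : ∀ b ∈ B, Function.Bijective (fderiv ℝ y b)
  base_mem : b₀ ∈ B
  base_mem_disc : y b₀ ∈ κ.disc
  base_vertex : κ = oneTwo → y b₀ = 0
  disc_eq : F.f '' F.crit = {b | b ∈ B ∧ y b ∈ κ.disc}
  disc_connected : IsPreconnected {b | b ∈ B ∧ y b ∈ κ.disc}
  normal_form : ∃ (V : Set E6) (Ψ : E6 → F.X), IsOpen V ∧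
    ContMDiffOn 𝓘(ℝ, E6) 𝓘(ℝ, E6) ∞ Ψ V ∧
    (∀ p ∈ V, ∀ p', κ.SamePoint p p' → p' ∈ V) ∧
    (∀ p ∈ V, ∀ p' ∈ V, Ψ p = Ψ p' ↔ κ.SamePoint p p') ∧
    (∀ p ∈ V, ∀ u w : E6, F.form (Ψ p)
      ![mfderiv 𝓘(ℝ, E6) 𝓘(ℝ, E6) Ψ p u, mfderiv 𝓘(ℝ, E6) 𝓘(ℝ, E6) Ψ p w] =
        stdSymplectic u w) ∧
    (∀ p ∈ V, y (F.f (Ψ p)) = κ.model p) ∧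
    F.crit ⊆ Ψ '' V ∧ F.f '' (Ψ '' V) = B

/-! ### The period 1-forms -/

/-- The polynomial `P_b(x) = x (x - b₂)(x - b₃) - b₁²`. -/
def hlPoly (b : E3) (x : ℝ) : ℝ := x * (x - b 1) * (x - b 2) - b 0 ^ 2

/-- The maximal real solution of `P_b(x) = c`: it is `ζ₀(b)` for `c = 0`, `ζ₁(b)` for `c = 1`. -/
def hlRoot (c : ℝ) (b : E3) : ℝ := sSup {x : ℝ | hlPoly b x = c}

/-- The function `α(b) = - ∫_{ζ₀}^{ζ₁} dx / √P_b(x)`: minus the time that the Hamiltonian flow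
of `Im z₁z₂z₃` takes from the section `Σ⁻` to the torus orbit of the section `Σ⁺`. -/
def hlAlpha (b : E3) : ℝ :=
  -∫ x in (hlRoot 0 b)..(hlRoot 1 b), 1 / √(hlPoly b x)

/-- The components `α₂` (`k = 1`, `j = 2`) and `α₃` (`k = 2`, `j = 1`): minus the time for which
the Hamiltonian flow of `|z₁|² - |z_{k+1}|²` has to be applied in order to reach `Σ⁺`
from `Σ⁻`. These functions are defined modulo `π`; the branch chosen here is continuous along
all segments in the complement of the discriminant locus that are parallel to the `b₁`-axis. -/
def hlAngle (k j : Fin 3) (b : E3) : ℝ :=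
  -(b 0 / 2 * ∫ x in (hlRoot 0 b)..(hlRoot 1 b), 1 / ((x - b k) * √(hlPoly b x))) -
    (open Classical in
      if 0 < b k ∧ b j < b k then Real.pi * (1 - (SignType.sign (b 0) : ℝ)) / 2 else 0)

/-- The coordinate 1-form `db_{i+1}`. -/
def dcoord (i : Fin 3) : E3 →L[ℝ] ℝ := EuclideanSpace.proj i

namespace SingularityType

/-- The reference singular period 1-form `τ₀` (closed off the discriminant locus, multivalued,
with a fixed branch). For `κ = 1` it is `α db₁ + α₂ db₂ + α₃ db₃ + ζ₁ db₁ / (1 + b₁²)`; the last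
summand is a smooth 1-form that makes the total closed. For `κ = 2` it is
`- log |s| db₁ + Arg(s) db₂` with `s = b₁ + i b₂`. -/
def tauZero : SingularityType → E3 → (E3 →L[ℝ] ℝ)
  | oneTwo, b =>
      (hlAlpha b + hlRoot 1 b / (1 + b 0 ^ 2)) • dcoord 0 +
        hlAngle 1 2 b • dcoord 1 + hlAngle 2 1 b • dcoord 2
  | twoTwo, b =>
      (-Real.log ‖(⟨b 0, b 1⟩ : ℂ)‖) • dcoord 0 + Complex.arg ⟨b 0, b 1⟩ • dcoord 1

/-- The three period 1-forms `τ₀, τ₂, τ₃` in the normalising coordinates, without the smooth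
exact summand. For `κ = 1`: `τ₂ = π db₂`, `τ₃ = π db₃`; for `κ = 2`: `τ₂ = 2π db₂`,
`τ₃ = db₃`. -/
def stdPeriod : SingularityType → Fin 3 → E3 → (E3 →L[ℝ] ℝ)
  | κ, 0 => κ.tauZero
  | oneTwo, 1 => fun _ => Real.pi • dcoord 1
  | oneTwo, 2 => fun _ => Real.pi • dcoord 2
  | twoTwo, 1 => fun _ => (2 * Real.pi) • dcoord 1
  | twoTwo, 2 => fun _ => dcoord 2

/-- The period 1-forms `τ₁ = y^*τ₀ + dH`, `τ₂ = y^*(std)`, `τ₃ = y^*(std)` (indices `0, 1, 2`)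
in normalising coordinates `y`. -/
def periodForm (κ : SingularityType) (y : E3 → E3) (H : E3 → ℝ) (i : Fin 3) (b : E3) :
    E3 →L[ℝ] ℝ :=
  (κ.stdPeriod i (y b)).comp (fderiv ℝ y b) + if i = 0 then fderiv ℝ H b else 0

end SingularityType

/-- `y^*τ₀ + dH` is the singular period of `(X, ω, f)`: `H` is a smooth function on `B` such that
the period lattice off the discriminant locus is generated by `y^*τ₀ + dH`, `τ₂`, `τ₃`. -/
structure HasSingularPeriod (κ : SingularityType) (B : Set E3) (y : E3 → E3)
    (F : FibrationTriple.{u}) (H : E3 → ℝ) : Prop where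
  smooth : ContDiffOn ℝ ∞ H B
  lattice : ∀ b ∈ B, y b ∉ κ.disc → ∀ l : E3 →L[ℝ] ℝ,
    F.IsPeriod b l ↔ ∃ n : Fin 3 → ℤ, l = ∑ i, n i • κ.periodForm y H i b

/-! ### Flatness and formal equivalence -/

/-- `h` is flat at `S`: it vanishes on `S` together with all its partial derivatives. -/
def IsFlatAt (h : E3 → ℝ) (S : Set E3) : Prop :=
  ∀ b ∈ S, ∀ n : ℕ, iteratedFDeriv ℝ n h b = 0

/-- `φ` is tangent to the identity (to infinite order) at `S`. -/
def IsTangentToIdAt (φ : E3 → E3) (S : Set E3) : Prop :=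
  ∀ i : Fin 3, IsFlatAt (fun b => φ b i - b i) S

/-- Formal equivalence of `F` and `F'`, two fibrations of type `κ` over the same base `B` and with
the same discriminant locus, whose singular periods are `y^*τ₀ + dH` and `y'^*τ₀ + dH'`: the
difference `H - H'` is flat at the discriminant locus. The functions `H` and `H'` are
determined by the singular periods only up to additive constants, whence the `c`. The
normalising coordinates `y` and `y'` are required to agree to infinite order at the discriminant
locus, so that they may be taken for the same coordinates there. -/
structure FormallyEquivalent (κ : SingularityType) (B : Set E3) (b₀ : E3)
    (y : E3 → E3) (F : FibrationTriple.{u}) (H : E3 → ℝ)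
    (y' : E3 → E3) (F' : FibrationTriple.{v}) (H' : E3 → ℝ) : Prop where
  left : IsFibrationOfType κ B b₀ y F
  right : IsFibrationOfType κ B b₀ y' F'
  left_period : HasSingularPeriod κ B y F H
  right_period : HasSingularPeriod κ B y' F' H'
  disc_eq : F.f '' F.crit = F'.f '' F'.crit
  coord_tangent : ∀ i : Fin 3, IsFlatAt (fun b => y' b i - y b i) (F.f '' F.crit)
  flat : ∃ c : ℝ, IsFlatAt (fun b => H b - H' b - c) (F.f '' F.crit)

/-- `φ^* τ'ᵢ = τᵢ` on `W` for `i = 1, 2, 3`, for the period 1-forms `τᵢ`, `τ'ᵢ` with singular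
periods `τ₀ + dH`, `τ₀ + dH'`. Equality of these forms, which live off the discriminant locus,
comprises the equality of their domains. -/
structure MatchesPeriods (κ : SingularityType) (W : Set E3) (φ : E3 → E3)
    (H H' : E3 → ℝ) : Prop where
  domain : ∀ b ∈ W, φ b ∈ κ.disc ↔ b ∈ κ.disc
  pullback : ∀ b ∈ W, b ∉ κ.disc → ∀ i : Fin 3,
    (κ.periodForm id H' i (φ b)).comp (fderiv ℝ φ b) = κ.periodForm id H i b

/-- The local homeomorphism `φ` is a smooth diffeomorphism from its source to its target. -/
def IsSmoothDiffeo (φ : OpenPartialHomeomorph E3 E3) : Prop :=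
  ContDiffOn ℝ ∞ φ φ.source ∧ ContDiffOn ℝ ∞ φ.symm φ.target

end

/-! Since `τ₂` and `τ₃` are constant multiples of `db₂` and `db₃`, a map that matches them changes
`b₂` and `b₃` only by local constants, and tangency at Δ makes these zero near Δ. So near Δ the
diffeomorphism is a shear `φ(b) = b + g(b) e`, with `e` the first coordinate direction and `g` flat
at Δ. Let `T` be a form closed along lines parallel to `e`, and `A = T(e)`. Then `φ^*T - T` is the
differential of `∫₀^{g(b)} A(b + t e) dt`, which is `g` times the mean of `A` over the segment from
`b` to `φ(b)`. Matching the singular periods thus becomes one scalar equation: `g` times a mean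
equals `h = H - H'` up to a constant (part 1, with `T = τ₀ + dH'`) or `H - H' ∘ φ` up to a constant
(part 2, with `T = τ₀`).

It remains to transfer flatness through this equation. The derivatives of `A` blow up at Δ, but only
polynomially in the inverse of the distance `ρ` to Δ, while flat functions decay with all
derivatives faster than any power of `ρ`. In part 2, `g` is flat, so the product is flat
(`IsTameForm.exists_flat_primitive`), and connectedness of the discriminant locus makes the local
constants agree. In part 1, `|A|` tends to infinity at the base point, so `A` has a fixed sign and
`|A| ≥ 1` nearby. Then the equation has a solution with `|g| ≤ |h|`, implicit differentiation bounds
the derivatives of `g` polynomially, and `g = h / mean` is flat (`IsTameForm.exists_flat_shear`).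
Extension by zero over Δ is smooth. Only `A` needs to be smooth; the other coefficients matter only
along lines parallel to `e`, so branch jumps elsewhere are harmless.

What has to be known of `τ₀` is therefore growth of `A`, closedness along these lines, and
divergence at the base point. For κ = 2 all is explicit, `A = -log|s|`. For κ = 1 the substitution
`P_b(x) = u²` turns the elliptic integrals into integrals over `[0, 1]` of expressions in the
largest solution `R(b, u)` and `1 / P_b'(R)`. Now Δ is exactly the set where the largest root of
`P_b` is a double root, and quantitatively `ρ² ≤ (R + 1) P_b'(R)` (`sq_infDist_le_hlPolyDeriv`).
Closedness comes from an explicit primitive off the plane `b₁ = 0` (`hasFDerivAt_hlS`) and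
continuity of the angles across that plane. -/

/-! ### Functions whose derivatives have prescribed growth -/

section Growth

variable {E E' F F' G : Type} [NormedAddCommGroup E] [NormedSpace ℝ E]
  [NormedAddCommGroup E'] [NormedSpace ℝ E'] [NormedAddCommGroup F] [NormedSpace ℝ F]
  [NormedAddCommGroup F'] [NormedSpace ℝ F'] [NormedAddCommGroup G] [NormedSpace ℝ G]

/-- The positive weight `ρ ≤ 1` on the open set `Ω`. -/
structure IsWeight (Ω : Set E) (ρ : E → ℝ) : Prop where
  isOpen : IsOpen Ω
  pos : ∀ x ∈ Ω, 0 < ρ x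
  le_one : ∀ x ∈ Ω, ρ x ≤ 1

/-- The derivatives of `f` of order up to `n` are `O(ρ ^ N)` on `Ω`. -/
def HasGrowth (Ω : Set E) (ρ : E → ℝ) (N : ℤ) :
    ℕ → ∀ {F : Type} [NormedAddCommGroup F] [NormedSpace ℝ F], (E → F) → Prop
  | 0, _, _, _, f => ∃ C, ∀ x ∈ Ω, ‖f x‖ ≤ C * ρ x ^ N
  | n + 1, _, _, _, f => (∃ C, ∀ x ∈ Ω, ‖f x‖ ≤ C * ρ x ^ N) ∧ DifferentiableOn ℝ f Ω ∧
      HasGrowth Ω ρ N n (fderiv ℝ f)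

/-- The derivatives of `f` of order up to `n` grow at most polynomially in `1 / ρ`. -/
def IsPolyGrowth (Ω : Set E) (ρ : E → ℝ) (n : ℕ) (f : E → F) : Prop :=
  ∃ N : ℤ, HasGrowth Ω ρ N n f

/-- All derivatives of `f` decay faster than any power of `ρ`. -/
def IsFlatGrowth (Ω : Set E) (ρ : E → ℝ) (f : E → F) : Prop :=
  ∀ (n : ℕ) (N : ℤ), HasGrowth Ω ρ N n f

variable {Ω : Set E} {ρ : E → ℝ} {N M : ℤ} {n : ℕ} {f g : E → F}

namespace HasGrowth

theorem bound (h : HasGrowth Ω ρ N n f) : ∃ C, ∀ x ∈ Ω, ‖f x‖ ≤ C * ρ x ^ N := by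
  cases n with
  | zero => exact h
  | succ n => exact h.1

theorem of_succ (h : HasGrowth Ω ρ N (n + 1) f) : HasGrowth Ω ρ N n f := by
  induction n generalizing F with
  | zero => exact h.1
  | succ n ih => exact ⟨h.1, h.2.1, ih h.2.2⟩

theorem mono_exp (hρ : IsWeight Ω ρ) (h : HasGrowth Ω ρ N n f) (hMN : M ≤ N) :
    HasGrowth Ω ρ M n f := by
  have key : ∀ {F : Type} [NormedAddCommGroup F] [NormedSpace ℝ F] {f : E → F},
      (∃ C, ∀ x ∈ Ω, ‖f x‖ ≤ C * ρ x ^ N) → ∃ C, ∀ x ∈ Ω, ‖f x‖ ≤ C * ρ x ^ M := by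
    rintro F _ _ f ⟨C, hC⟩
    refine ⟨|C|, fun x hx => (hC x hx).trans ?_⟩
    have h1 : ρ x ^ N ≤ ρ x ^ M :=
      zpow_le_zpow_right_of_le_one₀ (hρ.pos x hx) (hρ.le_one x hx) hMN
    have h2 : (0 : ℝ) ≤ ρ x ^ N := (zpow_pos (hρ.pos x hx) _).le
    exact mul_le_mul (le_abs_self C) h1 h2 (abs_nonneg C)
  induction n generalizing F with
  | zero => exact key h
  | succ n ih => exact ⟨key h.1, h.2.1, ih h.2.2⟩

theorem congr (hΩ : IsOpen Ω) (h : HasGrowth Ω ρ N n f) (hfg : EqOn g f Ω) :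
    HasGrowth Ω ρ N n g := by
  induction n generalizing F with
  | zero =>
    obtain ⟨C, hC⟩ := h
    exact ⟨C, fun x hx => by rw [hfg hx]; exact hC x hx⟩
  | succ n ih =>
    obtain ⟨⟨C, hC⟩, hd, h'⟩ := h
    refine ⟨⟨C, fun x hx => by rw [hfg hx]; exact hC x hx⟩, hd.congr hfg, ih h' ?_⟩
    intro x hx
    exact Filter.EventuallyEq.fderiv_eq (hfg.eventuallyEq_of_mem (hΩ.mem_nhds hx))

theorem mono_set {Ω' : Set E} (h : HasGrowth Ω ρ N n f) (hs : Ω' ⊆ Ω) :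
    HasGrowth Ω' ρ N n f := by
  induction n generalizing F with
  | zero => exact h.imp fun C hC x hx => hC x (hs hx)
  | succ n ih => exact ⟨h.1.imp fun C hC x hx => hC x (hs hx), h.2.1.mono hs, ih h.2.2⟩

theorem clm (hΩ : IsWeight Ω ρ) (L : F →L[ℝ] F') (h : HasGrowth Ω ρ N n f) :
    HasGrowth Ω ρ N n (fun x => L (f x)) := by
  have key : ∀ {F F' : Type} [NormedAddCommGroup F] [NormedSpace ℝ F] [NormedAddCommGroup F']
      [NormedSpace ℝ F'] (L : F →L[ℝ] F') {f : E → F},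
      (∃ C, ∀ x ∈ Ω, ‖f x‖ ≤ C * ρ x ^ N) → ∃ C, ∀ x ∈ Ω, ‖L (f x)‖ ≤ C * ρ x ^ N := by
    rintro F F' _ _ _ _ L f ⟨C, hC⟩
    refine ⟨‖L‖ * C, fun x hx => (L.le_opNorm _).trans ?_⟩
    rw [mul_assoc]
    exact mul_le_mul_of_nonneg_left (hC x hx) (norm_nonneg _)
  induction n generalizing F F' with
  | zero => exact key L h
  | succ n ih =>
    refine ⟨key L h.1, L.differentiable.comp_differentiableOn h.2.1, ?_⟩
    refine (ih (ContinuousLinearMap.compL ℝ E F F' L) h.2.2).congr hΩ.isOpen ?_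
    intro x hx
    exact (L.hasFDerivAt.comp x (h.2.1.differentiableAt (hΩ.isOpen.mem_nhds hx)).hasFDerivAt).fderiv

theorem add (hΩ : IsWeight Ω ρ) (hf : HasGrowth Ω ρ N n f) (hg : HasGrowth Ω ρ N n g) :
    HasGrowth Ω ρ N n (fun x => f x + g x) := by
  have key : ∀ {F : Type} [NormedAddCommGroup F] [NormedSpace ℝ F] {f g : E → F},
      (∃ C, ∀ x ∈ Ω, ‖f x‖ ≤ C * ρ x ^ N) → (∃ C, ∀ x ∈ Ω, ‖g x‖ ≤ C * ρ x ^ N) →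
      ∃ C, ∀ x ∈ Ω, ‖f x + g x‖ ≤ C * ρ x ^ N := by
    rintro F _ _ f g ⟨C, hC⟩ ⟨D, hD⟩
    refine ⟨C + D, fun x hx => (norm_add_le _ _).trans ?_⟩
    rw [add_mul]
    exact add_le_add (hC x hx) (hD x hx)
  induction n generalizing F with
  | zero => exact key hf hg
  | succ n ih =>
    refine ⟨key hf.1 hg.1, hf.2.1.add hg.2.1, (ih hf.2.2 hg.2.2).congr hΩ.isOpen ?_⟩
    intro x hx
    exact fderiv_fun_add (hf.2.1.differentiableAt (hΩ.isOpen.mem_nhds hx))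
      (hg.2.1.differentiableAt (hΩ.isOpen.mem_nhds hx))

theorem bilin (hΩ : IsWeight Ω ρ) (B : F →L[ℝ] F' →L[ℝ] G) {g : E → F'}
    (hf : HasGrowth Ω ρ N n f) (hg : HasGrowth Ω ρ M n g) :
    HasGrowth Ω ρ (N + M) n (fun x => B (f x) (g x)) := by
  have key : ∀ {F F' G : Type} [NormedAddCommGroup F] [NormedSpace ℝ F] [NormedAddCommGroup F']
      [NormedSpace ℝ F'] [NormedAddCommGroup G] [NormedSpace ℝ G] (B : F →L[ℝ] F' →L[ℝ] G)
      {f : E → F} {g : E → F'},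
      (∃ C, ∀ x ∈ Ω, ‖f x‖ ≤ C * ρ x ^ N) → (∃ C, ∀ x ∈ Ω, ‖g x‖ ≤ C * ρ x ^ M) →
      ∃ C, ∀ x ∈ Ω, ‖B (f x) (g x)‖ ≤ C * ρ x ^ (N + M) := by
    rintro F F' G _ _ _ _ _ _ B f g ⟨C, hC⟩ ⟨D, hD⟩
    refine ⟨‖B‖ * C * D, fun x hx => (B.le_opNorm₂ _ _).trans ?_⟩
    have h0 := hC x hx
    have h1 := hD x hx
    rw [zpow_add₀ (hΩ.pos x hx).ne']
    calc ‖B‖ * ‖f x‖ * ‖g x‖ ≤ ‖B‖ * (C * ρ x ^ N) * (D * ρ x ^ M) := by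
          have := norm_nonneg B
          have := (norm_nonneg _).trans h0
          gcongr
      _ = _ := by ring
  induction n generalizing F F' G with
  | zero => exact key B hf hg
  | succ n ih =>
    have hd : ∀ x ∈ Ω, HasFDerivAt (fun x => B (f x) (g x))
        (B.precompR E (f x) (fderiv ℝ g x) + B.precompL E (fderiv ℝ f x) (g x)) x := fun x hx =>
      B.hasFDerivAt_of_bilinear
        (hf.2.1.differentiableAt (hΩ.isOpen.mem_nhds hx)).hasFDerivAt
        (hg.2.1.differentiableAt (hΩ.isOpen.mem_nhds hx)).hasFDerivAt
    refine ⟨key B hf.1 hg.1, fun x hx => (hd x hx).differentiableAt.differentiableWithinAt, ?_⟩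
    exact (add hΩ (ih (B.precompR E) hf.of_succ hg.2.2) (ih (B.precompL E) hf.2.2 hg.of_succ)).congr
      hΩ.isOpen fun x hx => (hd x hx).fderiv

/-- One order is lost because the derivative of top order is only bounded, whereas the one below it
is differentiable and hence continuous. -/
theorem contDiffOn (hΩ : IsOpen Ω) (h : HasGrowth Ω ρ N (n + 1) f) : ContDiffOn ℝ n f Ω := by
  induction n generalizing F with
  | zero => exact contDiffOn_zero.2 h.2.1.continuousOn
  | succ n ih =>
    push_cast
    refine (contDiffOn_succ_iff_fderiv_of_isOpen hΩ).2 ⟨h.2.1, by simp, ih h.2.2⟩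

end HasGrowth

/-! ### Calculus of functions of polynomial growth. -/

namespace IsPolyGrowth

theorem bound (h : IsPolyGrowth Ω ρ n f) (hρ : IsWeight Ω ρ) :
    ∃ (N : ℕ) (C : ℝ), 0 ≤ C ∧ ∀ x ∈ Ω, ‖f x‖ * ρ x ^ N ≤ C := by
  obtain ⟨N, hN⟩ := h
  obtain ⟨C, hC⟩ := (hN.mono_exp hρ (M := -(N.natAbs : ℤ)) (by omega)).bound
  refine ⟨N.natAbs, |C|, abs_nonneg _, fun x hx => ?_⟩
  have h1 := hC x hx
  rw [zpow_neg, zpow_natCast] at h1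
  have h2 := pow_pos (hρ.pos x hx) N.natAbs
  calc ‖f x‖ * ρ x ^ N.natAbs ≤ C * (ρ x ^ N.natAbs)⁻¹ * ρ x ^ N.natAbs := by gcongr
    _ = C := by field_simp
    _ ≤ |C| := le_abs_self C

theorem zero_of_bound (N : ℕ) (C : ℝ) (hρ : IsWeight Ω ρ)
    (h : ∀ x ∈ Ω, ‖f x‖ * ρ x ^ N ≤ C) : IsPolyGrowth Ω ρ 0 f := by
  refine ⟨-(N : ℤ), C, fun x hx => ?_⟩
  have h2 := pow_pos (hρ.pos x hx) N
  rw [zpow_neg, zpow_natCast, ← div_eq_mul_inv, le_div_iff₀ h2]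
  exact h x hx

theorem of_succ (h : IsPolyGrowth Ω ρ (n + 1) f) : IsPolyGrowth Ω ρ n f :=
  h.imp fun _ hN => hN.of_succ

theorem fderiv (h : IsPolyGrowth Ω ρ (n + 1) f) : IsPolyGrowth Ω ρ n (fderiv ℝ f) :=
  h.imp fun _ hN => hN.2.2

theorem differentiableOn (h : IsPolyGrowth Ω ρ (n + 1) f) : DifferentiableOn ℝ f Ω :=
  h.choose_spec.2.1

theorem zero (h : IsPolyGrowth Ω ρ n f) : IsPolyGrowth Ω ρ 0 f :=
  h.imp fun _ hN => hN.bound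

theorem succ (hρ : IsWeight Ω ρ) (h0 : IsPolyGrowth Ω ρ 0 f) (hd : DifferentiableOn ℝ f Ω)
    (h : IsPolyGrowth Ω ρ n (_root_.fderiv ℝ f)) : IsPolyGrowth Ω ρ (n + 1) f := by
  obtain ⟨N, hN⟩ := h0
  obtain ⟨M, hM⟩ := h
  exact ⟨min N M, hN.mono_exp hρ (min_le_left _ _), hd, hM.mono_exp hρ (min_le_right _ _)⟩

theorem congr (hΩ : IsWeight Ω ρ) (h : IsPolyGrowth Ω ρ n f) (hfg : EqOn g f Ω) :
    IsPolyGrowth Ω ρ n g :=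
  h.imp fun _ hN => hN.congr hΩ.isOpen hfg

theorem mono_set {Ω' : Set E} (h : IsPolyGrowth Ω ρ n f) (hs : Ω' ⊆ Ω) : IsPolyGrowth Ω' ρ n f :=
  h.imp fun _ hN => hN.mono_set hs

theorem clm (hΩ : IsWeight Ω ρ) (L : F →L[ℝ] F') (h : IsPolyGrowth Ω ρ n f) :
    IsPolyGrowth Ω ρ n (fun x => L (f x)) :=
  h.imp fun _ hN => hN.clm hΩ L

theorem add (hΩ : IsWeight Ω ρ) (hf : IsPolyGrowth Ω ρ n f) (hg : IsPolyGrowth Ω ρ n g) :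
    IsPolyGrowth Ω ρ n (fun x => f x + g x) := by
  obtain ⟨N, hN⟩ := hf
  obtain ⟨M, hM⟩ := hg
  exact ⟨min N M, (hN.mono_exp hΩ (min_le_left _ _)).add hΩ (hM.mono_exp hΩ (min_le_right _ _))⟩

theorem bilin (hΩ : IsWeight Ω ρ) (B : F →L[ℝ] F' →L[ℝ] G) {g : E → F'}
    (hf : IsPolyGrowth Ω ρ n f) (hg : IsPolyGrowth Ω ρ n g) :
    IsPolyGrowth Ω ρ n (fun x => B (f x) (g x)) := by
  obtain ⟨N, hN⟩ := hf
  obtain ⟨M, hM⟩ := hg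
  exact ⟨N + M, hN.bilin hΩ B hM⟩

theorem smul (hΩ : IsWeight Ω ρ) {c : E → ℝ} (hc : IsPolyGrowth Ω ρ n c)
    (hf : IsPolyGrowth Ω ρ n f) : IsPolyGrowth Ω ρ n (fun x => c x • f x) :=
  bilin hΩ (ContinuousLinearMap.lsmul ℝ ℝ) hc hf

theorem mul (hΩ : IsWeight Ω ρ) {c d : E → ℝ} (hc : IsPolyGrowth Ω ρ n c)
    (hd : IsPolyGrowth Ω ρ n d) : IsPolyGrowth Ω ρ n (fun x => c x * d x) :=
  bilin hΩ (ContinuousLinearMap.mul ℝ ℝ) hc hd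

theorem neg (hΩ : IsWeight Ω ρ) (hf : IsPolyGrowth Ω ρ n f) :
    IsPolyGrowth Ω ρ n (fun x => -f x) :=
  (hf.clm hΩ (-ContinuousLinearMap.id ℝ F)).congr hΩ fun x _ => by simp

theorem sub (hΩ : IsWeight Ω ρ) (hf : IsPolyGrowth Ω ρ n f) (hg : IsPolyGrowth Ω ρ n g) :
    IsPolyGrowth Ω ρ n (fun x => f x - g x) :=
  (hf.add hΩ (hg.neg hΩ)).congr hΩ fun _ _ => sub_eq_add_neg _ _

theorem const (c : F) : IsPolyGrowth Ω ρ n (fun _ : E => c) := by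
  refine ⟨0, ?_⟩
  induction n generalizing F with
  | zero => exact ⟨‖c‖, fun x _ => by simp⟩
  | succ n ih =>
    refine ⟨⟨‖c‖, fun x _ => by simp⟩, differentiableOn_const c, ?_⟩
    have : _root_.fderiv ℝ (fun _ : E => c) = fun _ => 0 := by ext1 x; simp
    rw [this]
    exact ih 0

theorem linear (hΩ : IsWeight Ω ρ) (hb : ∃ C, ∀ x ∈ Ω, ‖x‖ ≤ C) (L : E →L[ℝ] F) :
    IsPolyGrowth Ω ρ n (fun x => L x) := by
  obtain ⟨C, hC⟩ := hb
  have h0 : IsPolyGrowth Ω ρ 0 (fun x => L x) := by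
    refine zero_of_bound 0 (‖L‖ * C) hΩ fun x hx => ?_
    rw [pow_zero, mul_one]
    exact (L.le_opNorm x).trans (mul_le_mul_of_nonneg_left (hC x hx) (norm_nonneg _))
  cases n with
  | zero => exact h0
  | succ n =>
    refine succ hΩ h0 L.differentiable.differentiableOn ?_
    have : _root_.fderiv ℝ (fun x => L x) = fun _ => L := by ext1 x; exact L.fderiv
    rw [this]
    exact const L

theorem prodMk (hΩ : IsWeight Ω ρ) {g : E → F'} (hf : IsPolyGrowth Ω ρ n f)
    (hg : IsPolyGrowth Ω ρ n g) : IsPolyGrowth Ω ρ n (fun x => (f x, g x)) :=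
  ((hf.clm hΩ (ContinuousLinearMap.inl ℝ F F')).add hΩ
    (hg.clm hΩ (ContinuousLinearMap.inr ℝ F F'))).congr hΩ fun x _ => by simp

/-- The lower bound by a power of `ρ` makes `1 / c` polynomially bounded, and `d(1/c) = -(1/c)(1/c)
dc` passes this on to higher derivatives by induction. -/
theorem inv (hΩ : IsWeight Ω ρ) {c : E → ℝ} (hc : IsPolyGrowth Ω ρ n c) (K : ℕ) (ε : ℝ)
    (hε : 0 < ε) (hlow : ∀ x ∈ Ω, ε * ρ x ^ K ≤ |c x|) :
    IsPolyGrowth Ω ρ n (fun x => (c x)⁻¹) := by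
  have hpos : ∀ x ∈ Ω, 0 < |c x| := fun x hx =>
    (mul_pos hε (pow_pos (hΩ.pos x hx) K)).trans_le (hlow x hx)
  have h0 : IsPolyGrowth Ω ρ 0 (fun x => (c x)⁻¹) := by
    refine zero_of_bound K ε⁻¹ hΩ fun x hx => ?_
    rw [norm_inv, Real.norm_eq_abs, inv_mul_le_iff₀ (hpos x hx), mul_comm, inv_mul_eq_div]
    rw [le_div_iff₀ hε, mul_comm]
    exact hlow x hx
  induction n with
  | zero => exact h0
  | succ n ih =>
    have hi := ih hc.of_succ
    have hd : ∀ x ∈ Ω, HasFDerivAt (fun x => (c x)⁻¹)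
        (-((c x)⁻¹ * (c x)⁻¹) • _root_.fderiv ℝ c x) x := fun x hx => by
      have h1 := (hasDerivAt_inv (abs_pos.1 (hpos x hx))).comp_hasFDerivAt x
        (hc.differentiableOn.differentiableAt (hΩ.isOpen.mem_nhds hx)).hasFDerivAt
      rw [← mul_inv, ← pow_two]
      exact h1
    refine succ hΩ h0 (fun x hx => (hd x hx).differentiableAt.differentiableWithinAt) ?_
    exact (smul hΩ ((hi.mul hΩ hi).neg hΩ) hc.fderiv).congr hΩ fun x hx => (hd x hx).fderiv

/-- The comparison of weights turns negative powers of `ρ'` at `φ x` into negative powers of `ρ` at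
`x`; derivatives follow from the chain rule by induction. -/
theorem comp {Ω' : Set E'} {ρ' : E' → ℝ} (hΩ : IsWeight Ω ρ) (hΩ' : IsWeight Ω' ρ')
    {h : E' → F} {φ : E → E'} (hh : IsPolyGrowth Ω' ρ' n h) (hφ : IsPolyGrowth Ω ρ n φ)
    (hm : MapsTo φ Ω Ω') {ε : ℝ} (hε : 0 < ε) (hlow : ∀ x ∈ Ω, ε * ρ x ≤ ρ' (φ x)) :
    IsPolyGrowth Ω ρ n (fun x => h (φ x)) := by
  have key : ∀ {F : Type} [NormedAddCommGroup F] [NormedSpace ℝ F] {h : E' → F},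
      IsPolyGrowth Ω' ρ' 0 h → IsPolyGrowth Ω ρ 0 (fun x => h (φ x)) := by
    intro F _ _ h hh
    obtain ⟨N, C, hC0, hC⟩ := hh.bound hΩ'
    refine zero_of_bound N (C / ε ^ N) hΩ fun x hx => ?_
    rw [le_div_iff₀ (pow_pos hε N), mul_assoc, ← mul_pow, mul_comm (ρ x)]
    refine le_trans ?_ (hC _ (hm hx))
    have := (mul_pos hε (hΩ.pos x hx)).le
    exact mul_le_mul_of_nonneg_left (pow_le_pow_left₀ this (hlow x hx) N) (norm_nonneg _)
  induction n generalizing F with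
  | zero => exact key hh
  | succ n ih =>
    have hd : ∀ x ∈ Ω, HasFDerivAt (fun x => h (φ x))
        ((_root_.fderiv ℝ h (φ x)).comp (_root_.fderiv ℝ φ x)) x := fun x hx =>
      (hh.differentiableOn.differentiableAt (hΩ'.isOpen.mem_nhds (hm hx))).hasFDerivAt.comp x
        (hφ.differentiableOn.differentiableAt (hΩ.isOpen.mem_nhds hx)).hasFDerivAt
    refine succ hΩ (key hh.zero) (fun x hx => (hd x hx).differentiableAt.differentiableWithinAt) ?_
    exact (bilin hΩ (ContinuousLinearMap.compL ℝ E E' F) (ih hh.fderiv hφ.of_succ)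
      hφ.fderiv).congr hΩ fun x hx => (hd x hx).fderiv

theorem contDiffOn (hΩ : IsWeight Ω ρ) (h : ∀ n, IsPolyGrowth Ω ρ n f) : ContDiffOn ℝ ∞ f Ω :=
  contDiffOn_infty.2 fun n => (h (n + 1)).choose_spec.contDiffOn hΩ.isOpen

theorem of_contDiffOn {U K : Set E} (hU : IsOpen U) (hK : IsCompact K) (hKU : K ⊆ U)
    (hΩK : Ω ⊆ K) (hf : ContDiffOn ℝ ∞ f U) : IsPolyGrowth Ω ρ n f := by
  refine ⟨0, ?_⟩
  have key : ∀ {F : Type} [NormedAddCommGroup F] [NormedSpace ℝ F] {f : E → F},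
      ContDiffOn ℝ ∞ f U → ∃ C, ∀ x ∈ Ω, ‖f x‖ ≤ C * ρ x ^ (0 : ℤ) := by
    intro F _ _ f hf
    obtain ⟨C, hC⟩ := hK.exists_bound_of_continuousOn (hf.continuousOn.mono hKU)
    exact ⟨C, fun x hx => by simpa using hC x (hΩK hx)⟩
  induction n generalizing F with
  | zero => exact key hf
  | succ n ih =>
    have h := (contDiffOn_infty_iff_fderiv_of_isOpen hU).1 hf
    exact ⟨key hf, h.1.mono (hΩK.trans hKU), ih h.2⟩

/-- A continuous solution of `H (x, ψ x) = 0` has polynomial growth. -/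
theorem implicit [CompleteSpace E] {Ω₂ : Set (E × ℝ)} (hΩ : IsWeight Ω ρ)
    (hΩ₂ : IsWeight Ω₂ (fun p => ρ p.1)) (hb : ∃ C, ∀ x ∈ Ω, ‖x‖ ≤ C) {H : E × ℝ → ℝ} {ψ : E → ℝ}
    (hH : ∀ n, IsPolyGrowth Ω₂ (fun p => ρ p.1) n H) (hψ : ContinuousOn ψ Ω)
    (hm : ∀ x ∈ Ω, (x, ψ x) ∈ Ω₂) (h0 : ∀ x ∈ Ω, H (x, ψ x) = 0)
    (hψb : ∃ C, ∀ x ∈ Ω, ‖ψ x‖ ≤ C) (K : ℕ) (ε : ℝ) (hε : 0 < ε)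
    (hlow : ∀ x ∈ Ω, ε * ρ x ^ K ≤ |_root_.fderiv ℝ H (x, ψ x) (0, 1)|) (n : ℕ) :
    IsPolyGrowth Ω ρ n ψ := by
  have hcd := contDiffOn hΩ₂ hH
  have hpos : ∀ x ∈ Ω, _root_.fderiv ℝ H (x, ψ x) (0, 1) ≠ 0 := fun x hx =>
    abs_pos.1 ((mul_pos hε (pow_pos (hΩ.pos x hx) K)).trans_le (hlow x hx))
  -- Being continuous, `ψ` stays in the neighbourhood where the zero set of `H` is the graph of the
  -- implicit function, so it agrees locally with that function.
  have hdiff : ∀ x ∈ Ω, DifferentiableAt ℝ ψ x := by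
    intro x hx
    have hs : HasStrictFDerivAt H (_root_.fderiv ℝ H (x, ψ x)) (x, ψ x) :=
      (hcd.contDiffAt (hΩ₂.isOpen.mem_nhds (hm x hx))).hasStrictFDerivAt (by simp)
    have hinv : (_root_.fderiv ℝ H (x, ψ x) ∘L .inr ℝ E ℝ).IsInvertible := by
      refine ⟨ContinuousLinearEquiv.unitsEquivAut ℝ (Units.mk0 _ (hpos x hx)), ?_⟩
      ext
      simp
    have h1 := hs.eventually_apply_eq_iff_implicitFunctionOfProdDomain hinv
    have hc : ContinuousAt (fun y => (y, ψ y)) x :=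
      continuousAt_id.prodMk (hψ.continuousAt (hΩ.isOpen.mem_nhds hx))
    have h2 := hc.eventually h1
    refine (hs.hasStrictFDerivAt_implicitFunctionOfProdDomain hinv).hasFDerivAt.congr_of_eventuallyEq
      ?_ |>.differentiableAt
    filter_upwards [h2, hΩ.isOpen.mem_nhds hx] with y hy hyΩ
    exact (hy.1 (by rw [h0 y hyΩ, h0 x hx])).symm
  have hz : IsPolyGrowth Ω ρ 0 ψ := by
    obtain ⟨C, hC⟩ := hψb
    exact zero_of_bound 0 C hΩ fun x hx => by simpa using hC x hx
  -- The formula `ψ' = -(∂H/∂t)⁻¹ ∂H/∂x` drives the bootstrap: growth control of `ψ` to order `n`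
  -- controls the right-hand side to order `n`, hence `ψ` to order `n + 1`.
  have hform : ∀ x ∈ Ω, _root_.fderiv ℝ ψ x = -((_root_.fderiv ℝ H (x, ψ x) (0, 1))⁻¹ •
      (_root_.fderiv ℝ H (x, ψ x)).comp (ContinuousLinearMap.inl ℝ E ℝ)) := by
    intro x hx
    have h1 := ((hcd.contDiffAt (hΩ₂.isOpen.mem_nhds (hm x hx))).differentiableAt
      (by simp)).hasFDerivAt.comp x ((hasFDerivAt_id x).prodMk (hdiff x hx).hasFDerivAt)
    have h2 : HasFDerivAt (H ∘ fun y => (id y, ψ y)) (0 : E →L[ℝ] ℝ) x := by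
      refine (hasFDerivAt_const (0 : ℝ) x).congr_of_eventuallyEq ?_
      filter_upwards [hΩ.isOpen.mem_nhds hx] with y hy using h0 y hy
    have h3 := h1.unique h2
    ext v
    have h4 := DFunLike.congr_fun h3 v
    simp only [ContinuousLinearMap.comp_apply, ContinuousLinearMap.prod_apply,
      ContinuousLinearMap.id_apply, zero_apply] at h4
    have h5 : (v, _root_.fderiv ℝ ψ x v) =
        ((v, 0) : E × ℝ) + _root_.fderiv ℝ ψ x v • ((0, 1) : E × ℝ) := by simp
    rw [h5, map_add, map_smul, smul_eq_mul] at h4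
    have h6 := hpos x hx
    simp only [neg_apply, smul_apply,
      ContinuousLinearMap.comp_apply, ContinuousLinearMap.inl_apply, smul_eq_mul]
    field_simp
    linarith
  induction n with
  | zero => exact hz
  | succ n ih =>
    refine succ hΩ hz (fun x hx => (hdiff x hx).differentiableWithinAt) ?_
    have hg : IsPolyGrowth Ω ρ n (fun x => (x, ψ x)) :=
      (linear hΩ hb (ContinuousLinearMap.id ℝ E)).prodMk hΩ ih
    have hD : IsPolyGrowth Ω ρ n (fun x => _root_.fderiv ℝ H (x, ψ x)) :=
      comp hΩ hΩ₂ (hH (n + 1)).fderiv hg hm one_pos fun x _ => by simp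
    have h1 := (hD.clm hΩ (ContinuousLinearMap.apply ℝ ℝ ((0, 1) : E × ℝ))).inv hΩ K ε hε hlow
    have h2 := hD.clm hΩ
      ((ContinuousLinearMap.compL ℝ E (E × ℝ) ℝ).flip (ContinuousLinearMap.inl ℝ E ℝ))
    exact ((h1.smul hΩ h2).neg hΩ).congr hΩ hform

end IsPolyGrowth

/-- Differentiation under the integral sign. -/
theorem hasFDerivAt_integral_zero_one [CompleteSpace F] {I : Set ℝ} (hΩ : IsOpen Ω) (hI : IsOpen I)
    (hIcc : Icc (0 : ℝ) 1 ⊆ I) {f : E × ℝ → F} (hf : ContDiffOn ℝ 1 f (Ω ×ˢ I)) {x : E}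
    (hx : x ∈ Ω) :
    HasFDerivAt (fun x => ∫ s in (0 : ℝ)..1, f (x, s))
      (∫ s in (0 : ℝ)..1, (fderiv ℝ f (x, s)).comp (ContinuousLinearMap.inl ℝ E ℝ)) x := by
  have hO : IsOpen (Ω ×ˢ I) := hΩ.prod hI
  have hf' : ContinuousOn (fun p => (fderiv ℝ f p).comp (ContinuousLinearMap.inl ℝ E ℝ))
      (Ω ×ˢ I) :=
    ((ContinuousLinearMap.compL ℝ E (E × ℝ) F).flip
      (ContinuousLinearMap.inl ℝ E ℝ)).continuous.comp_continuousOn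
      (hf.continuousOn_fderiv_of_isOpen hO le_rfl)
  have hmk : ∀ y : E, Continuous fun s : ℝ => (y, s) := fun y => by fun_prop
  have hslice : ∀ {G : Type} [NormedAddCommGroup G] {h : E × ℝ → G}, ContinuousOn h (Ω ×ˢ I) →
      ∀ y ∈ Ω, ContinuousOn (fun s => h (y, s)) (uIcc (0 : ℝ) 1) := by
    intro G _ h hh y hy
    refine hh.comp (hmk y).continuousOn fun s hs => ⟨hy, hIcc ?_⟩
    rwa [uIcc_of_le zero_le_one] at hs
  -- Compactness of `[0, 1]` makes the bound on the partial derivative uniform in `s` for all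
  -- parameters near `x`, as dominated convergence requires.
  have hloc : ∃ C, ∃ W ∈ 𝓝 x, W ⊆ Ω ∧ ∀ y ∈ W, ∀ s ∈ Icc (0 : ℝ) 1,
      ‖(fderiv ℝ f (y, s)).comp (ContinuousLinearMap.inl ℝ E ℝ)‖ ≤ C := by
    obtain ⟨C, hC⟩ := isCompact_Icc.exists_bound_of_continuousOn
      (by simpa [uIcc_of_le] using hslice hf' x hx)
    have h1 : ∀ s ∈ Icc (0 : ℝ) 1, ∀ᶠ p : E × ℝ in 𝓝 x ×ˢ 𝓝 s,
        ‖(fderiv ℝ f p).comp (ContinuousLinearMap.inl ℝ E ℝ)‖ < C + 1 := by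
      intro s hs
      rw [← nhds_prod_eq]
      have := (hf'.continuousAt (hO.mem_nhds (x := (x, s)) ⟨hx, hIcc hs⟩)).norm
      exact this.eventually (gt_mem_nhds (by linarith [hC s hs]))
    have h2 := isCompact_Icc.eventually_forall_of_forall_eventually
      (P := fun (y : E) (s : ℝ) =>
        ‖(fderiv ℝ f (y, s)).comp (ContinuousLinearMap.inl ℝ E ℝ)‖ < C + 1)
      (fun s hs => by rw [nhds_prod_eq]; exact h1 s hs)
    exact ⟨C + 1, {y | ∀ s ∈ Icc (0 : ℝ) 1,
        ‖(fderiv ℝ f (y, s)).comp (ContinuousLinearMap.inl ℝ E ℝ)‖ < C + 1} ∩ Ω,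
      Filter.inter_mem h2 (hΩ.mem_nhds hx), inter_subset_right, fun y hy s hs => (hy.1 s hs).le⟩
  obtain ⟨C, W, hW, hWΩ, hC⟩ := hloc
  have hsub : ∀ s ∈ uIoc (0 : ℝ) 1, s ∈ Icc (0 : ℝ) 1 := fun s hs => by
    rw [uIoc_of_le zero_le_one] at hs
    exact Ioc_subset_Icc_self hs
  refine intervalIntegral.hasFDerivAt_integral_of_dominated_of_fderiv_le (bound := fun _ => C) hW
    ?_ ?_ ?_ (Filter.Eventually.of_forall fun s hs y hy => hC y hy s (hsub s hs))
    intervalIntegrable_const (Filter.Eventually.of_forall fun s hs y hy => ?_)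
  · filter_upwards [hΩ.mem_nhds hx] with y hy
    exact ((hslice hf.continuousOn y hy).mono uIoc_subset_uIcc).aestronglyMeasurable
      measurableSet_uIoc
  · exact (hslice hf.continuousOn x hx).intervalIntegrable
  · exact ((hslice hf' x hx).mono uIoc_subset_uIcc).aestronglyMeasurable measurableSet_uIoc
  · have h1 := (hf.contDiffAt (hO.mem_nhds (x := (y, s)) ⟨hWΩ hy, hIcc (hsub s hs)⟩)).differentiableAt one_ne_zero
    have h2 : HasFDerivAt (fun y : E => (y, s)) (ContinuousLinearMap.inl ℝ E ℝ) y :=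
      hasFDerivAt_prodMk_left y s
    exact h1.hasFDerivAt.comp y h2

/-- The weight does not depend on the variable of integration, so bounds pass through the integral,
and derivatives may be taken under it. The open set `I` around `[0, 1]` gives the integrand
derivatives at the endpoints too. -/
theorem IsPolyGrowth.integral [CompleteSpace F] {I : Set ℝ} (hΩ : IsWeight Ω ρ) (hI : IsOpen I)
    (hIcc : Icc (0 : ℝ) 1 ⊆ I) {f : E × ℝ → F}
    (hf : ∀ n, IsPolyGrowth (Ω ×ˢ I) (fun p => ρ p.1) n f) (n : ℕ) :
    IsPolyGrowth Ω ρ n (fun x => ∫ s in (0 : ℝ)..1, f (x, s)) := by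
  have hΩI : IsWeight (Ω ×ˢ I) (fun p : E × ℝ => ρ p.1) :=
    ⟨hΩ.isOpen.prod hI, fun p hp => hΩ.pos _ hp.1, fun p hp => hΩ.le_one _ hp.1⟩
  have key : ∀ {F : Type} [NormedAddCommGroup F] [NormedSpace ℝ F] {f : E × ℝ → F},
      IsPolyGrowth (Ω ×ˢ I) (fun p => ρ p.1) 0 f →
      IsPolyGrowth Ω ρ 0 (fun x => ∫ s in (0 : ℝ)..1, f (x, s)) := by
    intro F _ _ f hf
    obtain ⟨N, C, hC0, hC⟩ := hf.bound hΩI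
    refine zero_of_bound N C hΩ fun x hx => ?_
    have hp := pow_pos (hΩ.pos x hx) N
    rw [← le_div_iff₀ hp]
    have h1 : ‖∫ s in (0 : ℝ)..1, f (x, s)‖ ≤ C / ρ x ^ N * |1 - 0| := by
      refine intervalIntegral.norm_integral_le_of_norm_le_const fun s hs => ?_
      rw [uIoc_of_le zero_le_one] at hs
      rw [le_div_iff₀ hp]
      exact hC (x, s) ⟨hx, hIcc (Ioc_subset_Icc_self hs)⟩
    simpa using h1
  induction n generalizing F with
  | zero => exact key (hf 0)
  | succ n ih =>
    have hcd : ContDiffOn ℝ 1 f (Ω ×ˢ I) := (contDiffOn hΩI hf).of_le (by simp)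
    have hd := fun x hx => hasFDerivAt_integral_zero_one hΩ.isOpen hI hIcc hcd (x := x) hx
    refine succ hΩ (key (hf 0)) (fun x hx => (hd x hx).differentiableAt.differentiableWithinAt) ?_
    refine (ih (f := fun p => (_root_.fderiv ℝ f p).comp (ContinuousLinearMap.inl ℝ E ℝ))
      fun m => ?_).congr hΩ fun x hx => (hd x hx).fderiv
    exact (hf (m + 1)).fderiv.clm hΩI
      ((ContinuousLinearMap.compL ℝ E (E × ℝ) F).flip (ContinuousLinearMap.inl ℝ E ℝ))

/-! ### Flat functions: products, extension across a closed set, and decay. -/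

namespace IsFlatGrowth

theorem bound (h : IsFlatGrowth Ω ρ f) (N : ℕ) : ∃ C, 0 ≤ C ∧ ∀ x ∈ Ω, ‖f x‖ ≤ C * |ρ x| ^ N := by
  obtain ⟨C, hC⟩ := (h 0 N).bound
  refine ⟨|C|, abs_nonneg C, fun x hx => (hC x hx).trans ?_⟩
  rw [zpow_natCast, ← abs_pow, ← abs_mul]
  exact le_abs_self _

theorem mul (hΩ : IsWeight Ω ρ) {c d : E → ℝ} (hc : IsFlatGrowth Ω ρ c)
    (hd : ∀ n, IsPolyGrowth Ω ρ n d) : IsFlatGrowth Ω ρ (fun x => c x * d x) := by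
  intro n N
  obtain ⟨M, hM⟩ := hd n
  have := (hc n (N - M)).bilin hΩ (ContinuousLinearMap.mul ℝ ℝ) hM
  rwa [sub_add_cancel] at this

theorem congr (hΩ : IsWeight Ω ρ) (h : IsFlatGrowth Ω ρ f) (hfg : EqOn g f Ω) :
    IsFlatGrowth Ω ρ g :=
  fun n N => (h n N).congr hΩ.isOpen hfg

theorem mono_set {Ω' : Set E} (h : IsFlatGrowth Ω ρ f) (hs : Ω' ⊆ Ω) : IsFlatGrowth Ω' ρ f :=
  fun n N => (h n N).mono_set hs

theorem fderiv (h : IsFlatGrowth Ω ρ f) : IsFlatGrowth Ω ρ (fderiv ℝ f) :=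
  fun n N => (h (n + 1) N).2.2

theorem isPolyGrowth (h : IsFlatGrowth Ω ρ f) (n : ℕ) : IsPolyGrowth Ω ρ n f := ⟨0, h n 0⟩

end IsFlatGrowth

/-- A function that is flat off the closed set `D` and vanishes on `D` is smooth and flat. -/
theorem IsFlatGrowth.hasFDerivAt_zero {U D : Set E} (hU : IsOpen U)
    (hf : IsFlatGrowth (U \ D) (Metric.infDist · D) f) (hz : ∀ x ∈ U ∩ D, f x = 0) {p : E}
    (hp : p ∈ U ∩ D) : HasFDerivAt f (0 : E →L[ℝ] F) p := by
  obtain ⟨C, hC0, hC⟩ := hf.bound 2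
  -- Any exponent above one would do: the distance to `D` is at most the distance to `p`, so `f` is
  -- `O(‖x - p‖²)` and its derivative at `p` vanishes.
  have hle : ∀ x ∈ U, ‖f x‖ ≤ C * ‖x - p‖ ^ 2 := by
    intro x hx
    by_cases hxD : x ∈ D
    · rw [hz x ⟨hx, hxD⟩, norm_zero]; positivity
    · refine (hC x ⟨hx, hxD⟩).trans ?_
      have : |Metric.infDist x D| ≤ ‖x - p‖ := by
        rw [abs_of_nonneg Metric.infDist_nonneg, ← dist_eq_norm]
        exact Metric.infDist_le_dist_of_mem hp.2
      gcongr
  rw [hasFDerivAt_iff_isLittleO_nhds_zero]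
  have h1 : (fun h => f (p + h) - f p - (0 : E →L[ℝ] F) h) =O[𝓝 0] fun h : E => ‖h‖ ^ 2 := by
    refine Asymptotics.IsBigO.of_bound C ?_
    have : ∀ᶠ h : E in 𝓝 0, p + h ∈ U := by
      have hc : ContinuousAt (fun h : E => p + h) 0 := by fun_prop
      exact hc.eventually (hU.mem_nhds (by simpa using hp.1))
    filter_upwards [this] with h hh
    simpa [hz p hp] using hle _ hh
  exact h1.trans_isLittleO (Asymptotics.isLittleO_norm_pow_id one_lt_two)

/-- The derivative is again flat off `D` and vanishes on `D`, by `IsFlatGrowth.hasFDerivAt_zero`, so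
both claims propagate through all orders. -/
theorem IsFlatGrowth.contDiffOn_and_flat {U D : Set E} (hU : IsOpen U) (hD : IsClosed D)
    (hf : IsFlatGrowth (U \ D) (Metric.infDist · D) f) (hz : ∀ x ∈ U ∩ D, f x = 0) :
    ContDiffOn ℝ ∞ f U ∧ ∀ p ∈ U ∩ D, ∀ n, iteratedFDeriv ℝ n f p = 0 := by
  have hd : ∀ {F : Type} [NormedAddCommGroup F] [NormedSpace ℝ F] {f : E → F},
      IsFlatGrowth (U \ D) (Metric.infDist · D) f → (∀ x ∈ U ∩ D, f x = 0) →
      DifferentiableOn ℝ f U := by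
    intro F _ _ f hf hz x hx
    by_cases hxD : x ∈ D
    · exact (hf.hasFDerivAt_zero hU hz ⟨hx, hxD⟩).differentiableAt.differentiableWithinAt
    · exact ((hf 1 0).2.1.differentiableAt
        ((hU.sdiff hD).mem_nhds ⟨hx, hxD⟩)).differentiableWithinAt
  constructor
  · refine contDiffOn_infty.2 fun n => ?_
    induction n generalizing F with
    | zero => exact contDiffOn_zero.2 (hd hf hz).continuousOn
    | succ n ih =>
      push_cast
      exact (contDiffOn_succ_iff_fderiv_of_isOpen hU).2 ⟨hd hf hz, by simp,
        ih hf.fderiv fun x hx => (hf.hasFDerivAt_zero hU hz hx).fderiv⟩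
  · intro p hp n
    induction n generalizing F with
    | zero => ext; simp [hz p hp]
    | succ n ih =>
      have := ih hf.fderiv fun x hx => (hf.hasFDerivAt_zero hU hz hx).fderiv
      rw [← norm_eq_zero, ← norm_iteratedFDeriv_fderiv, this, norm_zero]

/-- A smooth function that is flat at `D` decays faster than any power of the distance to `D`. -/
theorem isFlatGrowth_of_contDiffOn [ProperSpace E] {U D : Set E} (hU : IsOpen U) (hD : IsClosed D)
    {x₀ : E} {r : ℝ} (hx₀ : x₀ ∈ D) (hr : r ≤ 1)
    (hrU : Metric.closedBall x₀ (2 * r) ⊆ U) (hf : ContDiffOn ℝ ∞ f U)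
    (hflat : ∀ p ∈ U ∩ D, ∀ n, iteratedFDeriv ℝ n f p = 0) :
    IsFlatGrowth (Metric.ball x₀ r \ D) (Metric.infDist · D) f := by
  -- Taylor's estimate without Taylor's formula: if the derivative is `O(‖y - p‖ ^ N)`, the mean
  -- value inequality on the segment from `p` to `y` gains one power for `f`, which vanishes at `p`.
  have key : ∀ (N : ℕ) {F : Type} [NormedAddCommGroup F] [NormedSpace ℝ F] {f : E → F},
      ContDiffOn ℝ ∞ f U → (∀ p ∈ U ∩ D, ∀ n, iteratedFDeriv ℝ n f p = 0) →
      ∃ C, ∀ p ∈ Metric.closedBall x₀ (2 * r) ∩ D, ∀ y ∈ Metric.closedBall x₀ (2 * r),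
        ‖f y‖ ≤ C * ‖y - p‖ ^ N := by
    intro N
    induction N with
    | zero =>
      intro F _ _ f hf _
      obtain ⟨C, hC⟩ := (isCompact_closedBall x₀ (2 * r)).exists_bound_of_continuousOn
        (hf.continuousOn.mono hrU)
      exact ⟨C, fun p _ y hy => by simpa using hC y hy⟩
    | succ N ih =>
      intro F _ _ f hf hflat
      have h := (contDiffOn_infty_iff_fderiv_of_isOpen hU).1 hf
      obtain ⟨C, hC⟩ := ih h.2 fun p hp n => by
        rw [← norm_eq_zero, norm_iteratedFDeriv_fderiv, hflat p hp, norm_zero]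
      refine ⟨|C|, fun p hp y hy => ?_⟩
      have hfp : f p = 0 := by
        rw [← norm_eq_zero, ← norm_iteratedFDeriv_zero (𝕜 := ℝ), hflat p ⟨hrU hp.1, hp.2⟩,
          norm_zero]
      have hseg : segment ℝ p y ⊆ Metric.closedBall x₀ (2 * r) :=
        (convex_closedBall x₀ (2 * r)).segment_subset hp.1 hy
      have h1 := (convex_segment p y).norm_image_sub_le_of_norm_hasFDerivWithin_le
        (f := f) (f' := _root_.fderiv ℝ f) (C := |C| * ‖y - p‖ ^ N)
        (fun z hz => (h.1.differentiableAt
          (hU.mem_nhds (hrU (hseg hz)))).hasFDerivAt.hasFDerivWithinAt)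
        (fun z hz => ?_) (left_mem_segment ℝ p y) (right_mem_segment ℝ p y)
      · rw [hfp, sub_zero] at h1
        rw [pow_succ, ← mul_assoc]
        exact h1
      · have hzp : ‖z - p‖ ≤ ‖y - p‖ := by
          rw [← dist_eq_norm, ← dist_eq_norm, dist_comm z, dist_comm y]
          obtain ⟨t, ht, rfl⟩ := mem_segment_iff_wbtw.1 hz
          rw [dist_left_lineMap, Real.norm_eq_abs, abs_of_nonneg ht.1]
          exact mul_le_of_le_one_left dist_nonneg ht.2
        calc ‖_root_.fderiv ℝ f z‖ ≤ C * ‖z - p‖ ^ N := hC p hp z (hseg hz)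
          _ ≤ |C| * ‖y - p‖ ^ N :=
            mul_le_mul (le_abs_self C) (pow_le_pow_left₀ (norm_nonneg _) hzp N) (by positivity)
              (abs_nonneg C)
  have bd : ∀ (N : ℤ) {F : Type} [NormedAddCommGroup F] [NormedSpace ℝ F] {f : E → F},
      ContDiffOn ℝ ∞ f U → (∀ p ∈ U ∩ D, ∀ n, iteratedFDeriv ℝ n f p = 0) →
      ∃ C, ∀ x ∈ Metric.ball x₀ r \ D, ‖f x‖ ≤ C * Metric.infDist x D ^ N := by
    intro N F _ _ f hf hflat
    obtain ⟨C, hC⟩ := key N.natAbs hf hflat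
    refine ⟨|C|, fun x hx => ?_⟩
    -- The centre lies in `D`, so the point of `D` nearest to `x` is within `r` of `x` and hence in
    -- the ball of radius `2r`.
    obtain ⟨p, hpD, hp⟩ := hD.exists_infDist_eq_dist ⟨x₀, hx₀⟩ x
    have hxr : dist x x₀ < r := hx.1
    have hr0 : 0 < r := dist_nonneg.trans_lt hxr
    have hpx : dist x p ≤ dist x x₀ := hp ▸ Metric.infDist_le_dist_of_mem hx₀
    have h1 := hC p ⟨?_, hpD⟩ x (by rw [Metric.mem_closedBall]; linarith)
    · have hpos : 0 < Metric.infDist x D := (hD.notMem_iff_infDist_pos ⟨x₀, hx₀⟩).1 hx.2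
      have hle1 : Metric.infDist x D ≤ 1 := by rw [hp]; linarith
      refine h1.trans ?_
      rw [← dist_eq_norm, ← hp, ← zpow_natCast]
      exact mul_le_mul (le_abs_self C)
        (zpow_le_zpow_right_of_le_one₀ hpos hle1 Int.le_natAbs) (by positivity) (abs_nonneg C)
    · rw [Metric.mem_closedBall]
      linarith [dist_triangle_left p x₀ x]
  intro n N
  have hrU' : Metric.ball x₀ r \ D ⊆ U := fun x hx => hrU (Metric.ball_subset_closedBall
    (Metric.ball_subset_ball (by
      have : 0 < r := dist_nonneg.trans_lt (Metric.mem_ball.1 hx.1)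
      linarith) hx.1))
  induction n generalizing F with
  | zero => exact bd N hf hflat
  | succ n ih =>
    have h := (contDiffOn_infty_iff_fderiv_of_isOpen hU).1 hf
    exact ⟨bd N hf hflat, h.1.mono hrU', ih h.2 fun p hp m => by
      rw [← norm_eq_zero, norm_iteratedFDeriv_fderiv, hflat p hp, norm_zero]⟩

end Growth

/-! ### Pulling back a closed form along a shear -/

section Shear

variable {E : Type} [NormedAddCommGroup E] {D : Set E} {e x₀ : E} {r R : ℝ}

theorem infDist_lt_of_mem_ball (hx₀ : x₀ ∈ D) {x : E} (hx : x ∈ Metric.ball x₀ r) :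
    Metric.infDist x D < r :=
  (Metric.infDist_le_dist_of_mem hx₀).trans_lt hx

theorem isWeight_infDist (hD : IsClosed D) (hx₀ : x₀ ∈ D) (hr : r ≤ 1) :
    IsWeight (Metric.ball x₀ r \ D) (Metric.infDist · D) :=
  ⟨Metric.isOpen_ball.sdiff hD, fun _ hx => (hD.notMem_iff_infDist_pos ⟨x₀, hx₀⟩).1 hx.2,
    fun _ hx => ((infDist_lt_of_mem_ball hx₀ hx.1).le).trans hr⟩

/-- The pairs `(b, t)` for which the segment from `b` to `b + t e` stays well away from `D`. -/
def shearDomain (D : Set E) (x₀ : E) (r : ℝ) : Set (E × ℝ) :=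
  {p | p.1 ∈ Metric.ball x₀ r \ D ∧ |p.2| < Metric.infDist p.1 D / 2}

theorem isOpen_shearDomain (hD : IsClosed D) : IsOpen (shearDomain D x₀ r) := by
  refine ((Metric.isOpen_ball.sdiff hD).preimage continuous_fst).inter ?_
  exact isOpen_lt (by fun_prop) (((Metric.continuous_infDist_pt D).comp continuous_fst).div_const 2)

theorem isWeight_shearDomain (hD : IsClosed D) (hx₀ : x₀ ∈ D) (hr : r ≤ 1) :
    IsWeight (shearDomain D x₀ r) (fun p => Metric.infDist p.1 D) :=
  ⟨isOpen_shearDomain hD, fun _ hp => (isWeight_infDist hD hx₀ hr).pos _ hp.1,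
    fun _ hp => (isWeight_infDist hD hx₀ hr).le_one _ hp.1⟩

theorem shearDomain_bounded (hx₀ : x₀ ∈ D) (hr : r ≤ 1) :
    ∀ p ∈ shearDomain D x₀ r, ‖p‖ ≤ ‖x₀‖ + 1 := by
  intro p hp
  have h0 := infDist_lt_of_mem_ball hx₀ hp.1.1
  have h1 : dist p.1 x₀ < r := hp.1.1
  have h2 := hp.2
  have h3 := norm_le_norm_add_norm_sub' p.1 x₀
  rw [← dist_eq_norm] at h3
  have := norm_nonneg x₀
  refine max_le (by linarith) ?_
  rw [Real.norm_eq_abs]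
  have : 0 ≤ Metric.infDist p.1 D := Metric.infDist_nonneg
  linarith

variable [NormedSpace ℝ E] {T : E → E →L[ℝ] ℝ}

theorem infDist_sub_le (he : ‖e‖ = 1) (b : E) (t : ℝ) :
    Metric.infDist b D - |t| ≤ Metric.infDist (b + t • e) D := by
  have h := Metric.infDist_le_infDist_add_dist (s := D) (x := b) (y := b + t • e)
  rw [dist_self_add_right, norm_smul, he, mul_one, Real.norm_eq_abs] at h
  linarith

/-- A 1-form off `D` whose coefficient in the direction `e` has polynomial growth at `D`, and which
is closed along segments parallel to `e`. -/
structure IsTameForm (D : Set E) (e x₀ : E) (r : ℝ) (T : E → E →L[ℝ] ℝ) : Prop where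
  poly : ∀ n, IsPolyGrowth (Metric.ball x₀ r \ D) (Metric.infDist · D) n (fun b => T b e)
  closed : ∀ (b : E) (t : ℝ) (v : E),
    (∀ s ∈ uIcc 0 t, b + s • e ∈ Metric.ball x₀ r \ D) →
      T (b + t • e) v - T b v =
        ∫ s in (0 : ℝ)..t, fderiv ℝ (fun b => T b e) (b + s • e) v

theorem IsTameForm.mono (hT : IsTameForm D e x₀ R T) (hr : r ≤ R) : IsTameForm D e x₀ r T := by
  have h : Metric.ball x₀ r \ D ⊆ Metric.ball x₀ R \ D :=
    sdiff_subset_sdiff_left (Metric.ball_subset_ball hr)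
  exact ⟨fun n => (hT.poly n).mono_set h, fun b t v hb => hT.closed b t v fun s hs => h (hb s hs)⟩

theorem IsTameForm.contDiffOn (hD : IsClosed D) (hx₀ : x₀ ∈ D) (hr : r ≤ 1)
    (hT : IsTameForm D e x₀ r T) :
    ContDiffOn ℝ ∞ (fun b => T b e) (Metric.ball x₀ r \ D) :=
  IsPolyGrowth.contDiffOn (isWeight_infDist hD hx₀ hr) hT.poly

/-- Symmetry of the second derivative of `H` makes `dH` closed along the segments. This allows the
singular period `τ₀ + dH'` itself to be sheared. -/
theorem IsTameForm.add_fderiv [ProperSpace E] (hD : IsClosed D) (hx₀ : x₀ ∈ D) (hr : r ≤ 1)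
    (hT : IsTameForm D e x₀ r T) {U : Set E} (hU : IsOpen U) (hrU : Metric.closedBall x₀ r ⊆ U)
    {H : E → ℝ} (hH : ContDiffOn ℝ ∞ H U) :
    IsTameForm D e x₀ r (fun b => T b + fderiv ℝ H b) := by
  have hw := isWeight_infDist hD hx₀ hr
  have hBU : Metric.ball x₀ r \ D ⊆ U := fun x hx => hrU (Metric.ball_subset_closedBall hx.1)
  have hH' := (contDiffOn_infty_iff_fderiv_of_isOpen hU).1 hH
  have hHe : ContDiffOn ℝ ∞ (fun b => fderiv ℝ H b e) U := hH'.2.clm_apply contDiffOn_const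
  refine ⟨fun n => ?_, fun b t v hb => ?_⟩
  · exact (hT.poly n).add hw (IsPolyGrowth.of_contDiffOn hU (isCompact_closedBall x₀ r) hrU
      (fun x hx => Metric.ball_subset_closedBall hx.1) hHe)
  · have hline : Continuous fun s : ℝ => b + s • e := by fun_prop
    have hA := (hT.contDiffOn hD hx₀ hr)
    have hA' := ((contDiffOn_infty_iff_fderiv_of_isOpen hw.isOpen).1 hA).2.continuousOn
    have hHe' := ((contDiffOn_infty_iff_fderiv_of_isOpen hU).1 hHe).2.continuousOn
    have i1 : IntervalIntegrable (fun s : ℝ => fderiv ℝ (fun b => T b e) (b + s • e) v)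
        MeasureTheory.volume 0 t :=
      ContinuousOn.intervalIntegrable
        ((hA'.comp hline.continuousOn fun s hs => hb s hs).clm_apply continuousOn_const)
    have i2 : IntervalIntegrable (fun s : ℝ => fderiv ℝ (fun b => fderiv ℝ H b e) (b + s • e) v)
        MeasureTheory.volume 0 t :=
      ContinuousOn.intervalIntegrable
        ((hHe'.comp hline.continuousOn fun s hs => hBU (hb s hs)).clm_apply continuousOn_const)
    have e1 : ∀ s ∈ uIcc 0 t, fderiv ℝ (fun b => T b e + fderiv ℝ H b e) (b + s • e) v =
        fderiv ℝ (fun b => T b e) (b + s • e) v +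
          fderiv ℝ (fun b => fderiv ℝ H b e) (b + s • e) v := by
      intro s hs
      rw [fderiv_fun_add ((hA.contDiffAt (hw.isOpen.mem_nhds (hb s hs))).differentiableAt (by simp))
        ((hHe.contDiffAt (hU.mem_nhds (hBU (hb s hs)))).differentiableAt (by simp))]
      rfl
    have e2 : ∫ s in (0 : ℝ)..t, fderiv ℝ (fun b => fderiv ℝ H b e) (b + s • e) v =
        fderiv ℝ H (b + t • e) v - fderiv ℝ H b v := by
      have := intervalIntegral.integral_eq_sub_of_hasDerivAt
        (f := fun s : ℝ => fderiv ℝ H (b + s • e) v) (a := 0) (b := t) (fun s hs => ?_) i2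
      · simpa using this
      · have hs' := hU.mem_nhds (hBU (hb s hs))
        have hd2 := (hH'.2.contDiffAt hs').differentiableAt (by simp)
        have hsymm : IsSymmSndFDerivAt ℝ H (b + s • e) :=
          (hH.contDiffAt hs').isSymmSndFDerivAt
            (by simpa using WithTop.coe_le_coe.2 (le_top : (2 : ℕ∞) ≤ ⊤))
        have h1 : fderiv ℝ (fun b => fderiv ℝ H b e) (b + s • e) v =
            fderiv ℝ (fderiv ℝ H) (b + s • e) e v := by
          rw [fderiv_clm_apply hd2 (differentiableAt_const e)]
          simpa using hsymm.eq v e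
        rw [h1]
        have h2 : HasDerivAt (fun s : ℝ => b + s • e) e s := by
          simpa using ((hasDerivAt_id s).smul_const e).const_add b
        exact (((ContinuousLinearMap.apply ℝ ℝ v).hasFDerivAt.comp _
          hd2.hasFDerivAt).comp_hasDerivAt s h2)
    have := hT.closed b t v hb
    simp only [add_apply]
    rw [intervalIntegral.integral_congr e1, intervalIntegral.integral_add i1 i2, e2, ← this]
    ring

/-- The mean of `A` over the segment from `b` to `b + t e`. -/
noncomputable def shearMean (A : E → ℝ) (e : E) (p : E × ℝ) : ℝ :=
  ∫ s in (0 : ℝ)..1, A (p.1 + (s * p.2) • e)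

/-- The bound `3/2` covers the neighbourhood `(-1/2, 3/2)` of `[0, 1]` used for differentiation
under the integral. A displacement of at most `3/4` of the distance to `D` leaves a quarter of it.
As this distance is less than `r`, the point stays in the ball of radius `2r`. -/
theorem shear_mem (hD : IsClosed D) (hx₀ : x₀ ∈ D) (he : ‖e‖ = 1) {p : E × ℝ}
    (hp : p ∈ shearDomain D x₀ r) {s : ℝ} (hs : |s| ≤ 3 / 2) :
    p.1 + (s * p.2) • e ∈ Metric.ball x₀ (2 * r) \ D ∧
      1 / 4 * Metric.infDist p.1 D ≤ Metric.infDist (p.1 + (s * p.2) • e) D := by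
  have h0 := infDist_lt_of_mem_ball hx₀ hp.1.1
  have h1 : |s * p.2| ≤ 3 / 4 * Metric.infDist p.1 D := by
    rw [abs_mul]
    nlinarith [abs_nonneg s, abs_nonneg p.2, hp.2]
  have h2 := infDist_sub_le (D := D) he p.1 (s * p.2)
  have h3 : 0 < Metric.infDist p.1 D := (hD.notMem_iff_infDist_pos ⟨x₀, hx₀⟩).1 hp.1.2
  refine ⟨⟨?_, ?_⟩, by linarith⟩
  · have := dist_triangle (p.1 + (s * p.2) • e) p.1 x₀
    rw [dist_self_add_left, norm_smul, he, mul_one, Real.norm_eq_abs] at this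
    have h4 : dist p.1 x₀ < r := hp.1.1
    have h5 : 0 < r := h3.trans h0
    rw [Metric.mem_ball]
    linarith
  · refine (hD.notMem_iff_infDist_pos ⟨x₀, hx₀⟩).2 (by linarith)

theorem IsPolyGrowth.shear (hD : IsClosed D) (hx₀ : x₀ ∈ D) (hr : 2 * r ≤ 1) (hr0 : 0 < r)
    (he : ‖e‖ = 1)
    {A : E → ℝ} (hA : ∀ n, IsPolyGrowth (Metric.ball x₀ (2 * r) \ D) (Metric.infDist · D) n A)
    (n : ℕ) :
    IsPolyGrowth (shearDomain D x₀ r ×ˢ Ioo (-(1 / 2) : ℝ) (3 / 2))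
      (fun q => Metric.infDist q.1.1 D) n (fun q => A (q.1.1 + (q.2 * q.1.2) • e)) := by
  have hw := isWeight_shearDomain (r := r) hD hx₀ (by linarith)
  have hw3 : IsWeight (shearDomain D x₀ r ×ˢ Ioo (-(1 / 2) : ℝ) (3 / 2))
      (fun q => Metric.infDist q.1.1 D) :=
    ⟨hw.isOpen.prod isOpen_Ioo, fun q hq => hw.pos _ hq.1, fun q hq => hw.le_one _ hq.1⟩
  have hb : ∃ C, ∀ q ∈ shearDomain D x₀ r ×ˢ Ioo (-(1 / 2) : ℝ) (3 / 2), ‖q‖ ≤ C := by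
    refine ⟨max (‖x₀‖ + 1) (3 / 2), fun q hq => max_le_max
      (shearDomain_bounded hx₀ (by linarith) _ hq.1) ?_⟩
    rw [Real.norm_eq_abs, abs_le]
    constructor <;> linarith [hq.2.1, hq.2.2]
  have p1 : IsPolyGrowth _ _ n (fun q : (E × ℝ) × ℝ => q.1.1) := IsPolyGrowth.linear hw3 hb
    ((ContinuousLinearMap.fst ℝ E ℝ).comp (ContinuousLinearMap.fst ℝ (E × ℝ) ℝ))
  have p2 : IsPolyGrowth _ _ n (fun q : (E × ℝ) × ℝ => q.1.2) := IsPolyGrowth.linear hw3 hb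
    ((ContinuousLinearMap.snd ℝ E ℝ).comp (ContinuousLinearMap.fst ℝ (E × ℝ) ℝ))
  have p3 : IsPolyGrowth _ _ n (fun q : (E × ℝ) × ℝ => q.2) := IsPolyGrowth.linear hw3 hb
    (ContinuousLinearMap.snd ℝ (E × ℝ) ℝ)
  have hs : ∀ q ∈ shearDomain D x₀ r ×ˢ Ioo (-(1 / 2) : ℝ) (3 / 2), |q.2| ≤ 3 / 2 := by
    intro q hq
    rw [abs_le]
    constructor <;> linarith [hq.2.1, hq.2.2]
  exact IsPolyGrowth.comp hw3 (isWeight_infDist hD hx₀ hr) (hA n)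
    (p1.add hw3 ((p3.mul hw3 p2).smul hw3 (IsPolyGrowth.const e)))
    (fun q hq => (shear_mem hD hx₀ he hq.1 (hs q hq)).1) (by norm_num : (0 : ℝ) < 1 / 4)
    fun q hq => (shear_mem hD hx₀ he hq.1 (hs q hq)).2

theorem Icc_subset_Ioo_half : Icc (0 : ℝ) 1 ⊆ Ioo (-(1 / 2) : ℝ) (3 / 2) := fun s hs =>
  ⟨by linarith [hs.1], by linarith [hs.2]⟩

theorem IsPolyGrowth.shearMean (hD : IsClosed D) (hx₀ : x₀ ∈ D) (hr : 2 * r ≤ 1) (hr0 : 0 < r)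
    (he : ‖e‖ = 1)
    {A : E → ℝ} (hA : ∀ n, IsPolyGrowth (Metric.ball x₀ (2 * r) \ D) (Metric.infDist · D) n A)
    (n : ℕ) :
    IsPolyGrowth (shearDomain D x₀ r) (fun p => Metric.infDist p.1 D) n (shearMean A e) :=
  IsPolyGrowth.integral (isWeight_shearDomain hD hx₀ (by linarith)) isOpen_Ioo Icc_subset_Ioo_half
    (fun n => IsPolyGrowth.shear hD hx₀ hr hr0 he hA n) n

/-- The function is `K(b, t) = ∫₀ᵗ A(b + σ e) dσ`, written with a fixed interval of integration so
that its growth can be controlled. Closedness of `T` along the segment gives the derivative in `b`,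
and the fundamental theorem of calculus the one in `t`. -/
theorem hasFDerivAt_mul_shearMean (hD : IsClosed D) (hx₀ : x₀ ∈ D) (hr : 2 * r ≤ 1) (hr0 : 0 < r)
    (he : ‖e‖ = 1) (hT : IsTameForm D e x₀ (2 * r) T) {p : E × ℝ}
    (hp : p ∈ shearDomain D x₀ r) :
    HasFDerivAt (fun p => p.2 * shearMean (fun b => T b e) e p)
      ((T (p.1 + p.2 • e) - T p.1).comp (ContinuousLinearMap.fst ℝ E ℝ) +
        T (p.1 + p.2 • e) e • ContinuousLinearMap.snd ℝ E ℝ) p := by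
  obtain ⟨b, t⟩ := p
  set A : E → ℝ := fun b => T b e with hAdef
  have hw := isWeight_shearDomain (r := r) hD hx₀ (by linarith)
  have hw3 : IsWeight (shearDomain D x₀ r ×ˢ Ioo (-(1 / 2) : ℝ) (3 / 2))
      (fun q => Metric.infDist q.1.1 D) :=
    ⟨hw.isOpen.prod isOpen_Ioo, fun q hq => hw.pos _ hq.1, fun q hq => hw.le_one _ hq.1⟩
  have hcd := IsPolyGrowth.contDiffOn hw3 fun n => IsPolyGrowth.shear hD hx₀ hr hr0 he hT.poly n
  have hJ := hasFDerivAt_integral_zero_one hw.isOpen isOpen_Ioo Icc_subset_Ioo_half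
    (hcd.of_le (by simp)) hp
  have hK := (hasFDerivAt_snd (𝕜 := ℝ) (p := (b, t)) (E := E) (F := ℝ)).mul hJ
  have hwA := isWeight_infDist (r := 2 * r) hD hx₀ hr
  have hA := hT.contDiffOn hD hx₀ hr
  have hA' := ((contDiffOn_infty_iff_fderiv_of_isOpen hwA.isOpen).1 hA).2.continuousOn
  have hmem : ∀ s ∈ Icc (0 : ℝ) 1, b + (s * t) • e ∈ Metric.ball x₀ (2 * r) \ D := fun s hs =>
    (shear_mem hD hx₀ he hp (by rw [abs_of_nonneg hs.1]; linarith [hs.2])).1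
  have hAd : ∀ s ∈ Icc (0 : ℝ) 1, HasFDerivAt A (fderiv ℝ A (b + (s * t) • e)) (b + (s * t) • e) :=
    fun s hs => ((hA.contDiffAt (hwA.isOpen.mem_nhds (hmem s hs))).differentiableAt
      (by simp)).hasFDerivAt
  have hline : Continuous fun s : ℝ => b + (s * t) • e := by fun_prop
  have hcont : ∀ v, ContinuousOn (fun s => fderiv ℝ A (b + (s * t) • e) v) (Icc 0 1) := fun v =>
    (hA'.comp hline.continuousOn fun s hs => hmem s hs).clm_apply continuousOn_const
  have hpart : ∀ s ∈ uIcc (0 : ℝ) 1,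
      (fderiv ℝ (fun q : (E × ℝ) × ℝ => A (q.1.1 + (q.2 * q.1.2) • e)) ((b, t), s)).comp
        (ContinuousLinearMap.inl ℝ (E × ℝ) ℝ) =
      (fderiv ℝ A (b + (s * t) • e)).comp (ContinuousLinearMap.fst ℝ E ℝ +
        (s • ContinuousLinearMap.snd ℝ E ℝ).smulRight e) := by
    intro s hs
    rw [uIcc_of_le zero_le_one] at hs
    have h1 := ((hcd.contDiffAt (hw3.isOpen.mem_nhds (x := ((b, t), s))
      ⟨hp, Icc_subset_Ioo_half hs⟩)).differentiableAt (by simp)).hasFDerivAt.comp (b, t)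
      (hasFDerivAt_prodMk_left (𝕜 := ℝ) (b, t) s)
    have h2 : HasFDerivAt (fun p : E × ℝ => p.1 + (s * p.2) • e) (ContinuousLinearMap.fst ℝ E ℝ +
        (s • ContinuousLinearMap.snd ℝ E ℝ).smulRight e) (b, t) :=
      hasFDerivAt_fst.add ((hasFDerivAt_snd.const_mul s).smul_const e)
    exact h1.unique ((hAd s hs).comp (b, t) h2)
  rw [intervalIntegral.integral_congr hpart] at hK
  refine hK.congr_fderiv ?_
  have hint : IntervalIntegrable (fun s => (fderiv ℝ A (b + (s * t) • e)).comp
      (ContinuousLinearMap.fst ℝ E ℝ + (s • ContinuousLinearMap.snd ℝ E ℝ).smulRight e))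
      MeasureTheory.volume 0 1 := by
    refine ContinuousOn.intervalIntegrable ?_
    rw [uIcc_of_le zero_le_one]
    refine ContinuousOn.clm_comp (hA'.comp hline.continuousOn fun s hs => hmem s hs)
      (Continuous.continuousOn ?_)
    have : (fun s : ℝ => ContinuousLinearMap.fst ℝ E ℝ +
        (s • ContinuousLinearMap.snd ℝ E ℝ).smulRight e) = fun s : ℝ => ContinuousLinearMap.fst ℝ E ℝ +
        s • (ContinuousLinearMap.snd ℝ E ℝ).smulRight e := by
      ext s <;> simp
    rw [this]
    fun_prop
  -- The substitution `σ = s t` turns the left-hand side into the integral in the closedness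
  -- condition.
  have hv : ∀ v, t * ∫ s in (0 : ℝ)..1, fderiv ℝ A (b + (s * t) • e) v =
      T (b + t • e) v - T b v := by
    intro v
    have h1 := intervalIntegral.mul_integral_comp_mul_right (a := 0) (b := 1)
      (f := fun s => fderiv ℝ A (b + s • e) v) (c := t)
    rw [h1, zero_mul, one_mul]
    refine (hT.closed b t v fun s hs => ?_).symm
    have : ∃ s' ∈ Icc (0 : ℝ) 1, s = s' * t := by
      rw [← segment_eq_uIcc, segment_eq_image] at hs
      obtain ⟨θ, hθ, rfl⟩ := hs
      exact ⟨θ, hθ, by simp⟩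
    obtain ⟨s', hs', rfl⟩ := this
    exact hmem s' hs'
  -- The integrand is the derivative of `s ↦ s A(b + s t e)`.
  have ht : ∫ s in (0 : ℝ)..1, (A (b + (s * t) • e) + s * (t * fderiv ℝ A (b + (s * t) • e) e)) =
      A (b + t • e) := by
    have := intervalIntegral.integral_eq_sub_of_hasDerivAt
      (f := fun s : ℝ => s * A (b + (s * t) • e))
      (f' := fun s : ℝ => A (b + (s * t) • e) + s * (t * fderiv ℝ A (b + (s * t) • e) e))
      (a := 0) (b := 1) (fun s hs => ?_) ?_
    · simpa using this
    · rw [uIcc_of_le zero_le_one] at hs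
      have h2 : HasDerivAt (fun s : ℝ => b + (s * t) • e) (t • e) s := by
        simpa using (((hasDerivAt_id s).mul_const t).smul_const e).const_add b
      have h3 : HasDerivAt (fun s : ℝ => s * A (b + (s * t) • e))
          (1 * A (b + (s * t) • e) + s * fderiv ℝ A (b + (s * t) • e) (t • e)) s :=
        (hasDerivAt_id s).mul (HasFDerivAt.comp_hasDerivAt (l := A) s (hAd s hs) h2)
      simpa using h3
    · refine ContinuousOn.intervalIntegrable ?_
      rw [uIcc_of_le zero_le_one]
      exact (hA.continuousOn.comp hline.continuousOn fun s hs => hmem s hs).add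
        (continuousOn_id.mul (continuousOn_const.mul (hcont e)))
  have hApp : ∀ w, (∫ s in (0 : ℝ)..1, (fderiv ℝ A (b + (s * t) • e)).comp
      (ContinuousLinearMap.fst ℝ E ℝ + (s • ContinuousLinearMap.snd ℝ E ℝ).smulRight e)) w =
      ∫ s in (0 : ℝ)..1, (fderiv ℝ A (b + (s * t) • e) w.1 +
        w.2 * (s * fderiv ℝ A (b + (s * t) • e) e)) := by
    intro w
    rw [ContinuousLinearMap.intervalIntegral_apply hint]
    refine intervalIntegral.integral_congr fun s _ => ?_
    simp only [ContinuousLinearMap.comp_apply, add_apply, ContinuousLinearMap.smulRight_apply,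
      smul_apply, ContinuousLinearMap.coe_fst', ContinuousLinearMap.coe_snd', map_add, map_smul,
      smul_eq_mul]
    ring
  have c1 : IntervalIntegrable (fun s => A (b + (s * t) • e)) MeasureTheory.volume 0 1 := by
    refine ContinuousOn.intervalIntegrable ?_
    rw [uIcc_of_le zero_le_one]
    exact hA.continuousOn.comp hline.continuousOn fun s hs => hmem s hs
  have c2 : ∀ v, IntervalIntegrable (fun s => fderiv ℝ A (b + (s * t) • e) v)
      MeasureTheory.volume 0 1 := by
    intro v
    refine ContinuousOn.intervalIntegrable ?_
    rw [uIcc_of_le zero_le_one]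
    exact hcont v
  have c3 : IntervalIntegrable (fun s => s * fderiv ℝ A (b + (s * t) • e) e)
      MeasureTheory.volume 0 1 := (c2 e).continuousOn_mul continuousOn_id
  have ht' : (∫ s in (0 : ℝ)..1, A (b + (s * t) • e)) +
      t * ∫ s in (0 : ℝ)..1, s * fderiv ℝ A (b + (s * t) • e) e = A (b + t • e) := by
    rw [← ht, ← intervalIntegral.integral_const_mul, ← intervalIntegral.integral_add c1
      (c3.const_mul t)]
    exact intervalIntegral.integral_congr fun s _ => by ring
  ext w
  · simp only [ContinuousLinearMap.comp_apply, add_apply, smul_apply, smul_eq_mul, hApp,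
      ContinuousLinearMap.inl_apply, ContinuousLinearMap.coe_snd', ContinuousLinearMap.coe_fst',
      sub_apply, zero_mul, mul_zero, add_zero]
    exact hv w
  · simp only [ContinuousLinearMap.comp_apply, add_apply, smul_apply, smul_eq_mul, hApp,
      ContinuousLinearMap.inr_apply, ContinuousLinearMap.coe_snd', ContinuousLinearMap.coe_fst',
      map_zero, zero_add, mul_one, one_mul]
    exact (add_comm _ _).trans ht'

/-- For the shear `φ(b) = b + g(b) e` the differential is `φ^*T - T`; this is
`hasFDerivAt_mul_shearMean` restricted to the graph of `g`. -/
theorem hasFDerivAt_shear_primitive (hD : IsClosed D) (hx₀ : x₀ ∈ D) (hr : 2 * r ≤ 1) (hr0 : 0 < r)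
    (he : ‖e‖ = 1) (hT : IsTameForm D e x₀ (2 * r) T) {g : E → ℝ} {g' : E →L[ℝ] ℝ} {b : E}
    (hb : b ∈ Metric.ball x₀ r \ D) (hgb : |g b| < Metric.infDist b D / 2)
    (hg : HasFDerivAt g g' b) :
    HasFDerivAt (fun b => g b * shearMean (fun b => T b e) e (b, g b))
      ((T (b + g b • e)).comp (ContinuousLinearMap.id ℝ E + g'.smulRight e) - T b) b := by
  refine ((hasFDerivAt_mul_shearMean hD hx₀ hr hr0 he hT (p := (b, g b)) ⟨hb, hgb⟩).comp b
    ((hasFDerivAt_id b).prodMk hg)).congr_fderiv ?_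
  ext v
  simp only [ContinuousLinearMap.comp_apply, add_apply, smul_apply, smul_eq_mul, sub_apply,
    ContinuousLinearMap.smulRight_apply, ContinuousLinearMap.coe_snd', ContinuousLinearMap.coe_fst',
    ContinuousLinearMap.prod_apply, ContinuousLinearMap.id_apply, map_add, map_smul]
  ring

theorem IsPolyGrowth.shearMean_comp (hD : IsClosed D) (hx₀ : x₀ ∈ D) (hr : 2 * r ≤ 1) (hr0 : 0 < r)
    (he : ‖e‖ = 1) (hT : IsTameForm D e x₀ (2 * r) T) {g : E → ℝ}
    (hg : ∀ n, IsPolyGrowth (Metric.ball x₀ r \ D) (Metric.infDist · D) n g)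
    (hgb : ∀ b ∈ Metric.ball x₀ r \ D, |g b| < Metric.infDist b D / 2) (n : ℕ) :
    IsPolyGrowth (Metric.ball x₀ r \ D) (Metric.infDist · D) n
      (fun b => _root_.shearMean (fun b => T b e) e (b, g b)) := by
  have hw := isWeight_infDist (r := r) hD hx₀ (by linarith)
  have hb : ∃ C, ∀ x ∈ Metric.ball x₀ r \ D, ‖x‖ ≤ C := by
    refine ⟨‖x₀‖ + 1, fun x hx => ?_⟩
    have h3 := norm_le_norm_add_norm_sub' x x₀
    rw [← dist_eq_norm] at h3
    have : dist x x₀ < r := hx.1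
    linarith
  exact IsPolyGrowth.comp hw (isWeight_shearDomain hD hx₀ (by linarith))
    (IsPolyGrowth.shearMean hD hx₀ hr hr0 he hT.poly n)
    ((IsPolyGrowth.linear hw hb (ContinuousLinearMap.id ℝ E)).prodMk hw (hg n))
    (fun x hx => ⟨hx, hgb x hx⟩) one_pos fun x _ => by simp

/-- A flat function is small compared to the distance to `D`. -/
theorem exists_flat_small [ProperSpace E] (hD : IsClosed D) (hx₀ : x₀ ∈ D) (hR : 0 < R)
    {U : Set E} (hU : IsOpen U) (hxU : x₀ ∈ U) {h : E → ℝ} (hh : ContDiffOn ℝ ∞ h U)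
    (hflat : ∀ p ∈ U ∩ D, ∀ n, iteratedFDeriv ℝ n h p = 0) :
    ∃ r, 0 < r ∧ 2 * r ≤ R ∧ 2 * r ≤ 1 ∧ Metric.closedBall x₀ (2 * r) ⊆ U ∧
      IsFlatGrowth (Metric.ball x₀ r \ D) (Metric.infDist · D) h ∧
      ∀ b ∈ Metric.ball x₀ r \ D, |h b| < Metric.infDist b D / 2 := by
  obtain ⟨r₀, hr₀, hrU⟩ := Metric.nhds_basis_closedBall.mem_iff.1 (hU.mem_nhds hxU)
  set r₁ := min (r₀ / 2) (min (R / 2) (1 / 2)) with hr₁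
  have h1 : r₁ ≤ r₀ / 2 := min_le_left _ _
  have h2 : r₁ ≤ R / 2 := (min_le_right _ _).trans (min_le_left _ _)
  have h3 : r₁ ≤ 1 / 2 := (min_le_right _ _).trans (min_le_right _ _)
  have h0 : 0 < r₁ := by positivity
  have hf := isFlatGrowth_of_contDiffOn hU hD hx₀ (r := r₁) (by linarith)
    ((Metric.closedBall_subset_closedBall (by linarith)).trans hrU) hh hflat
  obtain ⟨C, hC0, hC⟩ := hf.bound 2
  -- From `|h| ≤ C ρ²` and `ρ < r₂ ≤ 1 / (2 (C + 1))` it follows that `|h| < ρ / 2`.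
  set r₂ := min r₁ (1 / (2 * (C + 1))) with hr₂
  have h4 : r₂ ≤ r₁ := min_le_left _ _
  have h5 : r₂ ≤ 1 / (2 * (C + 1)) := min_le_right _ _
  have h6 : 0 < r₂ := by positivity
  have hsub : Metric.ball x₀ r₂ \ D ⊆ Metric.ball x₀ r₁ \ D :=
    sdiff_subset_sdiff_left (Metric.ball_subset_ball h4)
  refine ⟨r₂, h6, by linarith, by linarith,
    (Metric.closedBall_subset_closedBall (by linarith)).trans hrU, hf.mono_set hsub, ?_⟩
  intro b hb
  have h7 := hC b (hsub hb)
  have h8 : 0 < Metric.infDist b D := (hD.notMem_iff_infDist_pos ⟨x₀, hx₀⟩).1 hb.2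
  have h9 := infDist_lt_of_mem_ball hx₀ hb.1
  rw [abs_of_pos h8, Real.norm_eq_abs] at h7
  have h10 : Metric.infDist b D * (2 * (C + 1)) < 1 := by
    rw [← lt_div_iff₀ (by positivity)]
    linarith
  nlinarith

/-- A shear that is flat at `D` changes a tame closed form by the differential of a flat
function. -/
theorem IsTameForm.exists_flat_primitive [ProperSpace E] (hD : IsClosed D) (hx₀ : x₀ ∈ D)
    (hR : 0 < R) (he : ‖e‖ = 1) (hT : IsTameForm D e x₀ R T) {U : Set E} (hU : IsOpen U)
    (hxU : x₀ ∈ U) {g : E → ℝ} (hg : ContDiffOn ℝ ∞ g U)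
    (hflat : ∀ p ∈ U ∩ D, ∀ n, iteratedFDeriv ℝ n g p = 0) :
    ∃ r, 0 < r ∧ ∃ k : E → ℝ, ContDiffOn ℝ ∞ k (Metric.ball x₀ r) ∧
      (∀ p ∈ Metric.ball x₀ r ∩ D, ∀ n, iteratedFDeriv ℝ n k p = 0) ∧
      ∀ b ∈ Metric.ball x₀ r \ D, HasFDerivAt k
        ((T (b + g b • e)).comp (ContinuousLinearMap.id ℝ E + (fderiv ℝ g b).smulRight e) - T b)
        b := by
  obtain ⟨r, hr0, hrR, hr, hrU, hgf, hgs⟩ := exists_flat_small hD hx₀ hR hU hxU hg hflat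
  have hw := isWeight_infDist (r := r) hD hx₀ (by linarith)
  have hT' := hT.mono hrR
  have hU' : ∀ b ∈ Metric.ball x₀ r, b ∈ U := fun b hb =>
    hrU (Metric.ball_subset_closedBall (Metric.ball_subset_ball (by linarith) hb))
  -- The primitive is `g` times the mean of the coefficient; the flat factor absorbs the polynomial
  -- growth of the mean.
  have hk := hgf.mul hw (IsPolyGrowth.shearMean_comp hD hx₀ hr hr0 he hT' hgf.isPolyGrowth hgs)
  have hz : ∀ x ∈ Metric.ball x₀ r ∩ D,
      g x * shearMean (fun b => T b e) e (x, g x) = 0 := by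
    intro x hx
    have : g x = 0 := by
      rw [← norm_eq_zero, ← norm_iteratedFDeriv_zero (𝕜 := ℝ), hflat x ⟨hU' x hx.1, hx.2⟩,
        norm_zero]
    rw [this, zero_mul]
  have h := hk.contDiffOn_and_flat Metric.isOpen_ball hD hz
  exact ⟨r, hr0, _, h.1, h.2, fun b hb => hasFDerivAt_shear_primitive hD hx₀ hr hr0 he hT' hb
    (hgs b hb) ((hg.contDiffAt (hU.mem_nhds (hU' b hb.1))).differentiableAt
      (by simp)).hasFDerivAt⟩

/-- The differential of a flat function is realised by a flat shear of a tame closed form whose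
coefficient is bounded away from zero. -/
theorem IsTameForm.exists_flat_shear [ProperSpace E] (hD : IsClosed D) (hx₀ : x₀ ∈ D)
    (hR : 0 < R) (he : ‖e‖ = 1) (hT : IsTameForm D e x₀ R T) {σ : ℝ} (hσ : |σ| = 1)
    (hlow : ∀ b ∈ Metric.ball x₀ R \ D, 1 ≤ σ * T b e) {U : Set E} (hU : IsOpen U)
    (hxU : x₀ ∈ U) {h : E → ℝ} (hh : ContDiffOn ℝ ∞ h U)
    (hflat : ∀ p ∈ U ∩ D, ∀ n, iteratedFDeriv ℝ n h p = 0) :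
    ∃ r, 0 < r ∧ ∃ g : E → ℝ, ContDiffOn ℝ ∞ g (Metric.ball x₀ r) ∧
      (∀ p ∈ Metric.ball x₀ r ∩ D, ∀ n, iteratedFDeriv ℝ n g p = 0) ∧
      ∀ b ∈ Metric.ball x₀ r \ D, b + g b • e ∉ D ∧ fderiv ℝ h b =
        (T (b + g b • e)).comp (ContinuousLinearMap.id ℝ E + (fderiv ℝ g b).smulRight e) - T b := by
  obtain ⟨r, hr0, hrR, hr, hrU, hhf, hhs⟩ := exists_flat_small hD hx₀ hR hU hxU hh hflat
  have hw := isWeight_infDist (r := r) hD hx₀ (by linarith)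
  have hw2 := isWeight_shearDomain (r := r) hD hx₀ (by linarith)
  have hT' := hT.mono hrR
  set A : E → ℝ := fun b => T b e with hAdef
  set K : E × ℝ → ℝ := fun p => p.2 * shearMean A e p with hKdef
  have hK : ∀ p ∈ shearDomain D x₀ r, HasFDerivAt K
      ((T (p.1 + p.2 • e) - T p.1).comp (ContinuousLinearMap.fst ℝ E ℝ) +
        T (p.1 + p.2 • e) e • ContinuousLinearMap.snd ℝ E ℝ) p := fun p hp =>
    hasFDerivAt_mul_shearMean hD hx₀ hr hr0 he hT' hp
  have hKt : ∀ p ∈ shearDomain D x₀ r,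
      HasDerivAt (fun t => σ * K (p.1, t)) (σ * A (p.1 + p.2 • e)) p.2 := by
    intro p hp
    have h1 := (hK p hp).comp_hasDerivAt p.2 ((hasDerivAt_const p.2 p.1).prodMk (hasDerivAt_id p.2))
    simpa using h1.const_mul σ
  have hA1 : ∀ p ∈ shearDomain D x₀ r, 1 ≤ σ * A (p.1 + p.2 • e) := by
    intro p hp
    refine hlow _ ?_
    have := (shear_mem hD hx₀ he hp (s := 1) (by norm_num)).1
    rw [one_mul] at this
    exact ⟨Metric.ball_subset_ball hrR this.1, this.2⟩
  -- The `t`-derivative of `σ K(b, t)` is at least one, so `σ K(b, ·)` does not contract distances.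
  -- This yields the existence of the solution, its bound and its continuity.
  have hmono : ∀ b ∈ Metric.ball x₀ r \ D, ∀ t t' : ℝ, |t| < Metric.infDist b D / 2 →
      |t'| < Metric.infDist b D / 2 → t ≤ t' → t' - t ≤ σ * K (b, t') - σ * K (b, t) := by
    intro b hb t t' ht ht' htt
    have hmem : ∀ s ∈ Icc t t', (b, s) ∈ shearDomain D x₀ r := fun s hs =>
      ⟨hb, abs_lt.2 ⟨by linarith [(abs_lt.1 ht).1, hs.1], by linarith [(abs_lt.1 ht').2, hs.2]⟩⟩
    have h1 := (convex_Icc t t').mul_sub_le_image_sub_of_le_deriv (f := fun s => σ * K (b, s))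
      (C := 1) (fun s hs => (hKt (b, s) (hmem s hs)).continuousAt.continuousWithinAt)
      (fun s hs => (hKt (b, s) (hmem s (interior_subset hs))).differentiableAt.differentiableWithinAt)
      (fun s hs => by
        rw [(hKt (b, s) (hmem s (interior_subset hs))).deriv]
        exact hA1 (b, s) (hmem s (interior_subset hs))) t (left_mem_Icc.2 htt) t'
      (right_mem_Icc.2 htt) htt
    simpa using h1
  have hσh : ∀ y : ℝ, |σ * y| = |y| := fun y => by rw [abs_mul, hσ, one_mul]
  have hσ0 : σ ≠ 0 := abs_pos.1 (by rw [hσ]; exact one_pos)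
  -- Expansion from `K(b, 0) = 0` shows that `σ K(b, ·)` is at most `-|h b|` at `-|h b|` and at
  -- least `|h b|` at `|h b|`, so the intermediate value theorem applies between them.
  have hex : ∀ b ∈ Metric.ball x₀ r \ D, ∃ t, |t| ≤ |h b| ∧ K (b, t) = h b := by
    intro b hb
    have hs := hhs b hb
    have hp := hw.pos b hb
    have hK0 : K (b, 0) = 0 := by simp [hKdef]
    have hup := hmono b hb 0 |h b| (by simpa using by linarith) (by rwa [abs_abs]) (abs_nonneg _)
    have hdn := hmono b hb (-|h b|) 0 (by rwa [abs_neg, abs_abs]) (by simpa using by linarith)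
      (by simp)
    rw [hK0, mul_zero, sub_zero, sub_zero] at hup
    rw [hK0, mul_zero, zero_sub, zero_sub, neg_neg] at hdn
    have hle : -|h b| ≤ |h b| := by linarith [abs_nonneg (h b)]
    have hc : ContinuousOn (fun t => σ * K (b, t)) (Icc (-|h b|) |h b|) := fun s hs' =>
      (hKt (b, s) ⟨hb, (abs_le.2 hs').trans_lt hs⟩).continuousAt.continuousWithinAt
    have h1 := abs_le.1 (hσh (h b)).le
    obtain ⟨t, ht, hKb⟩ := intermediate_value_Icc hle hc
      (show σ * h b ∈ _ from ⟨by linarith [h1.1], by linarith [h1.2]⟩)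
    exact ⟨t, abs_le.2 ht, mul_left_cancel₀ hσ0 hKb⟩
  choose! g hgle hgK using hex
  have hgs : ∀ b ∈ Metric.ball x₀ r \ D, |g b| < Metric.infDist b D / 2 := fun b hb =>
    (hgle b hb).trans_lt (hhs b hb)
  have hKpoly : ∀ n, IsPolyGrowth (shearDomain D x₀ r) (fun p => Metric.infDist p.1 D) n K := by
    intro n
    exact (IsPolyGrowth.linear hw2 ⟨_, shearDomain_bounded hx₀ (by linarith)⟩
      (ContinuousLinearMap.snd ℝ E ℝ)).mul hw2
      (IsPolyGrowth.shearMean hD hx₀ hr hr0 he hT'.poly n)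
  have hFpoly : ∀ n, IsPolyGrowth (shearDomain D x₀ r) (fun p => Metric.infDist p.1 D) n
      (fun p => K p - h p.1) := by
    intro n
    exact (hKpoly n).sub hw2 (IsPolyGrowth.comp hw2 hw (hhf.isPolyGrowth n)
      (IsPolyGrowth.linear hw2 ⟨_, shearDomain_bounded hx₀ (by linarith)⟩
        (ContinuousLinearMap.fst ℝ E ℝ)) (fun p hp => hp.1) one_pos fun p _ => by simp)
  have hFd : ∀ p ∈ shearDomain D x₀ r,
      fderiv ℝ (fun p => K p - h p.1) p (0, 1) = A (p.1 + p.2 • e) := by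
    intro p hp
    have h1 := (((hhf.isPolyGrowth 1).differentiableOn.differentiableAt
      (hw.isOpen.mem_nhds hp.1)).hasFDerivAt).comp p (hasFDerivAt_fst (𝕜 := ℝ) (p := p))
    have h2 := ((hK p hp).sub h1).fderiv
    rw [show (fun p => K p - h p.1) = K - h ∘ Prod.fst from rfl, h2]
    simp [hAdef]
  -- Expansion gives `|g x - g b| ≤ |K(x, g b) - h x|`, and the right-hand side tends to zero as `x`
  -- tends to `b`.
  have hgc : ContinuousOn g (Metric.ball x₀ r \ D) := by
    intro b hb
    refine ContinuousAt.continuousWithinAt ?_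
    have hF := (IsPolyGrowth.contDiffOn hw2 hFpoly).continuousOn.continuousAt
      (hw2.isOpen.mem_nhds (x := (b, g b)) ⟨hb, hgs b hb⟩)
    have h1 : Filter.Tendsto (fun x => |K (x, g b) - h x|) (𝓝 b) (𝓝 0) := by
      have h2 : ContinuousAt (fun x => |K (x, g b) - h x|) b :=
        (ContinuousAt.comp (f := fun x : E => (x, g b)) hF (by fun_prop)).abs
      have h3 := h2.tendsto
      rwa [hgK b hb, sub_self, abs_zero] at h3
    have hdom : ∀ᶠ x in 𝓝 b, (x, g b) ∈ shearDomain D x₀ r :=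
      (show ContinuousAt (fun x : E => (x, g b)) b by fun_prop).eventually
        (hw2.isOpen.mem_nhds ⟨hb, hgs b hb⟩)
    refine tendsto_iff_dist_tendsto_zero.2 (squeeze_zero' (Filter.Eventually.of_forall fun _ =>
      dist_nonneg) ?_ h1)
    filter_upwards [hdom] with x hx
    have hx1 := hx.1
    rw [Real.dist_eq, ← hgK x hx1, ← hσh (K (x, g b) - _), mul_sub]
    rcases le_total (g b) (g x) with hle | hle
    · have := hmono x hx1 _ _ hx.2 (hgs x hx1) hle
      rw [abs_of_nonneg (by linarith), abs_sub_comm]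
      exact this.trans (le_abs_self _)
    · have := hmono x hx1 _ _ (hgs x hx1) hx.2 hle
      rw [abs_sub_comm, abs_of_nonneg (by linarith)]
      exact this.trans (le_abs_self _)
  have hbd : ∃ C, ∀ x ∈ Metric.ball x₀ r \ D, ‖x‖ ≤ C := by
    refine ⟨‖x₀‖ + 1, fun x hx => ?_⟩
    have h3 := norm_le_norm_add_norm_sub' x x₀
    rw [← dist_eq_norm] at h3
    have : dist x x₀ < r := hx.1
    linarith
  have hgpoly : ∀ n, IsPolyGrowth (Metric.ball x₀ r \ D) (Metric.infDist · D) n g :=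
    IsPolyGrowth.implicit hw hw2 hbd hFpoly hgc (fun x hx => ⟨hx, hgs x hx⟩)
      (fun x hx => by rw [hgK x hx, sub_self])
      ⟨1, fun x hx => by
        rw [Real.norm_eq_abs]
        linarith [hgs x hx, hw.le_one x hx]⟩ 0 1 one_pos fun x hx => by
        rw [hFd (x, g x) ⟨hx, hgs x hx⟩, pow_zero, mul_one, ← hσh]
        exact (hA1 (x, g x) ⟨hx, hgs x hx⟩).trans (le_abs_self _)
  have hJlow : ∀ x ∈ Metric.ball x₀ r \ D, 1 * Metric.infDist x D ^ 0 ≤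
      |shearMean A e (x, g x)| := by
    intro x hx
    have hmem : ∀ s ∈ Icc (0 : ℝ) 1, (x, s * g x) ∈ shearDomain D x₀ r := by
      intro s hs
      refine ⟨hx, lt_of_le_of_lt ?_ (hgs x hx)⟩
      rw [abs_mul, abs_of_nonneg hs.1]
      exact mul_le_of_le_one_left (abs_nonneg _) hs.2
    have hline : Continuous fun s : ℝ => x + (s * g x) • e := by fun_prop
    have hc : IntervalIntegrable (fun s => σ * A (x + (s * g x) • e)) MeasureTheory.volume 0 1 := by
      refine ContinuousOn.intervalIntegrable ?_
      rw [uIcc_of_le zero_le_one]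
      refine continuousOn_const.mul ((hT'.contDiffOn hD hx₀ hr).continuousOn.comp
        hline.continuousOn fun s hs => ?_)
      exact (shear_mem hD hx₀ he (p := (x, g x)) ⟨hx, hgs x hx⟩
        (by rw [abs_of_nonneg hs.1]; linarith [hs.2])).1
    have h1 := intervalIntegral.integral_mono_on zero_le_one
      (intervalIntegrable_const (c := (1 : ℝ))) hc fun s hs => hA1 _ (hmem s hs)
    rw [intervalIntegral.integral_const_mul] at h1
    rw [pow_zero, mul_one, ← hσh]
    refine le_trans ?_ (le_abs_self _)
    unfold shearMean
    simpa using h1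
  -- The defining equation reads `g = h / mean`. The mean is at least one in absolute value and has
  -- polynomial growth along the graph of `g`, so flatness of `h` passes to `g`.
  have hgf0 : IsFlatGrowth (Metric.ball x₀ r \ D) (Metric.infDist · D) g := by
    refine (hhf.mul hw fun n => (IsPolyGrowth.shearMean_comp hD hx₀ hr hr0 he hT' hgpoly hgs n).inv
      hw 0 1 one_pos hJlow).congr hw fun x hx => ?_
    have h1 := hJlow x hx
    rw [pow_zero, mul_one] at h1
    have h2 : shearMean A e (x, g x) ≠ 0 := abs_pos.1 (by linarith)
    change g x = h x * (shearMean A e (x, g x))⁻¹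
    rw [← hgK x hx, hKdef]
    field_simp
  classical
  -- On `D` the choice of `g` is arbitrary, and it is replaced there by zero.
  set g₀ : E → ℝ := fun b => if b ∈ D then 0 else g b with hg₀
  have hg₀eq : EqOn g₀ g (Metric.ball x₀ r \ D) := fun b hb => if_neg hb.2
  have hfin := (hgf0.congr hw hg₀eq).contDiffOn_and_flat Metric.isOpen_ball hD
    fun x hx => if_pos hx.2
  refine ⟨r, hr0, g₀, hfin.1, hfin.2, fun b hb => ⟨?_, ?_⟩⟩
  · rw [hg₀eq hb]
    have := (shear_mem hD hx₀ he (p := (b, g b)) ⟨hb, hgs b hb⟩ (s := 1) (by norm_num)).1.2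
    rwa [one_mul] at this
  · have h1 := hasFDerivAt_shear_primitive hD hx₀ hr hr0 he hT' hb (g := g₀)
      (by rw [hg₀eq hb]; exact hgs b hb)
      ((hfin.1.contDiffAt (Metric.isOpen_ball.mem_nhds hb.1)).differentiableAt
        (by simp)).hasFDerivAt
    refine Filter.EventuallyEq.fderiv_eq ?_ |>.trans h1.fderiv
    filter_upwards [hw.isOpen.mem_nhds hb] with x hx
    rw [hg₀eq hx, ← hgK x hx]

end Shear

/-! ### The discriminant loci -/

/-- The direction of the first coordinate axis of `ℝ³`. -/
noncomputable def axis : E3 := EuclideanSpace.single 0 1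

@[simp] theorem axis_zero : axis 0 = 1 := by simp [axis]

@[simp] theorem axis_one : axis 1 = 0 := by simp [axis]

@[simp] theorem axis_two : axis 2 = 0 := by simp [axis]

theorem norm_axis : ‖axis‖ = 1 := by simp [axis]

@[simp] theorem dcoord_apply (i : Fin 3) (v : E3) : dcoord i v = v i := rfl

theorem dist_sq_E3 (x y : E3) :
    dist x y ^ 2 = (x 0 - y 0) ^ 2 + (x 1 - y 1) ^ 2 + (x 2 - y 2) ^ 2 := by
  rw [EuclideanSpace.dist_eq, Real.sq_sqrt (Finset.sum_nonneg fun i _ => sq_nonneg _)]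
  simp [Fin.sum_univ_three, Real.dist_eq, sq_abs]

theorem continuous_coord (i : Fin 3) : Continuous fun b : E3 => b i := (dcoord i).continuous

namespace SingularityType

theorem isClosed_disc (κ : SingularityType) : IsClosed κ.disc := by
  have h0 := continuous_coord 0
  have h1 := continuous_coord 1
  have h2 := continuous_coord 2
  cases κ with
  | oneTwo =>
    refine (isClosed_eq h0 continuous_const).inter (IsClosed.union ?_ (IsClosed.union ?_ ?_))
    · exact (isClosed_eq h1 h2).inter (isClosed_le continuous_const h1)
    · exact (isClosed_eq h1 continuous_const).inter (isClosed_le h2 continuous_const)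
    · exact (isClosed_eq h2 continuous_const).inter (isClosed_le h1 continuous_const)
  | twoTwo => exact (isClosed_eq h0 continuous_const).inter (isClosed_eq h1 continuous_const)

theorem zero_of_mem_disc {κ : SingularityType} {b : E3} (hb : b ∈ κ.disc) : b 0 = 0 := by
  cases κ <;> exact hb.1

/-- The complement of the discriminant locus is dense. -/
theorem dense_compl_disc (κ : SingularityType) : Dense κ.discᶜ := by
  intro x
  have h : Filter.Tendsto (fun t : ℝ => x + t • axis) (𝓝[≠] (-x 0)) (𝓝 (x + (-x 0) • axis)) :=
    tendsto_nhdsWithin_of_tendsto_nhds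
      (Continuous.tendsto (by fun_prop) _)
  by_cases hx : x 0 = 0
  · rw [hx, neg_zero, zero_smul, add_zero] at h
    refine mem_closure_of_tendsto h (eventually_nhdsWithin_of_forall fun t ht hd => ?_)
    have := zero_of_mem_disc hd
    simp [hx] at this
    exact ht this
  · exact subset_closure fun hd => hx (zero_of_mem_disc hd)

end SingularityType

open SingularityType

theorem bounded_of_mem_ball {x₀ : E3} {r : ℝ} (hr : r ≤ 1) {D : Set E3} :
    ∃ C, ∀ x ∈ Metric.ball x₀ r \ D, ‖x‖ ≤ C := by
  refine ⟨‖x₀‖ + 1, fun x hx => ?_⟩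
  have h3 := norm_le_norm_add_norm_sub' x x₀
  rw [← dist_eq_norm] at h3
  have : dist x x₀ < r := hx.1
  linarith

/-- Criterion for a form to be tame in terms of its components. -/
theorem isTameForm_of_components {D : Set E3} (hD : IsClosed D) {x₀ : E3} (hx₀ : x₀ ∈ D) {r : ℝ}
    (hr : r ≤ 1) {A : E3 → ℝ} {α : Fin 3 → E3 → ℝ} {T : E3 → E3 →L[ℝ] ℝ}
    (hT : ∀ b, T b = A b • dcoord 0 + α 1 b • dcoord 1 + α 2 b • dcoord 2)
    (hA : ∀ n, IsPolyGrowth (Metric.ball x₀ r \ D) (Metric.infDist · D) n A)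
    (hc : ∀ b ∈ Metric.ball x₀ r \ D, ∀ k : Fin 3, k ≠ 0 →
      ContinuousAt (fun s : ℝ => α k (b + s • axis)) 0)
    (hd : ∀ b ∈ Metric.ball x₀ r \ D, b 0 ≠ 0 → ∀ k : Fin 3, k ≠ 0 →
      HasDerivAt (fun s : ℝ => α k (b + s • axis))
        (fderiv ℝ A b (EuclideanSpace.single k 1)) 0) :
    IsTameForm D axis x₀ r T := by
  have hTe : (fun b => T b axis) = A := by
    ext b
    rw [hT]
    simp
  have hw := isWeight_infDist (r := r) hD hx₀ hr
  refine ⟨fun n => by rw [hTe]; exact hA n, fun b t v hb => ?_⟩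
  rw [hTe]
  have hAc := IsPolyGrowth.contDiffOn hw hA
  have hAd : ∀ x ∈ Metric.ball x₀ r \ D, HasFDerivAt A (fderiv ℝ A x) x := fun x hx =>
    ((hAc.contDiffAt (hw.isOpen.mem_nhds hx)).differentiableAt (by simp)).hasFDerivAt
  have hA' := ((contDiffOn_infty_iff_fderiv_of_isOpen hw.isOpen).1 hAc).2.continuousOn
  have hline : Continuous fun s : ℝ => b + s • axis := by fun_prop
  have hlineAt : ∀ s : ℝ, HasDerivAt (fun s : ℝ => b + s • axis) axis s := fun s => by
    simpa using ((hasDerivAt_id s).smul_const axis).const_add b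
  have hA1 : ∀ s ∈ uIcc 0 t, HasDerivAt (fun s : ℝ => A (b + s • axis))
      (fderiv ℝ A (b + s • axis) axis) s := fun s hs =>
    HasFDerivAt.comp_hasDerivAt (l := A) s (hAd _ (hb s hs)) (hlineAt s)
  have hshift : ∀ (k : Fin 3) (s : ℝ), (fun s' : ℝ => α k (b + s' • axis)) =
      (fun s' : ℝ => α k ((b + s • axis) + s' • axis)) ∘ fun s' => s' - s := by
    intro k s
    ext s'
    simp only [Function.comp, add_assoc, ← add_smul, add_sub_cancel]
  have hα1 : ∀ s ∈ uIcc 0 t, ∀ k : Fin 3, k ≠ 0 →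
      ContinuousAt (fun s : ℝ => α k (b + s • axis)) s := by
    intro s hs k hk
    rw [hshift k s]
    refine ContinuousAt.comp ?_ (by fun_prop)
    rw [sub_self]
    exact hc _ (hb s hs) k hk
  have hα2 : ∀ s ∈ uIcc 0 t, b 0 + s ≠ 0 → ∀ k : Fin 3, k ≠ 0 →
      HasDerivAt (fun s : ℝ => α k (b + s • axis))
        (fderiv ℝ A (b + s • axis) (EuclideanSpace.single k 1)) s := by
    intro s hs hs0 k hk
    rw [hshift k s]
    have h1 := hd _ (hb s hs) (by simpa using hs0) k hk
    have h2 : HasDerivAt (fun s' : ℝ => s' - s) 1 s := (hasDerivAt_id s).sub_const s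
    have h3 := HasDerivAt.comp (h := fun s' : ℝ => s' - s) s (by rwa [sub_self]) h2
    simpa using h3
  have hTv : ∀ x, T x v = A x * v 0 + α 1 x * v 1 + α 2 x * v 2 := fun x => by
    rw [hT]; simp
  have hv : v = v 0 • axis + v 1 • EuclideanSpace.single 1 1 + v 2 • EuclideanSpace.single 2 1 := by
    ext i
    fin_cases i <;> simp [axis]
  -- The line crosses the plane `b 0 = 0` only at `s = -b 0`. This version of the fundamental
  -- theorem needs only continuity at that one parameter.
  have hmain := MeasureTheory.integral_eq_of_hasDerivAt_off_countable (a := 0) (b := t)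
    (fun s => T (b + s • axis) v) (fun s => fderiv ℝ A (b + s • axis) v)
    (countable_singleton (-b 0)) ?_ ?_ ?_
  · simpa using hmain.symm
  · intro s hs
    refine ContinuousAt.continuousWithinAt ?_
    simp only [hTv]
    exact (((hA1 s hs).continuousAt.mul continuousAt_const).add
      ((hα1 s hs 1 (by simp)).mul continuousAt_const)).add
      ((hα1 s hs 2 (by simp)).mul continuousAt_const)
  · rintro s ⟨hs, hs0⟩
    have hs' : s ∈ uIcc 0 t := Ioo_subset_Icc_self hs
    have hs0' : b 0 + s ≠ 0 := fun h => hs0 (by rw [mem_singleton_iff]; linarith)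
    simp only [hTv]
    have h := (((hA1 s hs').mul_const (v 0)).add
      ((hα2 s hs' hs0' 1 (by simp)).mul_const (v 1))).add
      ((hα2 s hs' hs0' 2 (by simp)).mul_const (v 2))
    refine h.congr_deriv ?_
    conv_rhs => rw [hv]
    simp only [map_add, map_smul, smul_eq_mul]
    ring
  · exact ContinuousOn.intervalIntegrable
      ((hA'.comp hline.continuousOn fun s hs => hb s hs).clm_apply continuousOn_const)

/-! ### The reference form of the focus-focus singularity -/

theorem normSq_eq (b : E3) : ‖(⟨b 0, b 1⟩ : ℂ)‖ ^ 2 = b 0 ^ 2 + b 1 ^ 2 := by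
  rw [Complex.sq_norm, Complex.normSq_mk]
  ring

theorem neg_log_norm_eq (b : E3) :
    -Real.log ‖(⟨b 0, b 1⟩ : ℂ)‖ = -(1 / 2) * Real.log (b 0 ^ 2 + b 1 ^ 2) := by
  rw [← normSq_eq, Real.log_pow]
  push_cast
  ring

theorem sq_infDist_twoTwo_le (b : E3) :
    Metric.infDist b twoTwo.disc ^ 2 ≤ b 0 ^ 2 + b 1 ^ 2 := by
  have h1 : (!₂[0, 0, b 2] : E3) ∈ twoTwo.disc := by constructor <;> simp
  have h2 := Metric.infDist_le_dist_of_mem (x := b) h1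
  have h3 := dist_sq_E3 b !₂[0, 0, b 2]
  simp at h3
  rw [← h3]
  exact pow_le_pow_left₀ Metric.infDist_nonneg h2 2

theorem sq_add_sq_pos_of_notMem {b : E3} (hb : b ∉ twoTwo.disc) : 0 < b 0 ^ 2 + b 1 ^ 2 := by
  by_contra h
  exact hb ⟨by nlinarith [sq_nonneg (b 0), sq_nonneg (b 1)],
    by nlinarith [sq_nonneg (b 0), sq_nonneg (b 1)]⟩

theorem hasFDerivAt_log_twoTwo {b : E3} (hb : b ∉ twoTwo.disc) :
    HasFDerivAt (fun b : E3 => -(1 / 2) * Real.log (b 0 ^ 2 + b 1 ^ 2))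
      (-(b 0 ^ 2 + b 1 ^ 2)⁻¹ • (b 0 • dcoord 0 + b 1 • dcoord 1)) b := by
  have h0 : HasFDerivAt (fun b : E3 => b 0) (dcoord 0) b := (dcoord 0).hasFDerivAt
  have h1 : HasFDerivAt (fun b : E3 => b 1) (dcoord 1) b := (dcoord 1).hasFDerivAt
  have h2 := (((h0.pow 2).add (h1.pow 2)).log (sq_add_sq_pos_of_notMem hb).ne').const_mul (-(1 / 2))
  refine h2.congr_fderiv ?_
  ext v
  simp
  ring

/-- With `q = b₁² + b₂² ≥ ρ²`, the elementary bound `|log q| ≤ q + 1/q` gives growth at most `ρ⁻²`.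
The derivative is rational with denominator `q`, so all orders follow. -/
theorem isPolyGrowth_log_twoTwo {x₀ : E3} (hx₀ : x₀ ∈ twoTwo.disc) (n : ℕ) :
    IsPolyGrowth (Metric.ball x₀ 1 \ twoTwo.disc) (Metric.infDist · twoTwo.disc) n
      (fun b : E3 => -(1 / 2) * Real.log (b 0 ^ 2 + b 1 ^ 2)) := by
  have hw := isWeight_infDist (r := 1) twoTwo.isClosed_disc hx₀ le_rfl
  obtain ⟨C, hC⟩ := bounded_of_mem_ball (x₀ := x₀) (r := 1) le_rfl (D := twoTwo.disc)
  have hcoord : ∀ (i : Fin 3) (n : ℕ), IsPolyGrowth (Metric.ball x₀ 1 \ twoTwo.disc)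
      (Metric.infDist · twoTwo.disc) n (fun b : E3 => b i) := fun i n =>
    IsPolyGrowth.linear hw ⟨C, hC⟩ (dcoord i)
  have h0 : IsPolyGrowth (Metric.ball x₀ 1 \ twoTwo.disc) (Metric.infDist · twoTwo.disc) 0
      (fun b : E3 => -(1 / 2) * Real.log (b 0 ^ 2 + b 1 ^ 2)) := by
    refine IsPolyGrowth.zero_of_bound 2 (2 * C ^ 2 + 1) hw fun b hb => ?_
    have hq := sq_add_sq_pos_of_notMem hb.2
    have hρ := sq_infDist_twoTwo_le b
    have hρ0 := hw.pos b hb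
    have hρ1 := hw.le_one b hb
    have hc : ∀ i : Fin 3, b i ^ 2 ≤ C ^ 2 := fun i => by
      rw [← sq_abs]
      exact pow_le_pow_left₀ (abs_nonneg _) ((PiLp.norm_apply_le b i).trans (hC b hb)) 2
    have hup : Real.log (b 0 ^ 2 + b 1 ^ 2) ≤ b 0 ^ 2 + b 1 ^ 2 - 1 := Real.log_le_sub_one_of_pos hq
    have hdn : 1 - (b 0 ^ 2 + b 1 ^ 2)⁻¹ ≤ Real.log (b 0 ^ 2 + b 1 ^ 2) :=
      Real.one_sub_inv_le_log_of_pos hq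
    set q := b 0 ^ 2 + b 1 ^ 2 with hqdef
    set d := Metric.infDist b twoTwo.disc with hddef
    have hd2 : d ^ 2 ≤ 1 := pow_le_one₀ hρ0.le hρ1
    have hqi : q⁻¹ * d ^ 2 ≤ 1 := by
      rw [inv_mul_le_iff₀ hq]; linarith
    have hqC : q ≤ 2 * C ^ 2 := by linarith [hc 0, hc 1]
    have habs : |Real.log q| ≤ q + q⁻¹ := by
      rw [abs_le]
      constructor <;> linarith [inv_pos.2 hq]
    have h3 : |Real.log q| * d ^ 2 ≤ q * d ^ 2 + q⁻¹ * d ^ 2 := by nlinarith [sq_nonneg d]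
    have h4 : q * d ^ 2 ≤ q := mul_le_of_le_one_right hq.le hd2
    rw [Real.norm_eq_abs, abs_mul, abs_neg, abs_of_pos (by norm_num : (0 : ℝ) < 1 / 2)]
    have h5 : 0 ≤ |Real.log q| * d ^ 2 := by positivity
    linarith
  cases n with
  | zero => exact h0
  | succ n =>
    refine IsPolyGrowth.succ hw h0 (fun b hb =>
      (hasFDerivAt_log_twoTwo hb.2).differentiableAt.differentiableWithinAt) ?_
    refine IsPolyGrowth.congr hw (IsPolyGrowth.smul hw (IsPolyGrowth.neg hw (IsPolyGrowth.inv hw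
      (((hcoord 0 n).mul hw (hcoord 0 n)).add hw ((hcoord 1 n).mul hw (hcoord 1 n))) 2 1 one_pos
      fun b hb => ?_)) (((hcoord 0 n).smul hw (IsPolyGrowth.const (dcoord 0))).add hw
        ((hcoord 1 n).smul hw (IsPolyGrowth.const (dcoord 1))))) fun b hb => ?_
    · rw [one_mul, ← pow_two, ← pow_two]
      exact (sq_infDist_twoTwo_le b).trans (le_abs_self _)
    · rw [(hasFDerivAt_log_twoTwo hb.2).fderiv, pow_two, pow_two]

/-- On the cut of the principal branch, `b 1 = 0` and `b 0 < 0`, the line runs inside the cut. There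
the argument is constantly `π`, and the formula correctly gives zero. -/
theorem hasDerivAt_arg_twoTwo {b : E3} (hb : b ∉ twoTwo.disc) :
    HasDerivAt (fun s : ℝ => Complex.arg ⟨b 0 + s, b 1⟩) (-(b 0 ^ 2 + b 1 ^ 2)⁻¹ * b 1) 0 := by
  by_cases hs : (⟨b 0, b 1⟩ : ℂ) ∈ Complex.slitPlane
  · have h1 : HasDerivAt (fun s : ℝ => (⟨b 0 + s, b 1⟩ : ℂ)) 1 0 := by
      have h2 : (fun s : ℝ => (⟨b 0 + s, b 1⟩ : ℂ)) = fun s : ℝ => (⟨b 0, b 1⟩ : ℂ) + (s : ℂ) := by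
        ext s
        apply Complex.ext <;> simp
      rw [h2]
      exact (Complex.ofRealCLM.hasDerivAt (x := (0 : ℝ))).const_add _
    have h3 := h1.clog_real (by simpa using hs)
    have h4 := Complex.imCLM.hasFDerivAt.comp_hasDerivAt 0 h3
    simp only [Function.comp_def, Complex.imCLM_apply, Complex.log_im] at h4
    refine h4.congr_deriv ?_
    rw [one_div, Complex.inv_im, Complex.normSq_mk]
    simp
    ring
  · rw [Complex.mem_slitPlane_iff] at hs
    push Not at hs
    obtain ⟨h0, h1⟩ := hs
    simp only at h0 h1
    have h2 : b 0 < 0 := lt_of_le_of_ne h0 fun h => hb ⟨h, h1⟩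
    rw [h1, mul_zero]
    refine (hasDerivAt_const (0 : ℝ) Real.pi).congr_of_eventuallyEq ?_
    filter_upwards [gt_mem_nhds (show (0 : ℝ) < -b 0 by linarith)] with s hs
    rw [Complex.arg_eq_pi_iff]
    exact ⟨by simp only; linarith, rfl⟩

theorem isTameForm_twoTwo {x₀ : E3} (hx₀ : x₀ ∈ twoTwo.disc) :
    IsTameForm twoTwo.disc axis x₀ 1 twoTwo.tauZero := by
  have hd : ∀ b ∈ Metric.ball x₀ 1 \ twoTwo.disc, ∀ k : Fin 3, k ≠ 0 →
      HasDerivAt (fun s : ℝ => (![fun _ => 0, fun b : E3 => Complex.arg ⟨b 0, b 1⟩, fun _ => 0] :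
        Fin 3 → E3 → ℝ) k (b + s • axis))
        (fderiv ℝ (fun b : E3 => -(1 / 2) * Real.log (b 0 ^ 2 + b 1 ^ 2)) b
          (EuclideanSpace.single k 1)) 0 := by
    intro b hb k hk
    rw [(hasFDerivAt_log_twoTwo hb.2).fderiv]
    fin_cases k
    · exact absurd rfl hk
    · simpa using hasDerivAt_arg_twoTwo hb.2
    · simpa using hasDerivAt_const (0 : ℝ) (0 : ℝ)
  refine isTameForm_of_components (A := fun b : E3 => -(1 / 2) * Real.log (b 0 ^ 2 + b 1 ^ 2))
    (α := ![fun _ => 0, fun b => Complex.arg ⟨b 0, b 1⟩, fun _ => 0])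
    twoTwo.isClosed_disc hx₀ le_rfl (fun b => ?_)
    (isPolyGrowth_log_twoTwo hx₀) (fun b hb k hk => (hd b hb k hk).continuousAt)
    fun b hb _ => hd b hb
  simp only [← neg_log_norm_eq]
  simp [tauZero]

theorem tauZero_large_twoTwo {x₀ : E3} (hx₀ : x₀ ∈ twoTwo.disc) (M : ℝ) :
    ∃ r > 0, ∀ b ∈ Metric.ball x₀ r \ twoTwo.disc, M ≤ 1 * twoTwo.tauZero b axis := by
  refine ⟨Real.exp (-M), Real.exp_pos _, fun b hb => ?_⟩
  have hpos : 0 < ‖(⟨b 0, b 1⟩ : ℂ)‖ := by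
    refine lt_of_le_of_ne (norm_nonneg _) fun h => ?_
    have := sq_add_sq_pos_of_notMem hb.2
    rw [← normSq_eq, ← h] at this
    norm_num at this
  have h1 : ‖(⟨b 0, b 1⟩ : ℂ)‖ ≤ dist b x₀ := by
    refine (sq_le_sq₀ hpos.le dist_nonneg).1 ?_
    rw [normSq_eq, dist_sq_E3, hx₀.1, hx₀.2]
    nlinarith [sq_nonneg (b 2 - x₀ 2)]
  have h2 : Real.log ‖(⟨b 0, b 1⟩ : ℂ)‖ ≤ -M := by
    rw [Real.log_le_iff_le_exp hpos]
    exact h1.trans (le_of_lt hb.1)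
  simp [tauZero]
  linarith

/-! ### The largest root of the cubic of the Harvey-Lawson singularity -/

/-- The derivative of the cubic `P_b`. -/
def hlPolyDeriv (b : E3) (x : ℝ) : ℝ := (x - b 1) * (x - b 2) + x * (x - b 2) + x * (x - b 1)

theorem hlPoly_strictMono {b : E3} {x y : ℝ} (h0 : 0 ≤ x) (h1 : b 1 ≤ x) (h2 : b 2 ≤ x)
    (hxy : x < y) : hlPoly b x < hlPoly b y := by
  unfold hlPoly
  have h3 : x * (x - b 1) < y * (y - b 1) :=
    mul_lt_mul'' hxy (by linarith) h0 (by linarith)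
  have h4 : x * (x - b 1) * (x - b 2) < y * (y - b 1) * (y - b 2) :=
    mul_lt_mul'' h3 (by linarith) (mul_nonneg h0 (by linarith)) (by linarith)
  linarith

/-- Above `0`, `b 1` and `b 2` the polynomial is strictly increasing, so a solution in that range is
the largest one. -/
theorem hlRoot_eq {b : E3} {c r : ℝ} (h0 : 0 ≤ r) (h1 : b 1 ≤ r) (h2 : b 2 ≤ r)
    (hr : hlPoly b r = c) : hlRoot c b = r := by
  refine IsGreatest.csSup_eq ⟨hr, fun x hx => ?_⟩
  by_contra hlt
  have := hlPoly_strictMono h0 h1 h2 (not_le.1 hlt)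
  rw [hr, show hlPoly b x = c from hx] at this
  exact lt_irrefl _ this

theorem exists_hlRoot (b : E3) {c : ℝ} (hc : 0 ≤ c) :
    ∃ r, 0 ≤ r ∧ b 1 ≤ r ∧ b 2 ≤ r ∧ hlPoly b r = c := by
  set M := max 0 (max (b 1) (b 2)) with hM
  have hM0 : 0 ≤ M := le_max_left _ _
  have hM1 : b 1 ≤ M := (le_max_left _ _).trans (le_max_right _ _)
  have hM2 : b 2 ≤ M := (le_max_right _ _).trans (le_max_right _ _)
  -- `M` is the largest of the roots `0`, `b 1`, `b 2` of the cubic part, so `P_b(M) = -b 0 ^ 2 ≤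
  -- c`.
  have hzero : M * (M - b 1) * (M - b 2) = 0 := by
    rcases max_choice 0 (max (b 1) (b 2)) with h | h
    · rw [hM, h]; ring
    · rcases max_choice (b 1) (b 2) with h' | h'
      · rw [hM, h, h']; ring
      · rw [hM, h, h']; ring
  -- At `L` each of the three linear factors is at least `b 0 ^ 2 + c + 1 ≥ 1`, hence so is their
  -- product.
  set L := M + (b 0 ^ 2 + c + 1) with hL
  have hL1 : 1 ≤ b 0 ^ 2 + c + 1 := by nlinarith [sq_nonneg (b 0)]
  have hlow : hlPoly b M ≤ c := by
    unfold hlPoly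
    rw [hzero]
    nlinarith [sq_nonneg (b 0)]
  have hup : c ≤ hlPoly b L := by
    unfold hlPoly
    have h3 : b 0 ^ 2 + c + 1 ≤ L * (L - b 1) := by nlinarith
    have h4 : b 0 ^ 2 + c + 1 ≤ L * (L - b 1) * (L - b 2) := by nlinarith
    linarith
  have hcont : ContinuousOn (hlPoly b) (Icc M L) := by
    unfold hlPoly
    fun_prop
  obtain ⟨r, hr, hrc⟩ := intermediate_value_Icc (by linarith) hcont ⟨hlow, hup⟩
  exact ⟨r, hM0.trans hr.1, hM1.trans hr.1, hM2.trans hr.1, hrc⟩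

/-- The largest solution of `P_b(x) = u ^ 2`. -/
noncomputable def hlR (q : E3 × ℝ) : ℝ := hlRoot (q.2 ^ 2) q.1

theorem hlR_spec (q : E3 × ℝ) :
    0 ≤ hlR q ∧ q.1 1 ≤ hlR q ∧ q.1 2 ≤ hlR q ∧
      hlR q * (hlR q - q.1 1) * (hlR q - q.1 2) = q.1 0 ^ 2 + q.2 ^ 2 := by
  obtain ⟨r, h0, h1, h2, hr⟩ := exists_hlRoot q.1 (sq_nonneg q.2)
  have : hlR q = r := hlRoot_eq h0 h1 h2 hr
  rw [this]
  unfold hlPoly at hr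
  exact ⟨h0, h1, h2, by linarith⟩

theorem hlPoly_hlR (q : E3 × ℝ) : hlPoly q.1 (hlR q) = q.2 ^ 2 := by
  have := (hlR_spec q).2.2.2
  unfold hlPoly
  linarith

theorem hlR_lt_of {q : E3 × ℝ} {y : ℝ} (h0 : 0 ≤ y) (h1 : q.1 1 ≤ y) (h2 : q.1 2 ≤ y)
    (hy : q.2 ^ 2 < hlPoly q.1 y) : hlR q < y := by
  by_contra h
  rcases (not_lt.1 h).eq_or_lt with h | h
  · rw [h, hlPoly_hlR] at hy
    exact lt_irrefl _ hy
  · have := hlPoly_strictMono h0 h1 h2 h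
    rw [hlPoly_hlR] at this
    exact lt_asymm hy this

theorem lt_hlR_of {q : E3 × ℝ} {y : ℝ} (hy : hlPoly q.1 y < q.2 ^ 2) : y < hlR q := by
  by_contra h
  obtain ⟨h0, h1, h2, _⟩ := hlR_spec q
  rcases (not_lt.1 h).eq_or_lt with h | h
  · rw [← h, hlPoly_hlR] at hy
    exact lt_irrefl _ hy
  · have := hlPoly_strictMono h0 h1 h2 h
    rw [hlPoly_hlR] at this
    exact lt_asymm hy this

theorem hlR_strictMonoOn (b : E3) : StrictMonoOn (fun u => hlR (b, u)) (Ici 0) := by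
  intro u hu u' _ huu
  refine lt_hlR_of ?_
  rw [hlPoly_hlR (b, u)]
  exact pow_lt_pow_left₀ huu hu two_ne_zero

/-- The order topology suffices: both `y < R` and `R < y` are witnessed by open conditions, namely
the sign of `P_b(y) - u²` and comparisons of `y` with `0`, `b 1` and `b 2`. -/
theorem continuous_hlR : Continuous hlR := by
  have hc : ∀ y : ℝ, Continuous fun q : E3 × ℝ => hlPoly q.1 y := fun y => by
    have := continuous_coord
    unfold hlPoly
    have h0 := (continuous_coord 0).comp (continuous_fst (X := E3) (Y := ℝ))
    have h1 := (continuous_coord 1).comp (continuous_fst (X := E3) (Y := ℝ))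
    have h2 := (continuous_coord 2).comp (continuous_fst (X := E3) (Y := ℝ))
    exact ((continuous_const.mul (continuous_const.sub h1)).mul (continuous_const.sub h2)).sub
      (h0.pow 2)
  have h1 := (continuous_coord 1).comp (continuous_fst (X := E3) (Y := ℝ))
  have h2 := (continuous_coord 2).comp (continuous_fst (X := E3) (Y := ℝ))
  have hu : Continuous fun q : E3 × ℝ => q.2 ^ 2 := by fun_prop
  refine continuous_iff_continuousAt.2 fun q => tendsto_order.2 ⟨fun y hy => ?_, fun y hy => ?_⟩
  · obtain ⟨h0, h1', h2', _⟩ := hlR_spec q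
    by_cases hy0 : 0 ≤ y
    · by_cases hy1 : q.1 1 ≤ y
      · by_cases hy2 : q.1 2 ≤ y
        · have := hlPoly_strictMono hy0 hy1 hy2 hy
          rw [hlPoly_hlR] at this
          filter_upwards [((hc y).tendsto q).eventually_lt (hu.tendsto q) this] with x hx
          exact lt_hlR_of hx
        · filter_upwards [(h2.tendsto q).eventually (lt_mem_nhds (not_le.1 hy2))] with x hx
          exact lt_of_lt_of_le hx (hlR_spec x).2.2.1
      · filter_upwards [(h1.tendsto q).eventually (lt_mem_nhds (not_le.1 hy1))] with x hx
        exact lt_of_lt_of_le hx (hlR_spec x).2.1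
    · exact Filter.Eventually.of_forall fun x => (not_le.1 hy0).trans_le (hlR_spec x).1
  · obtain ⟨h0, h1', h2', _⟩ := hlR_spec q
    have := hlPoly_strictMono h0 h1' h2' hy
    rw [hlPoly_hlR] at this
    filter_upwards [(hu.tendsto q).eventually_lt ((hc y).tendsto q) this,
      (h1.tendsto q).eventually (gt_mem_nhds (h1'.trans_lt hy)),
      (h2.tendsto q).eventually (gt_mem_nhds (h2'.trans_lt hy))] with x hx hx1 hx2
    exact hlR_lt_of (h0.trans hy.le) hx1.le hx2.le hx

theorem hlR_le {q : E3 × ℝ} {C : ℝ} (hC : 0 ≤ C) (h0 : |q.1 0| ≤ C) (h1 : q.1 1 ≤ C)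
    (h2 : q.1 2 ≤ C) (hu : q.2 ^ 2 ≤ 4) : hlR q ≤ C ^ 2 + C + 5 := by
  refine (hlR_lt_of (by positivity) (by nlinarith) (by nlinarith) ?_).le
  have h3 : q.1 0 ^ 2 ≤ C ^ 2 := by rw [← sq_abs]; exact pow_le_pow_left₀ (abs_nonneg _) h0 2
  unfold hlPoly
  set L := C ^ 2 + C + 5
  have hL : C ^ 2 + 5 ≤ L := by simp only [L]; linarith
  have hL1 : C ^ 2 + 5 ≤ L - q.1 1 := by simp only [L]; linarith
  have hL2 : C ^ 2 + 5 ≤ L - q.1 2 := by simp only [L]; linarith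
  have h5 : (1 : ℝ) ≤ C ^ 2 + 5 := by nlinarith
  have h6 : C ^ 2 + 5 ≤ L * (L - q.1 1) := by nlinarith
  have h7 : C ^ 2 + 5 ≤ L * (L - q.1 1) * (L - q.1 2) := by nlinarith
  linarith

theorem sq_infDist_oneTwo_le {b x : E3} (hx : x ∈ oneTwo.disc) :
    Metric.infDist b oneTwo.disc ^ 2 ≤ b 0 ^ 2 + (b 1 - x 1) ^ 2 + (b 2 - x 2) ^ 2 := by
  have h2 := Metric.infDist_le_dist_of_mem (x := b) hx
  have h3 := dist_sq_E3 b x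
  rw [hx.1, sub_zero] at h3
  rw [← h3]
  exact pow_le_pow_left₀ Metric.infDist_nonneg h2 2

/-- The quantities `p = R`, `p - b 1` and `p - b 2` are nonnegative, and `P_b'(p)` is the sum of
their pairwise products. Their triple product is `b 0 ^ 2 + u ^ 2`, so `b 0 ^ 2 ≤ p P_b'(p)`. The
displacement within the plane `b 0 = 0` costs at most `P_b'(p)`, which explains the factor `R + 1`.
-/
theorem sq_infDist_le_hlPolyDeriv (q : E3 × ℝ) :
    Metric.infDist q.1 oneTwo.disc ^ 2 ≤ (hlR q + 1) * hlPolyDeriv q.1 (hlR q) := by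
  obtain ⟨h0, h1, h2, hc⟩ := hlR_spec q
  obtain ⟨b, u⟩ := q
  simp only at *
  set p := hlR (b, u)
  unfold hlPolyDeriv
  have hq : 0 ≤ p - b 1 := by linarith
  have hs : 0 ≤ p - b 2 := by linarith
  have hb0 : b 0 ^ 2 ≤ p * ((p - b 1) * (p - b 2)) := by nlinarith [sq_nonneg u]
  have hpq := mul_nonneg h0 hq
  have hps := mul_nonneg h0 hs
  have hqs := mul_nonneg hq hs
  -- The point `x` arises by moving the largest or second largest of the roots `0`, `b 1`, `b 2` so
  -- that these two coincide; the cases below say which pair this is.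
  suffices hplane : ∃ x ∈ oneTwo.disc, (b 1 - x 1) ^ 2 + (b 2 - x 2) ^ 2 ≤
      (p - b 1) * (p - b 2) + p * (p - b 2) + p * (p - b 1) by
    obtain ⟨x, hx, hle⟩ := hplane
    have := sq_infDist_oneTwo_le (b := b) hx
    nlinarith [mul_nonneg h0 hpq, mul_nonneg h0 hps]
  rcases le_total (b 2) (b 1) with h12 | h12
  · rcases le_total (b 2) 0 with hb2 | hb2
    · exact ⟨!₂[0, 0, b 2], ⟨by simp, Or.inr (Or.inl ⟨by simp, by simpa using hb2⟩)⟩, by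
        simp; nlinarith⟩
    · exact ⟨!₂[0, b 2, b 2], ⟨by simp, Or.inl ⟨by simp, by simpa using hb2⟩⟩, by
        simp; nlinarith⟩
  · rcases le_total (b 1) 0 with hb1 | hb1
    · exact ⟨!₂[0, b 1, 0], ⟨by simp, Or.inr (Or.inr ⟨by simp, by simpa using hb1⟩)⟩, by
        simp; nlinarith⟩
    · exact ⟨!₂[0, b 1, b 1], ⟨by simp, Or.inl ⟨by simp, by simpa using hb1⟩⟩, by
        simp; nlinarith⟩

theorem hlPolyDeriv_nonneg (q : E3 × ℝ) : 0 ≤ hlPolyDeriv q.1 (hlR q) := by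
  obtain ⟨h0, h1, h2, _⟩ := hlR_spec q
  unfold hlPolyDeriv
  have hq : 0 ≤ hlR q - q.1 1 := by linarith
  have hs : 0 ≤ hlR q - q.1 2 := by linarith
  positivity

theorem hlPolyDeriv_pos {q : E3 × ℝ} (hq : q.1 ∉ oneTwo.disc) : 0 < hlPolyDeriv q.1 (hlR q) := by
  have hne : (oneTwo.disc).Nonempty := ⟨0, by refine ⟨by simp, Or.inl ⟨by simp, by simp⟩⟩⟩
  have h1 := (oneTwo.isClosed_disc.notMem_iff_infDist_pos hne).1 hq
  refine lt_of_le_of_ne (hlPolyDeriv_nonneg q) fun h => ?_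
  have h2 := sq_infDist_le_hlPolyDeriv q
  rw [← h, mul_zero] at h2
  nlinarith

/-- The reciprocal of the derivative of `P_b` at the largest solution of `P_b(x) = u ^ 2`. -/
noncomputable def hlW (q : E3 × ℝ) : ℝ := (hlPolyDeriv q.1 (hlR q))⁻¹

theorem continuous_hlPolyDeriv : Continuous fun p : (E3 × ℝ) => hlPolyDeriv p.1 (hlR p) := by
  have h1 := (continuous_coord 1).comp (continuous_fst (X := E3) (Y := ℝ))
  have h2 := (continuous_coord 2).comp (continuous_fst (X := E3) (Y := ℝ))
  have hR := continuous_hlR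
  unfold hlPolyDeriv
  exact (((hR.sub h1).mul (hR.sub h2)).add (hR.mul (hR.sub h2))).add (hR.mul (hR.sub h1))

theorem continuous_hlR_right (b : E3) : Continuous fun u => hlR (b, u) :=
  continuous_hlR.comp (by fun_prop)

theorem continuous_hlW_right {b : E3} (hb : b ∉ oneTwo.disc) : Continuous fun u => hlW (b, u) :=
  Continuous.inv₀ (continuous_hlPolyDeriv.comp (by fun_prop : Continuous fun u : ℝ => (b, u)))
    fun u => (hlPolyDeriv_pos (q := (b, u)) hb).ne'

/-! ### Growth of the largest root and of the reciprocal derivative. -/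

section Ball

variable {x₀ : E3}

/-- A neighbourhood of `[0, 1]`. -/
abbrev unitNhd : Set ℝ := Ioo (-(1 / 2) : ℝ) (3 / 2)

theorem isWeight_prod {Ω : Set E3} {ρ : E3 → ℝ} (hw : IsWeight Ω ρ) :
    IsWeight (Ω ×ˢ unitNhd) (fun q => ρ q.1) :=
  ⟨hw.isOpen.prod isOpen_Ioo, fun _ hq => hw.pos _ hq.1, fun _ hq => hw.le_one _ hq.1⟩

theorem norm_coord_le_of_mem_ball {b : E3} (hb : b ∈ Metric.ball x₀ 1) (i : Fin 3) :
    |b i| ≤ ‖x₀‖ + 1 := by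
  have h3 := norm_le_norm_add_norm_sub' b x₀
  rw [← dist_eq_norm] at h3
  have : dist b x₀ < 1 := hb
  have h4 := PiLp.norm_apply_le b i
  rw [Real.norm_eq_abs] at h4
  linarith

theorem exists_hlR_bound (x₀ : E3) : ∃ K, 0 ≤ K ∧
    ∀ q ∈ Metric.ball x₀ 1 ×ˢ unitNhd, hlR q ≤ K := by
  have hC : 0 ≤ ‖x₀‖ + 1 := by positivity
  refine ⟨(‖x₀‖ + 1) ^ 2 + (‖x₀‖ + 1) + 5, by positivity, fun q hq => ?_⟩
  have h := norm_coord_le_of_mem_ball hq.1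
  refine hlR_le hC (h 0) ((le_abs_self _).trans (h 1)) ((le_abs_self _).trans (h 2)) ?_
  nlinarith [hq.2.1, hq.2.2]

theorem norm_le_of_mem_prod {Ω : Set E3} (hΩ : Ω ⊆ Metric.ball x₀ 1) :
    ∃ C, ∀ q ∈ Ω ×ˢ unitNhd, ‖q‖ ≤ C := by
  refine ⟨max (‖x₀‖ + 1) (3 / 2), fun q hq => max_le_max ?_ ?_⟩
  · have h3 := norm_le_norm_add_norm_sub' q.1 x₀
    rw [← dist_eq_norm] at h3
    have : dist q.1 x₀ < 1 := hΩ hq.1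
    linarith
  · rw [Real.norm_eq_abs, abs_le]
    constructor <;> linarith [hq.2.1, hq.2.2]

/-- The largest root solves an implicit equation whose derivative in the unknown is `P_b'(R) ≥ ρ² /
(K + 1)`, with `K` a bound for `R`. So `IsPolyGrowth.implicit` applies. -/
theorem isPolyGrowth_hlR (hx₀ : x₀ ∈ oneTwo.disc) (n : ℕ) :
    IsPolyGrowth ((Metric.ball x₀ 1 \ oneTwo.disc) ×ˢ unitNhd)
      (fun q => Metric.infDist q.1 oneTwo.disc) n hlR := by
  have hw := isWeight_infDist (r := 1) oneTwo.isClosed_disc hx₀ le_rfl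
  have hwI := isWeight_prod hw
  obtain ⟨K, hK0, hK⟩ := exists_hlR_bound x₀
  obtain ⟨C, hC⟩ := norm_le_of_mem_prod (x₀ := x₀) (Ω := Metric.ball x₀ 1 \ oneTwo.disc)
    sdiff_subset
  set Ω₂ : Set ((E3 × ℝ) × ℝ) :=
    ((Metric.ball x₀ 1 \ oneTwo.disc) ×ˢ unitNhd) ×ˢ Ioo (-1) (K + 1) with hΩ₂
  have hw2 : IsWeight Ω₂ (fun p => Metric.infDist p.1.1 oneTwo.disc) :=
    ⟨hwI.isOpen.prod isOpen_Ioo, fun _ hq => hwI.pos _ hq.1, fun _ hq => hwI.le_one _ hq.1⟩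
  have hb2 : ∃ C, ∀ p ∈ Ω₂, ‖p‖ ≤ C := by
    refine ⟨max C (K + 1), fun p hp => max_le_max (hC _ hp.1) ?_⟩
    rw [Real.norm_eq_abs, abs_le]
    constructor <;> linarith [hp.2.1, hp.2.2]
  have pc : ∀ (i : Fin 3) (n : ℕ), IsPolyGrowth Ω₂ (fun p => Metric.infDist p.1.1 oneTwo.disc) n
      (fun p => p.1.1 i) := fun i n => IsPolyGrowth.linear hw2 hb2 ((dcoord i).comp
    ((ContinuousLinearMap.fst ℝ E3 ℝ).comp (ContinuousLinearMap.fst ℝ (E3 × ℝ) ℝ)))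
  have pu : ∀ n, IsPolyGrowth Ω₂ (fun p => Metric.infDist p.1.1 oneTwo.disc) n
      (fun p => p.1.2) := fun n => IsPolyGrowth.linear hw2 hb2
    ((ContinuousLinearMap.snd ℝ E3 ℝ).comp (ContinuousLinearMap.fst ℝ (E3 × ℝ) ℝ))
  have px : ∀ n, IsPolyGrowth Ω₂ (fun p => Metric.infDist p.1.1 oneTwo.disc) n
      (fun p => p.2) := fun n => IsPolyGrowth.linear hw2 hb2
    (ContinuousLinearMap.snd ℝ (E3 × ℝ) ℝ)
  have pH : ∀ n, IsPolyGrowth Ω₂ (fun p => Metric.infDist p.1.1 oneTwo.disc) n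
      (fun p => p.2 * (p.2 - p.1.1 1) * (p.2 - p.1.1 2) -
        (p.1.1 0 * p.1.1 0 + p.1.2 * p.1.2)) := fun n =>
    (((px n).mul hw2 ((px n).sub hw2 (pc 1 n))).mul hw2 ((px n).sub hw2 (pc 2 n))).sub hw2
      (((pc 0 n).mul hw2 (pc 0 n)).add hw2 ((pu n).mul hw2 (pu n)))
  have hHd : ∀ p ∈ Ω₂, fderiv ℝ (fun p : (E3 × ℝ) × ℝ => p.2 * (p.2 - p.1.1 1) *
      (p.2 - p.1.1 2) - (p.1.1 0 * p.1.1 0 + p.1.2 * p.1.2)) p (0, 1) =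
      hlPolyDeriv p.1.1 p.2 := by
    intro p hp
    have h1 := (((pH 1).differentiableOn.differentiableAt (hw2.isOpen.mem_nhds hp)).hasFDerivAt
      ).comp_hasDerivAt p.2 ((hasDerivAt_const p.2 p.1).prodMk (hasDerivAt_id p.2))
    have hx := hasDerivAt_id p.2
    have h2 : HasDerivAt (fun x => x * (x - p.1.1 1) * (x - p.1.1 2) -
        (p.1.1 0 * p.1.1 0 + p.1.2 * p.1.2))
        ((1 * (p.2 - p.1.1 1) + p.2 * 1) * (p.2 - p.1.1 2) + p.2 * (p.2 - p.1.1 1) * 1) p.2 :=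
      (((hx.mul (hx.sub_const _)).mul (hx.sub_const _)).sub_const _)
    refine (h1.unique h2).trans ?_
    unfold hlPolyDeriv
    ring
  have hmem : ∀ q ∈ (Metric.ball x₀ 1 \ oneTwo.disc) ×ˢ unitNhd, (q, hlR q) ∈ Ω₂ := fun q hq =>
    ⟨hq, by linarith [(hlR_spec q).1], by linarith [hK q ⟨hq.1.1, hq.2⟩]⟩
  refine IsPolyGrowth.implicit hwI hw2 ⟨C, hC⟩ pH continuous_hlR.continuousOn hmem
    (fun q _ => ?_) ⟨K, fun q hq => ?_⟩ 2 (K + 1)⁻¹ (by positivity) (fun q hq => ?_) n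
  · have := (hlR_spec q).2.2.2
    simp only
    linarith
  · rw [Real.norm_eq_abs, abs_of_nonneg (hlR_spec q).1]
    exact hK q ⟨hq.1.1, hq.2⟩
  · rw [hHd _ (hmem q hq), abs_of_nonneg (hlPolyDeriv_nonneg q), inv_mul_le_iff₀ (by positivity)]
    refine (sq_infDist_le_hlPolyDeriv q).trans ?_
    have := hK q ⟨hq.1.1, hq.2⟩
    have := hlPolyDeriv_nonneg q
    gcongr

theorem isPolyGrowth_hlW (hx₀ : x₀ ∈ oneTwo.disc) (n : ℕ) :
    IsPolyGrowth ((Metric.ball x₀ 1 \ oneTwo.disc) ×ˢ unitNhd)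
      (fun q => Metric.infDist q.1 oneTwo.disc) n hlW := by
  have hw := isWeight_infDist (r := 1) oneTwo.isClosed_disc hx₀ le_rfl
  have hwI := isWeight_prod hw
  obtain ⟨K, hK0, hK⟩ := exists_hlR_bound x₀
  have hb := norm_le_of_mem_prod (x₀ := x₀) (Ω := Metric.ball x₀ 1 \ oneTwo.disc) sdiff_subset
  have pR := isPolyGrowth_hlR hx₀ n
  have pc : ∀ i : Fin 3, IsPolyGrowth _ _ n (fun q : E3 × ℝ => q.1 i) := fun i =>
    IsPolyGrowth.linear hwI hb ((dcoord i).comp (ContinuousLinearMap.fst ℝ E3 ℝ))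
  have p1 := pR.sub hwI (pc 1)
  have p2 := pR.sub hwI (pc 2)
  refine IsPolyGrowth.inv hwI (((p1.mul hwI p2).add hwI (pR.mul hwI p2)).add hwI (pR.mul hwI p1))
    2 (K + 1)⁻¹ (by positivity) fun q hq => ?_
  rw [abs_of_nonneg (hlPolyDeriv_nonneg q), inv_mul_le_iff₀ (by positivity)]
  refine (sq_infDist_le_hlPolyDeriv q).trans ?_
  have := hK q ⟨hq.1.1, hq.2⟩
  have := hlPolyDeriv_nonneg q
  gcongr

theorem hasFDerivAt_hlR (hx₀ : x₀ ∈ oneTwo.disc) {q : E3 × ℝ}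
    (hq : q ∈ (Metric.ball x₀ 1 \ oneTwo.disc) ×ˢ unitNhd) :
    HasFDerivAt hlR (hlW q • ((2 * q.1 0) • (dcoord 0).comp (ContinuousLinearMap.fst ℝ E3 ℝ) +
      (hlR q * (hlR q - q.1 2)) • (dcoord 1).comp (ContinuousLinearMap.fst ℝ E3 ℝ) +
      (hlR q * (hlR q - q.1 1)) • (dcoord 2).comp (ContinuousLinearMap.fst ℝ E3 ℝ) +
      (2 * q.2) • ContinuousLinearMap.snd ℝ E3 ℝ)) q := by
  have hw := isWeight_infDist (r := 1) oneTwo.isClosed_disc hx₀ le_rfl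
  have hR := ((isPolyGrowth_hlR hx₀ 1).differentiableOn.differentiableAt
    ((isWeight_prod hw).isOpen.mem_nhds hq)).hasFDerivAt
  have hcoord : ∀ i : Fin 3, HasFDerivAt (fun q : E3 × ℝ => q.1 i)
      ((dcoord i).comp (ContinuousLinearMap.fst ℝ E3 ℝ)) q := fun i =>
    ((dcoord i).comp (ContinuousLinearMap.fst ℝ E3 ℝ)).hasFDerivAt
  have h1 := (hR.mul (hR.sub (hcoord 1))).mul (hR.sub (hcoord 2))
  have h2 := ((hcoord 0).mul (hcoord 0)).add
    ((hasFDerivAt_snd (𝕜 := ℝ) (p := q)).mul (hasFDerivAt_snd (𝕜 := ℝ) (p := q)))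
  have h3 := h1.unique (h2.congr_of_eventuallyEq (Filter.Eventually.of_forall fun q => by
    have := (hlR_spec q).2.2.2
    simp only [Pi.mul_apply, Pi.sub_apply, Pi.add_apply]
    linarith))
  have hpos := hlPolyDeriv_pos (q := q) hq.1.2
  refine hR.congr_fderiv ?_
  refine ContinuousLinearMap.ext fun v => ?_
  have h4 := DFunLike.congr_fun h3 v
  simp only [add_apply, smul_apply, sub_apply, ContinuousLinearMap.comp_apply, dcoord_apply,
    ContinuousLinearMap.coe_fst', ContinuousLinearMap.coe_snd', smul_eq_mul, Pi.mul_apply,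
    Pi.sub_apply] at h4 ⊢
  rw [hlW, eq_inv_mul_iff_mul_eq₀ hpos.ne', hlPolyDeriv]
  linarith

end Ball

/-! ### The reference form of the Harvey-Lawson singularity -/

section Integrals

variable {x₀ b : E3}

theorem Icc_subset_unitNhd : Icc (0 : ℝ) 1 ⊆ unitNhd := Icc_subset_Ioo_half

theorem hasDerivAt_hlR_right (hx₀ : x₀ ∈ oneTwo.disc) (hb : b ∈ Metric.ball x₀ 1 \ oneTwo.disc)
    {u : ℝ} (hu : u ∈ unitNhd) :
    HasDerivAt (fun u => hlR (b, u)) (2 * u * hlW (b, u)) u := by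
  have h := HasFDerivAt.comp_hasDerivAt (l := hlR) u (hasFDerivAt_hlR hx₀ (q := (b, u)) ⟨hb, hu⟩)
    ((hasDerivAt_const u b).prodMk (hasDerivAt_id u))
  refine h.congr_deriv ?_
  simp
  ring

/-- The substitution `x = R(b, u)` in integrals of the form `∫ G(x) / √P_b(x) dx`. -/
theorem integral_hlPoly_eq (hx₀ : x₀ ∈ oneTwo.disc) (hb : b ∈ Metric.ball x₀ 1 \ oneTwo.disc)
    (G : ℝ → ℝ) :
    ∫ x in (hlRoot 0 b)..(hlRoot 1 b), G x / √(hlPoly b x) =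
      ∫ u in (0 : ℝ)..1, 2 * hlW (b, u) * G (hlR (b, u)) := by
  have hmono : StrictMonoOn (fun u => hlR (b, u)) (Icc 0 1) :=
    (hlR_strictMonoOn b).mono Icc_subset_Ici_self
  have h0 : hlRoot 0 b = hlR (b, 0) := by simp [hlR]
  have h1 : hlRoot 1 b = hlR (b, 1) := by simp [hlR]
  have himg : (fun u => hlR (b, u)) '' Icc 0 1 = Icc (hlR (b, 0)) (hlR (b, 1)) :=
    (continuous_hlR_right b).continuousOn.image_Icc_of_monotoneOn zero_le_one hmono.monotoneOn
  have hle : hlR (b, 0) ≤ hlR (b, 1) :=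
    hmono.monotoneOn (left_mem_Icc.2 zero_le_one) (right_mem_Icc.2 zero_le_one) zero_le_one
  -- The original integrand is singular where `P_b` vanishes, so the change of variables is made for
  -- set integrals over the image of an injective map, which asks no regularity of `G`. The Jacobian
  -- `2 u W` then cancels `√P_b = u`.
  rw [h0, h1, intervalIntegral.integral_of_le hle, intervalIntegral.integral_of_le zero_le_one,
    ← MeasureTheory.integral_Icc_eq_integral_Ioc, ← himg,
    MeasureTheory.integral_image_eq_integral_abs_deriv_smul measurableSet_Icc
      (fun u hu => (hasDerivAt_hlR_right hx₀ hb (Icc_subset_unitNhd hu)).hasDerivWithinAt)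
      hmono.injOn, MeasureTheory.integral_Icc_eq_integral_Ioc]
  refine MeasureTheory.setIntegral_congr_fun measurableSet_Ioc fun u hu => ?_
  have hW : 0 < hlW (b, u) := inv_pos.2 (hlPolyDeriv_pos (q := (b, u)) hb.2)
  have hu0 : 0 < u := hu.1
  have hP : hlPoly b (hlR (b, u)) = u ^ 2 := hlPoly_hlR (b, u)
  simp only [smul_eq_mul]
  rw [hP, Real.sqrt_sq hu0.le, abs_of_pos (by positivity)]
  field_simp

theorem hlAlpha_eq (hx₀ : x₀ ∈ oneTwo.disc) (hb : b ∈ Metric.ball x₀ 1 \ oneTwo.disc) :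
    hlAlpha b = -2 * ∫ u in (0 : ℝ)..1, hlW (b, u) := by
  have h := integral_hlPoly_eq hx₀ hb fun _ => 1
  simp only [mul_one] at h
  rw [hlAlpha, h, intervalIntegral.integral_const_mul]
  ring

theorem hlAngle_eq (hx₀ : x₀ ∈ oneTwo.disc) (hb : b ∈ Metric.ball x₀ 1 \ oneTwo.disc)
    (k j : Fin 3) :
    hlAngle k j b = -(b 0 * ∫ u in (0 : ℝ)..1, hlW (b, u) / (hlR (b, u) - b k)) -
      (open Classical in
        if 0 < b k ∧ b j < b k then Real.pi * (1 - (SignType.sign (b 0) : ℝ)) / 2 else 0) := by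
  have h := integral_hlPoly_eq hx₀ hb fun x => 1 / (x - b k)
  simp only [div_div] at h
  rw [hlAngle, h]
  congr 2
  have h2 : ∀ u, 2 * hlW (b, u) * (1 / (hlR (b, u) - b k)) =
      2 * (hlW (b, u) / (hlR (b, u) - b k)) := fun u => by ring
  simp only [h2]
  rw [intervalIntegral.integral_const_mul]
  ring

/-- The coefficient of `db₁` in the reference form. -/
noncomputable def hlA (b : E3) : ℝ :=
  -2 * (∫ u in (0 : ℝ)..1, hlW (b, u)) + hlR (b, 1) / (1 + b 0 ^ 2)

theorem tauZero_axis_eq (hx₀ : x₀ ∈ oneTwo.disc) (hb : b ∈ Metric.ball x₀ 1 \ oneTwo.disc) :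
    oneTwo.tauZero b axis = hlA b := by
  have h1 : hlRoot 1 b = hlR (b, 1) := by simp [hlR]
  simp [tauZero, hlA, hlAlpha_eq hx₀ hb, h1]

theorem isPolyGrowth_hlA (hx₀ : x₀ ∈ oneTwo.disc) (n : ℕ) :
    IsPolyGrowth (Metric.ball x₀ 1 \ oneTwo.disc) (Metric.infDist · oneTwo.disc) n hlA := by
  have hw := isWeight_infDist (r := 1) oneTwo.isClosed_disc hx₀ le_rfl
  have hwI := isWeight_prod hw
  have hb := bounded_of_mem_ball (x₀ := x₀) (r := 1) le_rfl (D := oneTwo.disc)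
  have p0 : IsPolyGrowth (Metric.ball x₀ 1 \ oneTwo.disc) (Metric.infDist · oneTwo.disc) n
      (fun b : E3 => b 0) := IsPolyGrowth.linear hw hb (dcoord 0)
  have p1 := IsPolyGrowth.comp hw hwI (isPolyGrowth_hlR hx₀ n)
    ((IsPolyGrowth.linear hw hb (ContinuousLinearMap.id ℝ E3)).prodMk hw
      (IsPolyGrowth.const (1 : ℝ))) (fun b hb => ⟨hb, Icc_subset_unitNhd (right_mem_Icc.2
        zero_le_one)⟩) one_pos fun b _ => by simp
  have p2 := ((IsPolyGrowth.const (1 : ℝ)).add hw (p0.mul hw p0)).inv hw 0 1 one_pos fun b _ => by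
    rw [pow_zero, mul_one]
    exact le_trans (by nlinarith [mul_self_nonneg (b 0)]) (le_abs_self _)
  have p3 := IsPolyGrowth.integral hw isOpen_Ioo Icc_subset_unitNhd (isPolyGrowth_hlW hx₀) n
  refine (((IsPolyGrowth.const (-2 : ℝ)).mul hw p3).add hw (p1.mul hw p2)).congr hw fun b _ => ?_
  simp [hlA, div_eq_mul_inv, pow_two]

/-- The part of the ball off the plane `b₁ = 0`. -/
def offPlane (x₀ : E3) : Set E3 := Metric.ball x₀ 1 ∩ {b | b 0 ≠ 0}

theorem offPlane_subset (x₀ : E3) : offPlane x₀ ⊆ Metric.ball x₀ 1 \ oneTwo.disc :=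
  fun _ hb => ⟨hb.1, fun h => hb.2 h.1⟩

/-- Since Δ lies in the plane `b 0 = 0`, the weight `|b 0|` is smaller than the distance to Δ, and
growth estimates pass to the complement of the plane. -/
theorem abs_le_infDist_oneTwo (b : E3) : |b 0| ≤ Metric.infDist b oneTwo.disc := by
  refine (Metric.le_infDist ⟨0, by refine ⟨by simp, Or.inl ⟨by simp, by simp⟩⟩⟩).2 fun x hx => ?_
  have h := PiLp.norm_apply_le (b - x) 0
  rw [dist_eq_norm]
  simpa [hx.1] using h

theorem isWeight_offPlane (hx₀ : x₀ ∈ oneTwo.disc) : IsWeight (offPlane x₀) (fun b => |b 0|) where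
  isOpen := Metric.isOpen_ball.inter
    (isOpen_ne_fun (continuous_coord 0) continuous_const)
  pos _ hb := abs_pos.2 hb.2
  le_one b hb := (abs_le_infDist_oneTwo b).trans
    ((isWeight_infDist (r := 1) oneTwo.isClosed_disc hx₀ le_rfl).le_one b (offPlane_subset x₀ hb))

/-- A single-valued primitive of the reference form off the plane `b₁ = 0`. -/
noncomputable def hlS (b : E3) : ℝ :=
  -b 0 * ∫ u in (0 : ℝ)..1, hlR (b, u) * (b 0 ^ 2 + u ^ 2)⁻¹

theorem isPolyGrowth_hlS_integrand (hx₀ : x₀ ∈ oneTwo.disc) (n : ℕ) :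
    IsPolyGrowth (offPlane x₀ ×ˢ unitNhd) (fun q => |q.1 0|) n
      (fun q => hlR q * (q.1 0 ^ 2 + q.2 ^ 2)⁻¹) := by
  have hw := isWeight_offPlane hx₀
  have hwI := isWeight_prod hw
  have hb := norm_le_of_mem_prod (x₀ := x₀) (Ω := offPlane x₀) inter_subset_left
  have pR : IsPolyGrowth (offPlane x₀ ×ˢ unitNhd) (fun q => |q.1 0|) n hlR :=
    IsPolyGrowth.comp hwI (isWeight_prod (isWeight_infDist (r := 1) oneTwo.isClosed_disc hx₀ le_rfl))
      (isPolyGrowth_hlR hx₀ n) (IsPolyGrowth.linear hwI hb (ContinuousLinearMap.id ℝ (E3 × ℝ)))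
      (fun q hq => ⟨offPlane_subset x₀ hq.1, hq.2⟩) one_pos
      fun q _ => by simpa using abs_le_infDist_oneTwo q.1
  have p0 : IsPolyGrowth (offPlane x₀ ×ˢ unitNhd) (fun q => |q.1 0|) n
      (fun q : E3 × ℝ => q.1 0) := IsPolyGrowth.linear hwI hb
    ((dcoord 0).comp (ContinuousLinearMap.fst ℝ E3 ℝ))
  have pu : IsPolyGrowth (offPlane x₀ ×ˢ unitNhd) (fun q => |q.1 0|) n
      (fun q : E3 × ℝ => q.2) := IsPolyGrowth.linear hwI hb (ContinuousLinearMap.snd ℝ E3 ℝ)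
  refine (pR.mul hwI (((p0.mul hwI p0).add hwI (pu.mul hwI pu)).inv hwI 2 1 one_pos
    fun q _ => ?_)).congr hwI fun q _ => by simp [pow_two]
  rw [one_mul, sq_abs]
  exact le_trans (by nlinarith [mul_self_nonneg q.2]) (le_abs_self _)

theorem contDiffOn_hlS (hx₀ : x₀ ∈ oneTwo.disc) : ContDiffOn ℝ ∞ hlS (offPlane x₀) := by
  have hw := isWeight_offPlane hx₀
  have hb : ∃ C, ∀ x ∈ offPlane x₀, ‖x‖ ≤ C :=
    (bounded_of_mem_ball (x₀ := x₀) (r := 1) le_rfl (D := oneTwo.disc)).imp fun C hC x hx =>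
      hC x (offPlane_subset x₀ hx)
  refine IsPolyGrowth.contDiffOn hw fun n => ?_
  have p0 : IsPolyGrowth (offPlane x₀) (fun b => |b 0|) n (fun b : E3 => b 0) :=
    IsPolyGrowth.linear hw hb (dcoord 0)
  exact (p0.neg hw).mul hw (IsPolyGrowth.integral hw isOpen_Ioo Icc_subset_unitNhd
    (isPolyGrowth_hlS_integrand hx₀) n)

theorem hlR_sub_pos {b : E3} (hb : b 0 ≠ 0) (u : ℝ) (k : Fin 3) (hk : k ≠ 0) :
    0 < hlR (b, u) - b k := by
  obtain ⟨h0, h1, h2, hc⟩ := hlR_spec (b, u)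
  have hpos : 0 < b 0 ^ 2 + u ^ 2 := by positivity
  simp only at h0 h1 h2 hc
  fin_cases k
  · exact absurd rfl hk
  · refine lt_of_le_of_ne (sub_nonneg.2 h1) fun h => ?_
    rw [show hlR (b, u) - b 1 = 0 from h.symm] at hc
    simp at hc
    linarith
  · refine lt_of_le_of_ne (sub_nonneg.2 h2) fun h => ?_
    rw [show hlR (b, u) - b 2 = 0 from h.symm] at hc
    simp at hc
    linarith

/-- In the directions `b 1` and `b 2` the cubic equation `R (R - b 1)(R - b 2) = b 0 ^ 2 + u ^ 2`
cancels the denominator of the integrand and leaves the angle integrals. In the direction `b 0` an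
integration by parts in `u` produces the integral of `W`. Its boundary term at `u = 1` is the
summand `ζ₁ / (1 + b₁²)`, which is why that summand makes the form closed. -/
theorem hasFDerivAt_hlS (hx₀ : x₀ ∈ oneTwo.disc) (hb : b ∈ offPlane x₀) :
    HasFDerivAt hlS (hlA b • dcoord 0 +
      (-(b 0 * ∫ u in (0 : ℝ)..1, hlW (b, u) / (hlR (b, u) - b 1))) • dcoord 1 +
      (-(b 0 * ∫ u in (0 : ℝ)..1, hlW (b, u) / (hlR (b, u) - b 2))) • dcoord 2) b := by
  have hw := isWeight_offPlane hx₀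
  have hwI := isWeight_prod hw
  have hb' := offPlane_subset x₀ hb
  have hb0 : b 0 ≠ 0 := hb.2
  set f : E3 × ℝ → ℝ := fun q => hlR q * (q.1 0 ^ 2 + q.2 ^ 2)⁻¹ with hf
  have hcd := IsPolyGrowth.contDiffOn hwI (isPolyGrowth_hlS_integrand hx₀)
  have hint := hasFDerivAt_integral_zero_one hw.isOpen isOpen_Ioo Icc_subset_unitNhd
    (hcd.of_le (by simp)) hb
  have hcpos : ∀ u : ℝ, 0 < b 0 ^ 2 + u ^ 2 := fun u => by positivity
  have hcont : ∀ u : ℝ, b 0 ^ 2 + u ^ 2 ≠ 0 := fun u => (hcpos u).ne'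
  have hRc := continuous_hlR_right b
  have hWc := continuous_hlW_right hb'.2
  have hcc : Continuous fun u : ℝ => (b 0 ^ 2 + u ^ 2)⁻¹ :=
    Continuous.inv₀ (by fun_prop) hcont
  have hinv : ∀ (u : ℝ) (k j : Fin 3), k = 1 ∧ j = 2 ∨ k = 2 ∧ j = 1 →
      hlR (b, u) * (hlR (b, u) - b j) * (b 0 ^ 2 + u ^ 2)⁻¹ = (hlR (b, u) - b k)⁻¹ := by
    intro u k j hkj
    have hk := hlR_sub_pos hb0 u k (by rcases hkj with ⟨rfl, _⟩ | ⟨rfl, _⟩ <;> simp)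
    have hc := (hlR_spec (b, u)).2.2.2
    simp only at hc
    rw [mul_inv_eq_iff_eq_mul₀ (hcont u), eq_inv_mul_iff_mul_eq₀ hk.ne', ← hc]
    rcases hkj with ⟨rfl, rfl⟩ | ⟨rfl, rfl⟩ <;> ring
  have hpart : ∀ u ∈ uIcc (0 : ℝ) 1,
      (fderiv ℝ f (b, u)).comp (ContinuousLinearMap.inl ℝ E3 ℝ) =
      (2 * b 0 * (hlW (b, u) * (b 0 ^ 2 + u ^ 2)⁻¹) -
          2 * b 0 * (hlR (b, u) * ((b 0 ^ 2 + u ^ 2)⁻¹) ^ 2)) • dcoord 0 +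
        (hlW (b, u) / (hlR (b, u) - b 1)) • dcoord 1 +
        (hlW (b, u) / (hlR (b, u) - b 2)) • dcoord 2 := by
    intro u hu
    rw [uIcc_of_le zero_le_one] at hu
    have hq : (b, u) ∈ (Metric.ball x₀ 1 \ oneTwo.disc) ×ˢ unitNhd := ⟨hb', Icc_subset_unitNhd hu⟩
    have h1 := ((hcd.contDiffAt (hwI.isOpen.mem_nhds (x := (b, u))
      ⟨hb, Icc_subset_unitNhd hu⟩)).differentiableAt (by simp)).hasFDerivAt.comp b
      (hasFDerivAt_prodMk_left (𝕜 := ℝ) b u)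
    have h0 : HasFDerivAt (fun b : E3 => b 0) (dcoord 0) b := (dcoord 0).hasFDerivAt
    have h2 := (hasDerivAt_inv (hcont u)).comp_hasFDerivAt b ((h0.pow 2).add_const (u ^ 2))
    have h3 := ((hasFDerivAt_hlR hx₀ hq).comp b (hasFDerivAt_prodMk_left (𝕜 := ℝ) b u)).mul h2
    have h4 := h1.unique h3
    refine h4.trans ?_
    have e1 := hinv u 1 2 (Or.inl ⟨rfl, rfl⟩)
    have e2 := hinv u 2 1 (Or.inr ⟨rfl, rfl⟩)
    refine ContinuousLinearMap.ext fun v => ?_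
    rw [div_eq_mul_inv, div_eq_mul_inv, ← e1, ← e2]
    simp
    ring
  rw [intervalIntegral.integral_congr hpart] at hint
  have h0 : HasFDerivAt (fun b : E3 => -b 0) (-dcoord 0) b := (dcoord 0).hasFDerivAt.neg
  have hS := h0.mul hint
  refine hS.congr_fderiv ?_
  have c0 : Continuous fun u => 2 * b 0 * (hlW (b, u) * (b 0 ^ 2 + u ^ 2)⁻¹) -
      2 * b 0 * (hlR (b, u) * ((b 0 ^ 2 + u ^ 2)⁻¹) ^ 2) := by fun_prop
  have ck : ∀ k : Fin 3, k ≠ 0 → Continuous fun u => hlW (b, u) / (hlR (b, u) - b k) :=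
    fun k hk => hWc.div (by fun_prop) fun u => (hlR_sub_pos hb0 u k hk).ne'
  have c1 := ck 1 (by simp)
  have c2 := ck 2 (by simp)
  have hsplit : ∫ u in (0 : ℝ)..1, ((2 * b 0 * (hlW (b, u) * (b 0 ^ 2 + u ^ 2)⁻¹) -
          2 * b 0 * (hlR (b, u) * ((b 0 ^ 2 + u ^ 2)⁻¹) ^ 2)) • dcoord 0 +
        (hlW (b, u) / (hlR (b, u) - b 1)) • dcoord 1 +
        (hlW (b, u) / (hlR (b, u) - b 2)) • dcoord 2) =
      (∫ u in (0 : ℝ)..1, (2 * b 0 * (hlW (b, u) * (b 0 ^ 2 + u ^ 2)⁻¹) -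
          2 * b 0 * (hlR (b, u) * ((b 0 ^ 2 + u ^ 2)⁻¹) ^ 2))) • dcoord 0 +
        (∫ u in (0 : ℝ)..1, hlW (b, u) / (hlR (b, u) - b 1)) • dcoord 1 +
        (∫ u in (0 : ℝ)..1, hlW (b, u) / (hlR (b, u) - b 2)) • dcoord 2 := by
    rw [intervalIntegral.integral_add, intervalIntegral.integral_add,
      intervalIntegral.integral_smul_const, intervalIntegral.integral_smul_const,
      intervalIntegral.integral_smul_const]
    all_goals apply Continuous.intervalIntegrable; fun_prop
  have cX : Continuous fun u => hlR (b, u) * (b 0 ^ 2 + u ^ 2)⁻¹ := by fun_prop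
  -- The integrand is the derivative of `u R(b, u) / (b 0 ^ 2 + u ^ 2)`.
  have hparts : ∫ u in (0 : ℝ)..1, (2 * hlW (b, u) - (hlR (b, u) * (b 0 ^ 2 + u ^ 2)⁻¹ +
      b 0 * (2 * b 0 * (hlW (b, u) * (b 0 ^ 2 + u ^ 2)⁻¹) -
        2 * b 0 * (hlR (b, u) * ((b 0 ^ 2 + u ^ 2)⁻¹) ^ 2)))) =
      hlR (b, 1) / (1 + b 0 ^ 2) := by
    rw [intervalIntegral.integral_eq_sub_of_hasDerivAt
      (f := fun u => u * (hlR (b, u) * (b 0 ^ 2 + u ^ 2)⁻¹)) (fun u hu => ?_)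
      (Continuous.intervalIntegrable (by fun_prop) _ _)]
    · simp [div_eq_mul_inv, add_comm]
    · rw [uIcc_of_le zero_le_one] at hu
      have h1 := hasDerivAt_hlR_right hx₀ hb' (Icc_subset_unitNhd hu)
      have h2 : HasDerivAt (fun u : ℝ => b 0 ^ 2 + u ^ 2) (2 * u) u := by
        simpa using (hasDerivAt_pow 2 u).const_add (b 0 ^ 2)
      have h3 := (hasDerivAt_id u).mul (h1.mul (h2.inv (hcont u)))
      refine h3.congr_deriv ?_
      have := hcont u
      simp only [id, Pi.mul_apply, Pi.inv_apply]
      field_simp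
      ring
  rw [intervalIntegral.integral_sub ((hWc.const_mul 2).intervalIntegrable _ _)
    (Continuous.intervalIntegrable (by fun_prop) _ _),
    intervalIntegral.integral_add (cX.intervalIntegrable _ _)
      ((c0.const_mul (b 0)).intervalIntegrable _ _),
    intervalIntegral.integral_const_mul, intervalIntegral.integral_const_mul] at hparts
  rw [hsplit]
  refine ContinuousLinearMap.ext fun v => ?_
  simp only [add_apply, smul_apply, neg_apply, smul_eq_mul, dcoord_apply, hlA]
  linear_combination (v 0) * hparts

/-- Both sides are mixed second derivatives of the primitive `hlS`. The branch correction is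
constant along the line near `s = 0` because `b 0 ≠ 0`. -/
theorem hasDerivAt_hlAngle (hx₀ : x₀ ∈ oneTwo.disc) (hb : b ∈ offPlane x₀) {k j : Fin 3}
    (hkj : k = 1 ∧ j = 2 ∨ k = 2 ∧ j = 1) :
    HasDerivAt (fun s : ℝ => hlAngle k j (b + s • axis))
      (fderiv ℝ hlA b (EuclideanSpace.single k 1)) 0 := by
  have hO := (isWeight_offPlane hx₀).isOpen
  have hS := contDiffOn_hlS hx₀
  have hS' := (contDiffOn_infty_iff_fderiv_of_isOpen hO).1 hS
  have hd2 := ((hS'.2.contDiffAt (hO.mem_nhds hb)).differentiableAt (by simp)).hasFDerivAt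
  have hsymm : IsSymmSndFDerivAt ℝ hlS b := (hS.contDiffAt (hO.mem_nhds hb)).isSymmSndFDerivAt
    (by simpa using WithTop.coe_le_coe.2 (le_top : (2 : ℕ∞) ≤ ⊤))
  have hline : HasDerivAt (fun s : ℝ => b + s • axis) axis 0 := by
    simpa using ((hasDerivAt_id (0 : ℝ)).smul_const axis).const_add b
  have hb0 : b 0 ≠ 0 := hb.2
  have hk0 : k ≠ 0 := by rcases hkj with ⟨rfl, _⟩ | ⟨rfl, _⟩ <;> simp
  have hj0 : j ≠ 0 := by rcases hkj with ⟨_, rfl⟩ | ⟨_, rfl⟩ <;> simp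
  have haxis : ∀ i : Fin 3, i ≠ 0 → axis i = 0 := fun i hi => by
    fin_cases i <;> simp_all
  have hA : fderiv ℝ hlA b (EuclideanSpace.single k 1) =
      fderiv ℝ (fderiv ℝ hlS) b axis (EuclideanSpace.single k 1) := by
    have h1 : hlA =ᶠ[𝓝 b] fun b => fderiv ℝ hlS b axis := by
      filter_upwards [hO.mem_nhds hb] with x hx
      rw [(hasFDerivAt_hlS hx₀ hx).fderiv]
      simp
    rw [h1.fderiv_eq, fderiv_clm_apply hd2.differentiableAt (differentiableAt_const axis)]
    simpa using hsymm.eq (EuclideanSpace.single k 1) axis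
  rw [hA]
  have h2 : HasDerivAt (fun s : ℝ => fderiv ℝ hlS (b + s • axis) (EuclideanSpace.single k 1))
      (fderiv ℝ (fderiv ℝ hlS) b axis (EuclideanSpace.single k 1)) 0 := by
    have h3 : HasFDerivAt (fderiv ℝ hlS) (fderiv ℝ (fderiv ℝ hlS) b)
        ((fun s : ℝ => b + s • axis) 0) := by simpa using hd2
    exact ((ContinuousLinearMap.apply ℝ ℝ (EuclideanSpace.single k 1)).hasFDerivAt.comp_hasDerivAt
      0 (h3.comp_hasDerivAt 0 hline))
  have h4 := h2.sub_const (open Classical in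
    if 0 < b k ∧ b j < b k then Real.pi * (1 - (SignType.sign (b 0) : ℝ)) / 2 else 0)
  refine h4.congr_of_eventuallyEq ?_
  have hmem : ∀ᶠ s : ℝ in 𝓝 0, b + s • axis ∈ offPlane x₀ :=
    hline.continuousAt.eventually (hO.mem_nhds (by simpa using hb))
  have hsign : ∀ᶠ s : ℝ in 𝓝 0, SignType.sign (b 0 + s) = SignType.sign (b 0) := by
    rcases hb0.lt_or_gt with h | h
    · filter_upwards [gt_mem_nhds (show (0 : ℝ) < -b 0 by linarith)] with s hs
      rw [sign_neg h, sign_neg (by linarith)]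
    · filter_upwards [lt_mem_nhds (show -b 0 < (0 : ℝ) by linarith)] with s hs
      rw [sign_pos h, sign_pos (by linarith)]
  filter_upwards [hmem, hsign] with s hs hss
  rw [hlAngle_eq hx₀ (offPlane_subset x₀ hs), (hasFDerivAt_hlS hx₀ hs).fderiv]
  simp only [PiLp.add_apply, PiLp.smul_apply, smul_eq_mul, haxis k hk0, haxis j hj0, mul_zero,
    add_zero, axis_zero, mul_one, hss]
  rcases hkj with ⟨rfl, rfl⟩ | ⟨rfl, rfl⟩ <;> simp

theorem mem_disc_of_double_root {b : E3} (h0 : b 0 = 0) {k j : Fin 3}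
    (hkj : k = 1 ∧ j = 2 ∨ k = 2 ∧ j = 1)
    (h : (b k = b j ∧ 0 ≤ b k) ∨ (b k = 0 ∧ b j ≤ 0)) : b ∈ oneTwo.disc := by
  refine ⟨h0, ?_⟩
  rcases hkj with ⟨rfl, rfl⟩ | ⟨rfl, rfl⟩ <;> rcases h with ⟨h1, h2⟩ | ⟨h1, h2⟩
  · exact Or.inl ⟨h1, h2⟩
  · exact Or.inr (Or.inl ⟨h1, h2⟩)
  · exact Or.inl ⟨h1.symm, h1 ▸ h2⟩
  · exact Or.inr (Or.inr ⟨h1, h2⟩)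

/-- Continuity of the angles across the plane `b₁ = 0`. -/
theorem continuousAt_hlAngle_of_zero (hx₀ : x₀ ∈ oneTwo.disc)
    (hb : b ∈ Metric.ball x₀ 1 \ oneTwo.disc) (hb0 : b 0 = 0) {k j : Fin 3}
    (hkj : k = 1 ∧ j = 2 ∨ k = 2 ∧ j = 1) :
    ContinuousAt (fun s : ℝ => hlAngle k j (b + s • axis)) 0 := by
  have hO := (isWeight_infDist (r := 1) oneTwo.isClosed_disc hx₀ le_rfl).isOpen
  have hdpos := (isWeight_infDist (r := 1) oneTwo.isClosed_disc hx₀ le_rfl).pos b hb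
  set d := Metric.infDist b oneTwo.disc with hd
  obtain ⟨K, hK0, hK⟩ := exists_hlR_bound x₀
  have hk0 : k ≠ 0 := by rcases hkj with ⟨rfl, _⟩ | ⟨rfl, _⟩ <;> simp
  have hj0 : j ≠ 0 := by rcases hkj with ⟨_, rfl⟩ | ⟨_, rfl⟩ <;> simp
  have haxis : ∀ i : Fin 3, i ≠ 0 → axis i = 0 := fun i hi => by
    fin_cases i <;> simp_all
  have hck : ∀ s : ℝ, (b + s • axis) k = b k := fun s => by simp [haxis k hk0]
  have hcj : ∀ s : ℝ, (b + s • axis) j = b j := fun s => by simp [haxis j hj0]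
  have hc0 : ∀ s : ℝ, (b + s • axis) 0 = s := fun s => by simp [hb0]
  have hline : Continuous fun s : ℝ => b + s • axis := by fun_prop
  have hmem : ∀ᶠ s : ℝ in 𝓝 0, b + s • axis ∈ Metric.ball x₀ 1 \ oneTwo.disc :=
    (hline.tendsto 0).eventually (hO.mem_nhds (by simpa using hb))
  have hsmall : ∀ᶠ s : ℝ in 𝓝 0, |s| < d / 2 := by
    have := (continuous_abs.tendsto (0 : ℝ)).eventually (gt_mem_nhds (show |(0 : ℝ)| < d / 2 by
      simpa using by positivity))
    exact this
  -- For `|s| < d / 2` the distance to Δ remains at least `d / 2`, and `sq_infDist_le_hlPolyDeriv`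
  -- bounds `W` uniformly.
  set CW := (K + 1) / (d / 2) ^ 2 with hCW
  have hCW0 : 0 ≤ CW := by positivity
  have hW : ∀ s : ℝ, b + s • axis ∈ Metric.ball x₀ 1 \ oneTwo.disc → |s| < d / 2 →
      ∀ u ∈ Icc (0 : ℝ) 1, 0 ≤ hlW (b + s • axis, u) ∧ hlW (b + s • axis, u) ≤ CW := by
    intro s hs hs2 u hu
    have h1 := hlPolyDeriv_pos (q := (b + s • axis, u)) hs.2
    refine ⟨(inv_pos.2 h1).le, ?_⟩
    have h2 := sq_infDist_le_hlPolyDeriv (b + s • axis, u)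
    have h3 := infDist_sub_le (D := oneTwo.disc) norm_axis b s
    have h4 : d / 2 ≤ Metric.infDist (b + s • axis) oneTwo.disc := by linarith
    have h5 : (d / 2) ^ 2 ≤ Metric.infDist (b + s • axis) oneTwo.disc ^ 2 :=
      pow_le_pow_left₀ (by positivity) h4 2
    have h6 := hK (b + s • axis, u) ⟨hs.1, Icc_subset_unitNhd hu⟩
    rw [hlW, hCW, inv_le_comm₀ h1 (by positivity), inv_div, div_le_iff₀ (by positivity)]
    simp only at h2
    nlinarith
  have hspec : ∀ s u : ℝ, 0 ≤ hlR (b + s • axis, u) ∧ b k ≤ hlR (b + s • axis, u) ∧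
      b j ≤ hlR (b + s • axis, u) ∧ hlR (b + s • axis, u) * (hlR (b + s • axis, u) - b k) *
        (hlR (b + s • axis, u) - b j) = s ^ 2 + u ^ 2 ∧
      hlPolyDeriv (b + s • axis) (hlR (b + s • axis, u)) =
        (hlR (b + s • axis, u) - b k) * (hlR (b + s • axis, u) - b j) +
        hlR (b + s • axis, u) * (hlR (b + s • axis, u) - b j) +
        hlR (b + s • axis, u) * (hlR (b + s • axis, u) - b k) := by
    intro s u
    obtain ⟨h0, h1, h2, hc⟩ := hlR_spec (b + s • axis, u)
    simp only [hc0] at hc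
    unfold hlPolyDeriv
    rcases hkj with ⟨rfl, rfl⟩ | ⟨rfl, rfl⟩
    · simp only [hck, hcj] at h1 h2 hc ⊢
      exact ⟨h0, h1, h2, hc, trivial⟩
    · simp only [hck, hcj] at h1 h2 hc ⊢
      exact ⟨h0, h2, h1, by linarith, by ring⟩
  suffices hest : ∃ C, ∃ g : ℝ → ℝ, ContinuousAt g 0 ∧ g 0 = 0 ∧ ∀ᶠ s : ℝ in 𝓝 0,
      |hlAngle k j (b + s • axis) - hlAngle k j (b + (0 : ℝ) • axis)| ≤ |g s| + C * |s| by
    obtain ⟨C, g, hg, hg0, hCg⟩ := hest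
    refine tendsto_iff_dist_tendsto_zero.2 (squeeze_zero' (Filter.Eventually.of_forall fun _ =>
      dist_nonneg) hCg ?_)
    have h1 : ContinuousAt (fun s => |g s| + C * |s|) 0 := by fun_prop
    have h2 := h1.tendsto
    simp only [hg0, abs_zero, mul_zero, add_zero] at h2
    exact h2
  have hval0 : hlAngle k j (b + (0 : ℝ) • axis) = -(open Classical in
      if 0 < b k ∧ b j < b k then Real.pi / 2 else 0) := by
    rw [hlAngle_eq hx₀ (by simpa using hb)]
    simp [hb0]
  -- If `b k` is the simple largest root at `b 0 = 0`, then `R - b k` tends to zero as `s` and `u`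
  -- do, and the integral term jumps by `π` across the plane, which the branch correction undoes.
  -- Otherwise `R - b k` stays away from zero.
  by_cases hcase : 0 < b k ∧ b j < b k
  · obtain ⟨hk, hjk⟩ := hcase
    set m := b k * (b k - b j) with hm
    have hmpos : 0 < m := mul_pos hk (by linarith)
    set CE := CW * (2 * K + |b j|) / m with hCE
    refine ⟨CE, Real.arctan, Real.continuous_arctan.continuousAt, Real.arctan_zero, ?_⟩
    filter_upwards [hmem, hsmall] with s hs hs2
    rw [hval0, if_pos ⟨hk, hjk⟩]
    by_cases hs0 : s = 0
    · rw [hs0, hval0, if_pos ⟨hk, hjk⟩]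
      simp
    rw [hlAngle_eq hx₀ hs, hck, hcj, hc0, if_pos ⟨hk, hjk⟩]
    have hRc := continuous_hlR_right (b + s • axis)
    have hWc := continuous_hlW_right hs.2
    have hmR : ∀ u, m ≤ hlR (b + s • axis, u) * (hlR (b + s • axis, u) - b j) := fun u =>
      mul_le_mul (hspec s u).2.1 (by linarith [(hspec s u).2.1]) (by linarith) (hspec s u).1
    have hEc : Continuous fun u => hlW (b + s • axis, u) * (2 * hlR (b + s • axis, u) - b j) /
        (hlR (b + s • axis, u) * (hlR (b + s • axis, u) - b j)) :=
      Continuous.div (by fun_prop) (by fun_prop) fun u => (hmpos.trans_le (hmR u)).ne'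
    have hne : ∀ u : ℝ, s ^ 2 + u ^ 2 ≠ 0 := fun u => by positivity
    have harct : Real.arctan s⁻¹ = ∫ u in (0 : ℝ)..1, s * (s ^ 2 + u ^ 2)⁻¹ := by
      simpa [div_eq_mul_inv] using (integral_div_sq_add_sq (a := 0) (b := 1) (c := s)).symm
    -- Dividing `P_b'(R) = R (R - b j) + (R - b k)(2 R - b j)` by `P_b'(R)` times the triple product
    -- `s² + u²` gives `W / (R - b k) = 1 / (s² + u²) - W (2 R - b j) / (R (R - b j))`. The first
    -- term integrates to `arctan(1/s)` after multiplication by `s`, and the second is bounded.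
    have hsplit : s * ∫ u in (0 : ℝ)..1, hlW (b + s • axis, u) / (hlR (b + s • axis, u) - b k) =
        Real.arctan s⁻¹ - s * ∫ u in (0 : ℝ)..1, hlW (b + s • axis, u) *
          (2 * hlR (b + s • axis, u) - b j) /
          (hlR (b + s • axis, u) * (hlR (b + s • axis, u) - b j)) := by
      rw [harct, ← intervalIntegral.integral_const_mul,
        ← intervalIntegral.integral_const_mul, ← intervalIntegral.integral_sub]
      · refine intervalIntegral.integral_congr fun u _ => ?_
        obtain ⟨_, h1, _, h3, h4⟩ := hspec s u
        have h5 := hlPolyDeriv_pos (q := (b + s • axis, u)) hs.2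
        have h6 := (hmpos.trans_le (hmR u)).ne'
        have h7 : hlR (b + s • axis, u) - b k ≠ 0 := fun h => hne u (by rw [← h3, h]; ring)
        simp only [hlW]
        simp only at h5
        rw [← h3]
        have h8 := h5.ne'
        have h9 := left_ne_zero_of_mul h6
        have h10 := right_ne_zero_of_mul h6
        set x := hlR (b + s • axis, u)
        set y := hlPolyDeriv (b + s • axis) x
        field_simp
        linear_combination -h4
      · exact Continuous.intervalIntegrable
          (continuous_const.mul (Continuous.inv₀ (by fun_prop) hne)) _ _
      · exact (hEc.const_mul s).intervalIntegrable _ _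
    have hEb : |∫ u in (0 : ℝ)..1, hlW (b + s • axis, u) * (2 * hlR (b + s • axis, u) - b j) /
        (hlR (b + s • axis, u) * (hlR (b + s • axis, u) - b j))| ≤ CE := by
      have h1 := intervalIntegral.norm_integral_le_of_norm_le_const (a := 0) (b := 1) (C := CE)
        (f := fun u => hlW (b + s • axis, u) * (2 * hlR (b + s • axis, u) - b j) /
        (hlR (b + s • axis, u) * (hlR (b + s • axis, u) - b j))) fun u hu => ?_
      · simpa using h1
      · rw [uIoc_of_le zero_le_one] at hu
        have hu' := Ioc_subset_Icc_self hu
        obtain ⟨w0, w1⟩ := hW s hs hs2 u hu'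
        have hR0 := (hspec s u).1
        have hRK := hK (b + s • axis, u) ⟨hs.1, Icc_subset_unitNhd hu'⟩
        have h2 : |2 * hlR (b + s • axis, u) - b j| ≤ 2 * K + |b j| := by
          refine (abs_sub _ _).trans ?_
          rw [abs_of_nonneg (by linarith : 0 ≤ 2 * hlR (b + s • axis, u))]
          linarith
        rw [Real.norm_eq_abs, abs_div, abs_mul, abs_of_nonneg w0,
          abs_of_pos (hmpos.trans_le (hmR u)), hCE]
        exact div_le_div₀ (by positivity) (mul_le_mul w1 h2 (abs_nonneg _) hCW0) hmpos (hmR u)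
    rw [hsplit]
    set J := ∫ u in (0 : ℝ)..1, hlW (b + s • axis, u) * (2 * hlR (b + s • axis, u) - b j) /
        (hlR (b + s • axis, u) * (hlR (b + s • axis, u) - b j))
    -- The reflection formula for `arctan` has opposite constants `± π / 2` for the two signs of
    -- `s`; the sign correction cancels exactly this jump.
    have harc : -(Real.arctan s⁻¹ - s * J) - Real.pi * (1 - (SignType.sign s : ℝ)) / 2 -
        -(Real.pi / 2) = Real.arctan s + s * J := by
      rcases lt_or_gt_of_ne hs0 with h | h
      · rw [Real.arctan_inv_of_neg h, sign_neg h]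
        simp
        ring
      · rw [Real.arctan_inv_of_pos h, sign_pos h]
        simp
        ring
    rw [harc]
    refine (abs_add_le _ _).trans (add_le_add le_rfl ?_)
    rw [abs_mul, mul_comm]
    exact mul_le_mul_of_nonneg_right hEb (abs_nonneg s)
  -- Either `b k < 0 ≤ R` or `b k < b j ≤ R`: in every remaining case the largest root would be
  -- double, so `b` would lie in Δ.
  · obtain ⟨δ, hδ, hδR⟩ : ∃ δ > 0, ∀ s u : ℝ, δ ≤ hlR (b + s • axis, u) - b k := by
      by_cases hk : b k < 0
      · exact ⟨-b k, by linarith, fun s u => by linarith [(hspec s u).1]⟩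
      · have hjk : b k < b j := by
          by_contra h
          refine hb.2 (mem_disc_of_double_root hb0 hkj ?_)
          rcases (not_lt.1 hk).eq_or_lt with h0 | h0
          · exact Or.inr ⟨h0.symm, h0 ▸ not_lt.1 h⟩
          · rcases (not_lt.1 h).eq_or_lt with h1 | h1
            · exact Or.inl ⟨h1.symm, h0.le⟩
            · exact absurd ⟨h0, h1⟩ hcase
        exact ⟨b j - b k, by linarith, fun s u => by linarith [(hspec s u).2.2.1]⟩
    refine ⟨CW / δ, fun _ => 0, continuousAt_const, rfl, ?_⟩
    filter_upwards [hmem, hsmall] with s hs hs2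
    rw [hval0, if_neg hcase, hlAngle_eq hx₀ hs, hck, hcj, hc0, if_neg hcase]
    have h1 := intervalIntegral.norm_integral_le_of_norm_le_const (a := 0) (b := 1) (C := CW / δ)
      (f := fun u => hlW (b + s • axis, u) / (hlR (b + s • axis, u) - b k)) fun u hu => ?_
    · simp only [sub_zero, neg_zero, abs_neg, abs_zero, zero_add, abs_mul, abs_one, mul_one,
        Real.norm_eq_abs] at h1 ⊢
      rw [mul_comm]
      exact mul_le_mul_of_nonneg_right h1 (abs_nonneg s)
    · rw [uIoc_of_le zero_le_one] at hu
      obtain ⟨w0, w1⟩ := hW s hs hs2 u (Ioc_subset_Icc_self hu)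
      have h2 := hδR s u
      rw [Real.norm_eq_abs, abs_div, abs_of_nonneg w0, abs_of_pos (hδ.trans_le h2)]
      exact div_le_div₀ hCW0 w1 hδ h2

theorem isTameForm_oneTwo (hx₀ : x₀ ∈ oneTwo.disc) :
    IsTameForm oneTwo.disc axis x₀ 1 oneTwo.tauZero := by
  have hα : ∀ k : Fin 3, k ≠ 0 → ∃ j, (k = 1 ∧ j = 2 ∨ k = 2 ∧ j = 1) ∧
      (![fun _ => 0, hlAngle 1 2, hlAngle 2 1] : Fin 3 → E3 → ℝ) k = hlAngle k j := by
    intro k hk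
    fin_cases k
    · exact absurd rfl hk
    · exact ⟨2, Or.inl ⟨rfl, rfl⟩, rfl⟩
    · exact ⟨1, Or.inr ⟨rfl, rfl⟩, rfl⟩
  have hA : EqOn (fun b => oneTwo.tauZero b axis) hlA (Metric.ball x₀ 1 \ oneTwo.disc) :=
    fun b hb => tauZero_axis_eq hx₀ hb
  have hw := isWeight_infDist (r := 1) oneTwo.isClosed_disc hx₀ le_rfl
  have hoff : ∀ b ∈ Metric.ball x₀ 1 \ oneTwo.disc, b 0 ≠ 0 → ∀ k : Fin 3, k ≠ 0 →
      HasDerivAt (fun s : ℝ => (![fun _ => 0, hlAngle 1 2, hlAngle 2 1] : Fin 3 → E3 → ℝ) k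
        (b + s • axis)) (fderiv ℝ (fun b => oneTwo.tauZero b axis) b
          (EuclideanSpace.single k 1)) 0 := by
    intro b hb hb0 k hk
    obtain ⟨j, hj, hjα⟩ := hα k hk
    rw [hjα, (hA.eventuallyEq_of_mem (hw.isOpen.mem_nhds hb)).fderiv_eq]
    exact hasDerivAt_hlAngle hx₀ ⟨hb.1, hb0⟩ hj
  refine isTameForm_of_components (A := fun b => oneTwo.tauZero b axis)
    (α := ![fun _ => 0, hlAngle 1 2, hlAngle 2 1]) oneTwo.isClosed_disc hx₀ le_rfl (fun b => ?_)
    (fun n => (isPolyGrowth_hlA hx₀ n).congr hw hA) (fun b hb k hk => ?_) hoff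
  · simp [tauZero]
  · by_cases hb0 : b 0 = 0
    · obtain ⟨j, hj, hjα⟩ := hα k hk
      rw [hjα]
      exact continuousAt_hlAngle_of_zero hx₀ hb hb0 hj
    · exact (hoff b hb hb0 k hk).continuousAt

/-- At the vertex the largest root is triple, so the integral of `W = 1 / P_b'(R)` diverges as a
power, while the smooth summand stays bounded. The coefficient tends to minus infinity, whence the
factor `-1`. -/
theorem tauZero_large_oneTwo (M : ℝ) :
    ∃ r > 0, ∀ b ∈ Metric.ball (0 : E3) r \ oneTwo.disc, M ≤ -1 * oneTwo.tauZero b axis := by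
  have hx₀ : (0 : E3) ∈ oneTwo.disc := by refine ⟨by simp, Or.inl ⟨by simp, by simp⟩⟩
  obtain ⟨K, hK0, hK⟩ := exists_hlR_bound (0 : E3)
  -- Scaling: for `|b| < θ³` and `u ≤ θ³`, the triple product `R (R - b 1)(R - b 2)` is at most `2
  -- θ⁶`, so `R ≤ 3 θ²` and `P_b'(R) ≤ 48 θ⁴`. Integrating `W` over `[0, θ³]` gives at least `1 /
  -- (48 θ)`, and twice this must exceed `|M| + K`.
  set θ : ℝ := min 1 (24 * (|M| + K + 1))⁻¹ with hθ
  have hθ1 : θ ≤ 1 := min_le_left _ _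
  have hθ0 : 0 < θ := by positivity
  have hθM : 24 * (|M| + K + 1) * θ ≤ 1 := by
    have : θ ≤ (24 * (|M| + K + 1))⁻¹ := min_le_right _ _
    rw [← le_div_iff₀' (by positivity), one_div]
    exact this
  have hθ3 : θ ^ 3 ≤ θ ^ 2 := pow_le_pow_of_le_one hθ0.le hθ1 (by norm_num)
  have hθ31 : θ ^ 3 ≤ 1 := pow_le_one₀ hθ0.le hθ1
  refine ⟨θ ^ 3, by positivity, fun b hb => ?_⟩
  have hb1 : b ∈ Metric.ball (0 : E3) 1 \ oneTwo.disc := ⟨Metric.ball_subset_ball hθ31 hb.1, hb.2⟩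
  have hcoord : ∀ i, |b i| ≤ θ ^ 3 := fun i => by
    have h1 : ‖b‖ < θ ^ 3 := by simpa using hb.1
    exact ((PiLp.norm_apply_le b i)).trans h1.le
  rw [tauZero_axis_eq hx₀ hb1, hlA]
  have hWc := continuous_hlW_right hb.2
  have hW0 : ∀ u, 0 ≤ hlW (b, u) := fun u => inv_nonneg.2 (hlPolyDeriv_nonneg (b, u))
  have hlow : ∀ u ∈ Icc (0 : ℝ) (θ ^ 3), 1 / (48 * θ ^ 4) ≤ hlW (b, u) := by
    intro u hu
    have hpos := hlPolyDeriv_pos (q := (b, u)) hb.2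
    rw [hlW, ← one_div]
    refine one_div_le_one_div_of_le hpos ?_
    obtain ⟨h0, h1, h2, hc⟩ := hlR_spec (b, u)
    simp only at h0 h1 h2 hc ⊢
    set R := hlR (b, u)
    have c1 := abs_le.1 (hcoord 1)
    have c2 := abs_le.1 (hcoord 2)
    have hsq : b 0 ^ 2 + u ^ 2 ≤ 2 * (θ ^ 3) ^ 2 := by
      have e1 : b 0 ^ 2 ≤ (θ ^ 3) ^ 2 := by
        rw [← sq_abs]; exact pow_le_pow_left₀ (abs_nonneg _) (hcoord 0) 2
      have e2 : u ^ 2 ≤ (θ ^ 3) ^ 2 := pow_le_pow_left₀ hu.1 hu.2 2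
      linarith
    have hθ2 : 0 < θ ^ 2 := by positivity
    have hR : R ≤ 3 * θ ^ 2 := by
      by_contra hlt
      push Not at hlt
      have e1 : 2 * θ ^ 2 ≤ R - b 1 := by linarith
      have e2 : 2 * θ ^ 2 ≤ R - b 2 := by linarith
      have e3 : 3 * θ ^ 2 * (2 * θ ^ 2) * (2 * θ ^ 2) ≤ R * (R - b 1) * (R - b 2) := by
        have := hlt.le
        gcongr
      rw [hc] at e3
      have : 0 < θ ^ 6 := by positivity
      nlinarith
    have e0 : R ≤ 4 * θ ^ 2 := by linarith
    have e1 : R - b 1 ≤ 4 * θ ^ 2 := by linarith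
    have e2 : R - b 2 ≤ 4 * θ ^ 2 := by linarith
    have f1 : 0 ≤ R - b 1 := by linarith
    have f2 : 0 ≤ R - b 2 := by linarith
    have g1 : (R - b 1) * (R - b 2) ≤ 4 * θ ^ 2 * (4 * θ ^ 2) := by gcongr
    have g2 : R * (R - b 2) ≤ 4 * θ ^ 2 * (4 * θ ^ 2) := by gcongr
    have g3 : R * (R - b 1) ≤ 4 * θ ^ 2 * (4 * θ ^ 2) := by gcongr
    unfold hlPolyDeriv
    linarith
  have hint : 1 / (48 * θ) ≤ ∫ u in (0 : ℝ)..1, hlW (b, u) := by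
    have h1 : ∫ u in (0 : ℝ)..(θ ^ 3), 1 / (48 * θ ^ 4) ≤ ∫ u in (0 : ℝ)..(θ ^ 3), hlW (b, u) :=
      intervalIntegral.integral_mono_on (by positivity) intervalIntegrable_const
        (hWc.intervalIntegrable _ _) hlow
    have h2 : ∫ u in (0 : ℝ)..(θ ^ 3), hlW (b, u) ≤ ∫ u in (0 : ℝ)..1, hlW (b, u) :=
      intervalIntegral.integral_mono_interval le_rfl (by positivity) hθ31
        (Filter.Eventually.of_forall hW0) (hWc.intervalIntegrable _ _)
    have h3 : ∫ u in (0 : ℝ)..(θ ^ 3), 1 / (48 * θ ^ 4) = 1 / (48 * θ) := by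
      rw [intervalIntegral.integral_const, smul_eq_mul]
      field_simp
      ring
    linarith
  have hR1 : hlR (b, 1) / (1 + b 0 ^ 2) ≤ K := by
    have h1 := hK (b, 1) ⟨hb1.1, Icc_subset_unitNhd (right_mem_Icc.2 zero_le_one)⟩
    exact (div_le_self (hlR_spec _).1 (by nlinarith [sq_nonneg (b 0)])).trans h1
  have hfin : |M| + K + 1 ≤ 2 * (1 / (48 * θ)) := by
    rw [mul_one_div, le_div_iff₀ (by positivity)]
    linarith
  have := le_abs_self M
  linarith

end Integrals

/-! ### Consequences for both families -/

theorem SingularityType.isTameForm_tauZero (κ : SingularityType) {x₀ : E3} (hx₀ : x₀ ∈ κ.disc) :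
    IsTameForm κ.disc axis x₀ 1 κ.tauZero := by
  cases κ with
  | oneTwo => exact isTameForm_oneTwo hx₀
  | twoTwo => exact isTameForm_twoTwo hx₀

theorem SingularityType.tauZero_large (κ : SingularityType) {x₀ : E3} (hx₀ : x₀ ∈ κ.disc)
    (hv : κ = oneTwo → x₀ = 0) (M : ℝ) :
    ∃ σ : ℝ, |σ| = 1 ∧ ∃ r > 0, ∀ b ∈ Metric.ball x₀ r \ κ.disc, M ≤ σ * κ.tauZero b axis := by
  cases κ with
  | oneTwo =>
    obtain rfl := hv rfl
    exact ⟨-1, by simp, tauZero_large_oneTwo M⟩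
  | twoTwo => exact ⟨1, by simp, tauZero_large_twoTwo hx₀ M⟩

theorem SingularityType.exists_stdPeriod_eq (κ : SingularityType) {i : Fin 3} (hi : i ≠ 0) :
    ∃ c : ℝ, c ≠ 0 ∧ ∀ b, κ.stdPeriod i b = c • dcoord i := by
  have := Real.pi_ne_zero
  fin_cases i
  · exact absurd rfl hi
  · cases κ with
    | oneTwo => exact ⟨Real.pi, this, fun _ => rfl⟩
    | twoTwo => exact ⟨2 * Real.pi, by positivity, fun _ => rfl⟩
  · cases κ with
    | oneTwo => exact ⟨Real.pi, this, fun _ => rfl⟩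
    | twoTwo => exact ⟨1, one_ne_zero, fun _ => (one_smul _ _).symm⟩

theorem SingularityType.periodForm_id (κ : SingularityType) (H : E3 → ℝ) (i : Fin 3) (b : E3) :
    κ.periodForm id H i b = κ.stdPeriod i b + if i = 0 then fderiv ℝ H b else 0 := by
  rw [periodForm, fderiv_id, id, ContinuousLinearMap.comp_id]

theorem SingularityType.periodForm_id_zero (κ : SingularityType) (H : E3 → ℝ) (b : E3) :
    κ.periodForm id H 0 b = κ.tauZero b + fderiv ℝ H b := by
  rw [periodForm_id, if_pos rfl]
  cases κ <;> rfl

theorem SingularityType.periodForm_comp (κ : SingularityType) {φ : E3 → E3} {H : E3 → ℝ} {b : E3}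
    (hφ : DifferentiableAt ℝ φ b) (hH : DifferentiableAt ℝ H (φ b)) (i : Fin 3) :
    κ.periodForm φ (H ∘ φ) i b = (κ.periodForm id H i (φ b)).comp (fderiv ℝ φ b) := by
  rw [periodForm_id, periodForm, ContinuousLinearMap.add_comp, fderiv_comp b hH hφ]
  split_ifs <;> simp

theorem isFlatAt_apply_eq_zero {h : E3 → ℝ} {S : Set E3} (hh : IsFlatAt h S) {b : E3}
    (hb : b ∈ S) : h b = 0 := by
  rw [← norm_eq_zero, ← norm_iteratedFDeriv_zero (𝕜 := ℝ), hh b hb 0, norm_zero]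

theorem fderiv_eq_zero_of_flat {h : E3 → ℝ} {b : E3} (hh : iteratedFDeriv ℝ 1 h b = 0) :
    fderiv ℝ h b = 0 := by
  rw [← norm_eq_zero, ← norm_iteratedFDeriv_one, hh, norm_zero]

/-- Flat perturbations of the singular period are realised by diffeomorphisms. -/
theorem exists_diffeo_of_flat (κ : SingularityType) {B : Set E3} (hB : IsOpen B) {b₀ : E3}
    (hb₀ : b₀ ∈ B) (hd : b₀ ∈ κ.disc) (hv : κ = oneTwo → b₀ = 0) {H H' : E3 → ℝ}
    (hH : ContDiffOn ℝ ∞ H B) (hH' : ContDiffOn ℝ ∞ H' B) {c : ℝ}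
    (hflat : IsFlatAt (fun b => H b - H' b - c) (B ∩ κ.disc)) :
    ∃ φ : OpenPartialHomeomorph E3 E3, IsSmoothDiffeo φ ∧
      b₀ ∈ φ.source ∧ φ b₀ = b₀ ∧ φ.source ⊆ B ∧ φ.target ⊆ B ∧
      IsTangentToIdAt φ (φ.source ∩ κ.disc) ∧ MatchesPeriods κ φ.source φ H H' := by
  have hD := κ.isClosed_disc
  obtain ⟨R₀, hR₀, hR₀B⟩ := Metric.nhds_basis_closedBall.mem_iff.1 (hB.mem_nhds hb₀)
  have hH'e : ContinuousOn (fun b => fderiv ℝ H' b axis) B :=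
    ((contDiffOn_infty_iff_fderiv_of_isOpen hB).1 hH').2.continuousOn.clm_apply continuousOn_const
  obtain ⟨M, hM⟩ := (isCompact_closedBall b₀ R₀).exists_bound_of_continuousOn (hH'e.mono hR₀B)
  -- The margin `M` bounds `dH'(e)`, so the coefficient of `τ₀ + dH'` is still at least one up to
  -- sign.
  obtain ⟨σ, hσ, R₁, hR₁, hlarge⟩ := κ.tauZero_large hd hv (1 + M)
  set R := min R₀ (min R₁ 1) with hR
  have hRR₀ : R ≤ R₀ := min_le_left _ _
  have hRR₁ : R ≤ R₁ := (min_le_right _ _).trans (min_le_left _ _)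
  have hR1 : R ≤ 1 := (min_le_right _ _).trans (min_le_right _ _)
  have hR0 : 0 < R := by positivity
  have hT := ((κ.isTameForm_tauZero hd).mono hR1).add_fderiv hD hd hR1 hB
    ((Metric.closedBall_subset_closedBall hRR₀).trans hR₀B) hH'
  have hh : ContDiffOn ℝ ∞ (fun b => H b - H' b - c) B := (hH.sub hH').sub contDiffOn_const
  obtain ⟨r, hr, g, hg, hgflat, hgeq⟩ := hT.exists_flat_shear hD hd hR0 norm_axis hσ
    (fun b hb => by
      have h1 := hlarge b ⟨Metric.ball_subset_ball hRR₁ hb.1, hb.2⟩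
      have h2 := hM b (Metric.closedBall_subset_closedBall hRR₀
        (Metric.ball_subset_closedBall hb.1))
      have h3 : |σ * fderiv ℝ H' b axis| ≤ M := by rwa [abs_mul, hσ, one_mul, ← Real.norm_eq_abs]
      simp only [add_apply, mul_add]
      linarith [(abs_le.1 h3).1]) hB hb₀ hh hflat
  set φ₀ : E3 → E3 := fun b => b + g b • axis with hφ₀
  have hφs : ContDiffOn ℝ ∞ φ₀ (Metric.ball b₀ r) := contDiffOn_id.add (hg.smul contDiffOn_const)
  have hφd : ∀ b ∈ Metric.ball b₀ r, HasFDerivAt φ₀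
      (ContinuousLinearMap.id ℝ E3 + (fderiv ℝ g b).smulRight axis) b := fun b hb =>
    (hasFDerivAt_id b).add (((hg.contDiffAt (Metric.isOpen_ball.mem_nhds hb)).differentiableAt
      (by simp)).hasFDerivAt.smul_const axis)
  have hb₀r : b₀ ∈ Metric.ball b₀ r := Metric.mem_ball_self hr
  have hg0 : ∀ p ∈ Metric.ball b₀ r ∩ κ.disc, g p = 0 := fun p hp =>
    isFlatAt_apply_eq_zero (S := Metric.ball b₀ r ∩ κ.disc) hgflat hp
  have hφb₀ : φ₀ b₀ = b₀ := by simp [hφ₀, hg0 b₀ ⟨hb₀r, hd⟩]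
  -- As `g` is flat at `b₀`, the shear has the identity as its derivative there, and the inverse
  -- function theorem applies.
  have hstrict : HasStrictFDerivAt φ₀ ((ContinuousLinearEquiv.refl ℝ E3 : E3 ≃L[ℝ] E3) :
      E3 →L[ℝ] E3) b₀ := by
    have h1 := (hφs.contDiffAt (Metric.isOpen_ball.mem_nhds hb₀r)).hasStrictFDerivAt (by simp)
    rw [(hφd b₀ hb₀r).fderiv, fderiv_eq_zero_of_flat (hgflat b₀ ⟨hb₀r, hd⟩ 1)] at h1
    have h2 : ContinuousLinearMap.id ℝ E3 + (0 : E3 →L[ℝ] ℝ).smulRight axis =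
        ((ContinuousLinearEquiv.refl ℝ E3 : E3 ≃L[ℝ] E3) : E3 →L[ℝ] E3) :=
      ContinuousLinearMap.ext fun v => by simp
    rwa [h2] at h1
  have hφ'c : ContinuousOn (fderiv ℝ φ₀) (Metric.ball b₀ r) :=
    ((contDiffOn_infty_iff_fderiv_of_isOpen Metric.isOpen_ball).1 hφs).2.continuousOn
  -- Restricting to points with image in `B` and invertible derivative puts the target in `B` and
  -- makes the inverse smooth on all of it.
  set W : Set E3 := (Metric.ball b₀ r ∩ φ₀ ⁻¹' B) ∩ (Metric.ball b₀ r ∩ fderiv ℝ φ₀ ⁻¹'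
    range ((↑) : (E3 ≃L[ℝ] E3) → E3 →L[ℝ] E3)) ∩ B with hW
  have hWo : IsOpen W := ((hφs.continuousOn.isOpen_inter_preimage Metric.isOpen_ball hB).inter
    (hφ'c.isOpen_inter_preimage Metric.isOpen_ball ContinuousLinearEquiv.isOpen)).inter hB
  set φ := (hstrict.toOpenPartialHomeomorph φ₀).restrOpen W hWo with hφ
  have hcoe : (φ : E3 → E3) = φ₀ := rfl
  have hsource : φ.source = (hstrict.toOpenPartialHomeomorph φ₀).source ∩ W :=
    OpenPartialHomeomorph.restrOpen_source _ _ hWo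
  have hsub : φ.source ⊆ W := hsource ▸ inter_subset_right
  have hball : ∀ b ∈ φ.source, b ∈ Metric.ball b₀ r := fun b hb => (hsub hb).1.1.1
  refine ⟨φ, ⟨?_, ?_⟩, ?_, hφb₀, fun b hb => (hsub hb).2, ?_, ?_, ?_⟩
  · exact hφs.mono fun b hb => hball b hb
  · intro y hy
    refine ContDiffAt.contDiffWithinAt ?_
    have hs := φ.map_target hy
    obtain ⟨L, hL⟩ := (hsub hs).1.2.2
    have hcd := hφs.contDiffAt (Metric.isOpen_ball.mem_nhds (hball _ hs))
    refine φ.contDiffAt_symm hy (f₀' := L) ?_ hcd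
    rw [hL]
    exact (hcd.differentiableAt (by simp)).hasFDerivAt
  · rw [hsource]
    refine ⟨hstrict.mem_toOpenPartialHomeomorph_source, ⟨⟨hb₀r, ?_⟩, hb₀r, ?_⟩, hb₀⟩
    · rwa [mem_preimage, hφb₀]
    · exact ⟨ContinuousLinearEquiv.refl ℝ E3, hstrict.hasFDerivAt.fderiv.symm⟩
  · intro y hy
    have h1 := (hsub (φ.map_target hy)).1.1.2
    rwa [mem_preimage, ← hcoe, φ.right_inv hy] at h1
  · intro i b hb n
    have hbi := hgflat b ⟨hball b hb.1, hb.2⟩ n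
    by_cases hi : i = 0
    · subst hi
      have : (fun b => φ b 0 - b 0) = g := by
        ext b
        simp [hcoe, hφ₀]
      rw [this, hbi]
    · have : (fun b => φ b i - b i) = fun _ => 0 := by
        ext b
        fin_cases i
        · exact absurd rfl hi
        · simp [hcoe, hφ₀]
        · simp [hcoe, hφ₀]
      rw [this]
      simp
  · refine ⟨fun b hb => ⟨fun h => ?_, fun h => ?_⟩, fun b hb hbd i => ?_⟩
    · by_contra hbd
      exact (hgeq b ⟨hball b hb, hbd⟩).1 h
    · have : φ b = b := by simp [hcoe, hφ₀, hg0 b ⟨hball b hb, h⟩]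
      rwa [this]
    · rw [hcoe, (hφd b (hball b hb)).fderiv]
      by_cases hi : i = 0
      · subst hi
        have hbB := (hsub hb).2
        have h1 := (hgeq b ⟨hball b hb, hbd⟩).2
        have h2 : fderiv ℝ (fun b => H b - H' b - c) b = fderiv ℝ H b - fderiv ℝ H' b :=
          ((((hH.contDiffAt (hB.mem_nhds hbB)).differentiableAt (by simp)).hasFDerivAt.sub
            ((hH'.contDiffAt (hB.mem_nhds hbB)).differentiableAt
              (by simp)).hasFDerivAt).sub_const c).fderiv
        rw [h2] at h1
        rw [periodForm_id_zero, periodForm_id_zero, hφ₀, ← sub_eq_zero]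
        rw [← sub_eq_zero] at h1
        rw [← neg_eq_zero, ← h1]
        abel
      · obtain ⟨a, -, ha⟩ := κ.exists_stdPeriod_eq hi
        simp only [periodForm_id, if_neg hi, add_zero, ha]
        ext v
        fin_cases i
        · exact absurd rfl hi
        · simp
        · simp

theorem eq_zero_of_eq_zero_off_disc (κ : SingularityType) {F : Type} [NormedAddCommGroup F]
    {U : Set E3} (hU : IsOpen U) {f : E3 → F} (hf : ContinuousOn f U)
    (h0 : ∀ b ∈ U \ κ.disc, f b = 0) : ∀ b ∈ U, f b = 0 := by
  intro b hb
  by_contra hne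
  obtain ⟨x, hx, hxd⟩ := κ.dense_compl_disc.inter_open_nonempty _
    (hf.isOpen_inter_preimage hU isOpen_compl_singleton) ⟨b, hb, hne⟩
  exact hx.2 (h0 x ⟨hx.1, hxd⟩)

/-- A smooth function on a ball with vanishing differential off the discriminant locus is
constant. -/
theorem eq_of_fderiv_eq_zero_off_disc (κ : SingularityType) {p : E3} {r : ℝ} {f : E3 → ℝ}
    (hf : ContDiffOn ℝ ∞ f (Metric.ball p r))
    (h0 : ∀ b ∈ Metric.ball p r \ κ.disc, fderiv ℝ f b = 0) :
    ∀ b ∈ Metric.ball p r, ∀ b' ∈ Metric.ball p r, f b = f b' := by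
  have h1 := (contDiffOn_infty_iff_fderiv_of_isOpen Metric.isOpen_ball).1 hf
  intro b hb b' hb'
  exact Metric.isOpen_ball.is_const_of_fderiv_eq_zero (convex_ball p r).isPreconnected h1.1
    (fun x hx => eq_zero_of_eq_zero_off_disc κ Metric.isOpen_ball h1.2.continuousOn h0 x hx) hb hb'

/-! ### From matching periods to flatness of the difference. -/

section Converse

variable {κ : SingularityType} {B : Set E3} {φ : E3 → E3} {H H' : E3 → ℝ}

/-- A diffeomorphism that matches the periods is a shear near the discriminant locus. -/
theorem MatchesPeriods.eq_shear (hB : IsOpen B) (hφ : ContDiffOn ℝ ∞ φ B)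
    (htan : IsTangentToIdAt φ (B ∩ κ.disc)) (hm : MatchesPeriods κ B φ H H') {p : E3}
    (hp : p ∈ B ∩ κ.disc) {r : ℝ} (hr : 0 < r) (hrB : Metric.ball p r ⊆ B) :
    ∀ b ∈ Metric.ball p r, φ b = b + (φ b 0 - b 0) • axis := by
  have hcoord : ∀ i : Fin 3, i ≠ 0 → ∀ b ∈ Metric.ball p r, φ b i - b i = 0 := by
    intro i hi b hb
    have hs : ContDiffOn ℝ ∞ (fun b => φ b i - b i) (Metric.ball p r) :=
      ((dcoord i).contDiff.comp_contDiffOn (hφ.mono hrB)).sub (dcoord i).contDiff.contDiffOn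
    rw [eq_of_fderiv_eq_zero_off_disc κ hs (fun x hx => ?_) b hb p (Metric.mem_ball_self hr),
      isFlatAt_apply_eq_zero (htan i) hp]
    have hxB := hrB hx.1
    have hd := ((hφ.contDiffAt (hB.mem_nhds hxB)).differentiableAt (by simp)).hasFDerivAt
    have h1 : HasFDerivAt (fun b => φ b i - b i) ((dcoord i).comp (fderiv ℝ φ x) - dcoord i) x :=
      ((dcoord i).hasFDerivAt.comp x hd).sub (dcoord i).hasFDerivAt
    obtain ⟨a, ha0, ha⟩ := κ.exists_stdPeriod_eq hi
    have h2 := hm.pullback x hxB hx.2 i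
    simp only [periodForm_id, if_neg hi, add_zero, ha, ContinuousLinearMap.smul_comp] at h2
    rw [h1.fderiv, smul_right_injective _ ha0 h2, sub_self]
  intro b hb
  ext i
  fin_cases i
  · simp
  · simpa using sub_eq_zero.1 (hcoord 1 (by simp) b hb)
  · simpa using sub_eq_zero.1 (hcoord 2 (by simp) b hb)

/-- Matching of the singular periods says `d(H - H' ∘ φ) = φ^*τ₀ - τ₀`. Near `p` the map is a flat
shear, so the right-hand side is the differential of a flat function `k`, and `H - H' ∘ φ - k` is
constant on a ball. -/
theorem MatchesPeriods.locally_flat (hB : IsOpen B) (hφ : ContDiffOn ℝ ∞ φ B)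
    (htan : IsTangentToIdAt φ (B ∩ κ.disc)) (hm : MatchesPeriods κ B φ H H')
    (hH : ContDiffOn ℝ ∞ H B) {B' : Set E3} (hB' : IsOpen B') (hφB : MapsTo φ B B')
    (hH' : ContDiffOn ℝ ∞ H' B') {p : E3} (hp : p ∈ B ∩ κ.disc) :
    ∃ r > 0, ∃ c, ∀ q ∈ Metric.ball p r ∩ κ.disc,
      H q - H' (φ q) = c ∧ ∀ n, iteratedFDeriv ℝ n (fun b => H b - H' (φ b) - c) q = 0 := by
  obtain ⟨R, hR, hRB⟩ := Metric.nhds_basis_ball.mem_iff.1 (hB.mem_nhds hp.1)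
  have hpR := Metric.mem_ball_self (x := p) hR
  have hshear := hm.eq_shear hB hφ htan hp hR hRB
  set g : E3 → ℝ := fun b => φ b 0 - b 0 with hg
  have hgs : ContDiffOn ℝ ∞ g (Metric.ball p R) :=
    ((dcoord 0).contDiff.comp_contDiffOn (hφ.mono hRB)).sub (dcoord 0).contDiff.contDiffOn
  obtain ⟨r₁, hr₁, k, hk, hkflat, hkd⟩ := (κ.isTameForm_tauZero hp.2).exists_flat_primitive
    κ.isClosed_disc hp.2 one_pos norm_axis Metric.isOpen_ball hpR hgs
    fun q hq n => htan 0 q ⟨hRB hq.1, hq.2⟩ n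
  set r := min R r₁ with hr
  have hr0 : 0 < r := lt_min hR hr₁
  have hrR : Metric.ball p r ⊆ Metric.ball p R := Metric.ball_subset_ball (min_le_left _ _)
  have hrr₁ : Metric.ball p r ⊆ Metric.ball p r₁ := Metric.ball_subset_ball (min_le_right _ _)
  have hhs : ContDiffOn ℝ ∞ (fun b => H b - H' (φ b)) B := hH.sub (hH'.comp hφ hφB)
  have hconst := eq_of_fderiv_eq_zero_off_disc κ (p := p) (r := r)
    (f := fun b => H b - H' (φ b) - k b)
    ((hhs.mono (hrR.trans hRB)).sub (hk.mono hrr₁)) fun b hb => ?_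
  · set c := H p - H' (φ p) - k p with hc
    have hk0 : ∀ q ∈ Metric.ball p r ∩ κ.disc, k q = 0 := fun q hq =>
      isFlatAt_apply_eq_zero (S := Metric.ball p r₁ ∩ κ.disc) hkflat ⟨hrr₁ hq.1, hq.2⟩
    refine ⟨r, hr0, c, fun q hq => ⟨?_, fun n => ?_⟩⟩
    · have := hconst q hq.1 p (Metric.mem_ball_self hr0)
      rw [hk0 q hq, sub_zero] at this
      exact this
    · rw [← hkflat q ⟨hrr₁ hq.1, hq.2⟩ n]
      refine (Filter.EventuallyEq.iteratedFDeriv ℝ ?_ n).eq_of_nhds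
      filter_upwards [Metric.isOpen_ball.mem_nhds hq.1] with x hx
      have := hconst x hx p (Metric.mem_ball_self hr0)
      linarith
  · have hbB := hRB (hrR hb.1)
    have hφd := ((hφ.contDiffAt (hB.mem_nhds hbB)).differentiableAt (by simp)).hasFDerivAt
    have hφd' : fderiv ℝ φ b = ContinuousLinearMap.id ℝ E3 + (fderiv ℝ g b).smulRight axis := by
      have h1 : HasFDerivAt (fun b => b + g b • axis)
          (ContinuousLinearMap.id ℝ E3 + (fderiv ℝ g b).smulRight axis) b :=
        (hasFDerivAt_id b).add (((hgs.contDiffAt (Metric.isOpen_ball.mem_nhds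
          (hrR hb.1))).differentiableAt (by simp)).hasFDerivAt.smul_const axis)
      refine (Filter.EventuallyEq.fderiv_eq ?_).trans h1.fderiv
      filter_upwards [Metric.isOpen_ball.mem_nhds (hrR hb.1)] with x hx using hshear x hx
    have h2 := (((hH.contDiffAt (hB.mem_nhds hbB)).differentiableAt (by simp)).hasFDerivAt.sub
      (((hH'.contDiffAt (hB'.mem_nhds (hφB hbB))).differentiableAt
        (by simp)).hasFDerivAt.comp b hφd)).sub (hkd b ⟨hrr₁ hb.1, hb.2⟩)
    refine h2.fderiv.trans ?_
    have h3 := hm.pullback b hbB hb.2 0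
    rw [periodForm_id_zero, periodForm_id_zero, ContinuousLinearMap.add_comp] at h3
    rw [← hφd', ← hshear b (hrR hb.1)]
    rw [← sub_eq_zero] at h3
    rw [← neg_eq_zero, ← h3]
    abel

/-- Since `k` vanishes on Δ, the local constant is the value of `H - H' ∘ φ` there. This is locally
constant on the connected discriminant locus, so one constant serves everywhere. -/
theorem MatchesPeriods.exists_flat (hB : IsOpen B) (hφ : ContDiffOn ℝ ∞ φ B)
    (htan : IsTangentToIdAt φ (B ∩ κ.disc)) (hm : MatchesPeriods κ B φ H H')
    (hH : ContDiffOn ℝ ∞ H B) {B' : Set E3} (hB' : IsOpen B') (hφB : MapsTo φ B B')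
    (hH' : ContDiffOn ℝ ∞ H' B') (hconn : IsPreconnected (B ∩ κ.disc)) :
    ∃ c, IsFlatAt (fun b => H b - (H' ∘ φ) b - c) (B ∩ κ.disc) := by
  have hloc := fun p hp => hm.locally_flat hB hφ htan hH hB' hφB hH' (p := p) hp
  have hpre : PreconnectedSpace ↥(B ∩ κ.disc) := isPreconnected_iff_preconnectedSpace.1 hconn
  have hlc : IsLocallyConstant fun q : ↥(B ∩ κ.disc) => H q - H' (φ q) := by
    refine (IsLocallyConstant.iff_eventually_eq _).2 fun p => ?_
    obtain ⟨r, hr, c, hc⟩ := hloc p p.2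
    have hU : ∀ᶠ q : ↥(B ∩ κ.disc) in 𝓝 p, (q : E3) ∈ Metric.ball (p : E3) r :=
      continuous_subtype_val.continuousAt.eventually (Metric.ball_mem_nhds _ hr)
    filter_upwards [hU] with q hq
    rw [(hc q ⟨hq, q.2.2⟩).1, (hc p ⟨Metric.mem_ball_self hr, p.2.2⟩).1]
  rcases (B ∩ κ.disc).eq_empty_or_nonempty with he | ⟨p₀, hp₀⟩
  · exact ⟨0, by rw [he]; exact fun b hb => absurd hb (notMem_empty b)⟩
  · refine ⟨H p₀ - H' (φ p₀), fun p hp n => ?_⟩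
    obtain ⟨r, hr, c, hc⟩ := hloc p hp
    have h1 := hc p ⟨Metric.mem_ball_self hr, hp.2⟩
    have h2 : H p₀ - H' (φ p₀) = H p - H' (φ p) :=
      hlc.apply_eq_of_preconnectedSpace ⟨p₀, hp₀⟩ ⟨p, hp⟩
    rw [h2, h1.1]
    exact h1.2 n

end Converse

/-! ### Change of coordinates on the base -/

namespace FibrationTriple

variable (F : FibrationTriple.{u}) {g : E3 → E3}

theorem comp_df {x : F.X} (hg : DifferentiableAt ℝ g (F.f x))
    (hf : MDifferentiableAt 𝓘(ℝ, E6) 𝓘(ℝ, E3) F.f x) (w : TangentSpace 𝓘(ℝ, E6) x) :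
    (F.comp g).df x w = fderiv ℝ g (F.f x) (F.df x w) := by
  have h := mfderiv_comp (I' := 𝓘(ℝ, E3)) x hg.mdifferentiableAt hf
  rw [mfderiv_eq_fderiv] at h
  exact congrArg (fun A => A w) h

end FibrationTriple

section ChangeOfBase

variable {F : FibrationTriple.{u}} {φ : OpenPartialHomeomorph E3 E3}

theorem IsSmoothDiffeo.symm_fderiv_comp (hφ : IsSmoothDiffeo φ) {b : E3} (hb : b ∈ φ.source)
    (v : E3) : fderiv ℝ φ.symm (φ b) (fderiv ℝ φ b v) = v := by
  have h1 := ((hφ.1.contDiffAt (φ.open_source.mem_nhds hb)).differentiableAt (by simp))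
  have h2 := ((hφ.2.contDiffAt (φ.open_target.mem_nhds (φ.map_source hb))).differentiableAt
    (by simp))
  have h3 : φ.symm ∘ φ =ᶠ[𝓝 b] id := φ.eventually_left_inverse hb
  have h4 := h3.fderiv_eq (𝕜 := ℝ)
  rw [fderiv_comp b h2 h1, fderiv_id] at h4
  exact congrArg (fun A : E3 →L[ℝ] E3 => A v) h4

theorem IsSmoothDiffeo.symm (hφ : IsSmoothDiffeo φ) : IsSmoothDiffeo φ.symm := ⟨hφ.2, hφ.1⟩

theorem IsSmoothDiffeo.fderiv_comp_symm (hφ : IsSmoothDiffeo φ) {b : E3} (hb : b ∈ φ.source)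
    (v : E3) : fderiv ℝ φ b (fderiv ℝ φ.symm (φ b) v) = v := by
  have h := hφ.symm.symm_fderiv_comp (φ.map_source hb) v
  rwa [φ.left_inv hb] at h

theorem FibrationTriple.IsAdmissibleLagrangianFibration.mdifferentiableAt {B : Set E3}
    (hF : F.IsAdmissibleLagrangianFibration B) (x : F.X) :
    MDifferentiableAt 𝓘(ℝ, E6) 𝓘(ℝ, E3) F.f x :=
  hF.smooth.mdifferentiableAt (by simp)

namespace FibrationTriple

theorem IsAdmissibleLagrangianFibration.mem_target
    (hF : F.IsAdmissibleLagrangianFibration φ.target) (x : F.X) : F.f x ∈ φ.target :=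
  hF.range_subset (mem_range_self x)

theorem IsAdmissibleLagrangianFibration.comp_symm_df
    (hF : F.IsAdmissibleLagrangianFibration φ.target) (hφ : IsSmoothDiffeo φ) (x : F.X)
    (w : TangentSpace 𝓘(ℝ, E6) x) :
    (F.comp φ.symm).df x w = fderiv ℝ φ.symm (F.f x) (F.df x w) :=
  F.comp_df ((hφ.2.contDiffAt (φ.open_target.mem_nhds (hF.mem_target x))).differentiableAt
    (by simp)) (hF.mdifferentiableAt x) w

theorem IsAdmissibleLagrangianFibration.df_eq
    (hF : F.IsAdmissibleLagrangianFibration φ.target) (hφ : IsSmoothDiffeo φ) (x : F.X)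
    (w : TangentSpace 𝓘(ℝ, E6) x) :
    F.df x w = fderiv ℝ φ (φ.symm (F.f x)) ((F.comp φ.symm).df x w) := by
  rw [hF.comp_symm_df hφ]
  exact (hφ.symm.symm_fderiv_comp (hF.mem_target x) _).symm

theorem IsAdmissibleLagrangianFibration.comp_symm_crit
    (hF : F.IsAdmissibleLagrangianFibration φ.target) (hφ : IsSmoothDiffeo φ) :
    (F.comp φ.symm).crit = F.crit := by
  ext x
  refine not_congr ⟨fun h v => ?_, fun h v => ?_⟩
  · obtain ⟨w, hw⟩ := h (fderiv ℝ φ.symm (F.f x) v)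
    refine ⟨w, ?_⟩
    rw [hF.df_eq hφ x w, hw]
    exact hφ.symm.symm_fderiv_comp (hF.mem_target x) v
  · obtain ⟨w, hw⟩ := h (fderiv ℝ φ (φ.symm (F.f x)) v)
    refine ⟨w, ?_⟩
    rw [hF.comp_symm_df hφ x w, hw]
    exact hφ.symm.fderiv_comp_symm (hF.mem_target x) v

theorem IsAdmissibleLagrangianFibration.comp_symm_apply_eq_iff
    (hF : F.IsAdmissibleLagrangianFibration φ.target) (x : F.X) {b : E3} (hb : b ∈ φ.source) :
    (F.comp φ.symm).f x = b ↔ F.f x = φ b := by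
  constructor
  · rintro rfl
    exact (φ.right_inv (hF.mem_target x)).symm
  · intro h
    change φ.symm (F.f x) = b
    rw [h, φ.left_inv hb]

theorem IsAdmissibleLagrangianFibration.comp_symm_fibre
    (hF : F.IsAdmissibleLagrangianFibration φ.target) {b : E3} (hb : b ∈ φ.source) :
    (F.comp φ.symm).f ⁻¹' {b} = F.f ⁻¹' {φ b} :=
  Set.ext fun x => hF.comp_symm_apply_eq_iff x hb

theorem IsAdmissibleLagrangianFibration.comp_symm
    (hF : F.IsAdmissibleLagrangianFibration φ.target) (hφ : IsSmoothDiffeo φ) :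
    (F.comp φ.symm).IsAdmissibleLagrangianFibration φ.source where
  isOpen_base := φ.open_source
  smooth := hφ.2.contMDiffOn.comp_contMDiff hF.smooth hF.mem_target
  range_subset := by
    rintro _ ⟨x, rfl⟩
    exact φ.map_target (hF.mem_target x)
  proper K hK hKc := by
    have h : (F.comp φ.symm).f ⁻¹' K = F.f ⁻¹' (φ '' K) := by
      ext x
      refine ⟨fun hx => ⟨_, hx, φ.right_inv (hF.mem_target x)⟩, ?_⟩
      rintro ⟨b, hb, hbx⟩
      have := (hF.comp_symm_apply_eq_iff x (hK hb)).2 hbx.symm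
      rwa [mem_preimage, this]
    rw [h]
    exact hF.proper _ (image_subset_iff.2 fun b hb => φ.map_source (hK hb))
      (hKc.image_of_continuousOn (φ.continuousOn.mono hK))
  connected_fibre b hb := by
    rw [hF.comp_symm_fibre hb]
    exact hF.connected_fibre _ (φ.map_source hb)
  lagrangian x hx u w hu hw := by
    rw [hF.comp_symm_crit hφ] at hx
    refine hF.lagrangian x hx u w ?_ ?_
    · exact (hF.df_eq hφ x u).trans ((congrArg _ hu).trans (map_zero _))
    · exact (hF.df_eq hφ x w).trans ((congrArg _ hw).trans (map_zero _))
  connected_crit b hb := by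
    rw [hF.comp_symm_crit hφ, hF.comp_symm_fibre hb]
    exact hF.connected_crit _ (φ.map_source hb)
  connected_regular_fibre b hb := by
    rw [hF.comp_symm_crit hφ, hF.comp_symm_fibre hb]
    exact hF.connected_regular_fibre _ (φ.map_source hb)
  local_section x hx := by
    rw [hF.comp_symm_crit hφ] at hx
    obtain ⟨W, hW, hxW, -, σ, hσ, hσx, hσW⟩ := hF.local_section x hx
    have hr : φ ((F.comp φ.symm).f x) = F.f x := φ.right_inv (hF.mem_target x)
    refine ⟨φ.source ∩ φ ⁻¹' W, φ.isOpen_inter_preimage hW,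
      ⟨φ.map_target (hF.mem_target x), ?_⟩, inter_subset_left, σ ∘ φ,
      hσ.comp (hφ.1.mono inter_subset_left).contMDiffOn fun b hb => hb.2, ?_, fun b hb => ?_⟩
    · rwa [mem_preimage, hr]
    · exact (congrArg σ hr).trans hσx
    · exact (hF.comp_symm_apply_eq_iff _ hb.1).2 (hσW _ hb.2)

/-- The same loop serves both fibrations: the lifts of `v` for `φ⁻¹ ∘ f` are the lifts of `dφ(v)`
for `f`. -/
theorem IsAdmissibleLagrangianFibration.comp_symm_isPeriod_iff
    (hF : F.IsAdmissibleLagrangianFibration φ.target) (hφ : IsSmoothDiffeo φ) {b : E3}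
    (hb : b ∈ φ.source) (l : E3 →L[ℝ] ℝ) :
    (F.comp φ.symm).IsPeriod b l ↔ F.IsPeriod (φ b) (l.comp (fderiv ℝ φ.symm (φ b))) := by
  have hcrit := hF.comp_symm_crit hφ
  constructor
  · rintro ⟨γ, hγ, hper, hγb, hl⟩
    have hγb' : ∀ t, F.f (γ t) = φ b := fun t => (hF.comp_symm_apply_eq_iff _ hb).1 (hγb t).1
    refine ⟨γ, hγ, hper, fun t => ⟨hγb' t, fun h => (hγb t).2 (hcrit ▸ h)⟩, fun v w hw => ?_⟩
    refine hl _ w fun t => ?_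
    refine (hF.comp_symm_df hφ (γ t) (w t)).trans ?_
    rw [hw, hγb']
    rfl
  · rintro ⟨γ, hγ, hper, hγb, hl⟩
    refine ⟨γ, hγ, hper, fun t => ⟨(hF.comp_symm_apply_eq_iff _ hb).2 (hγb t).1,
      fun h => (hγb t).2 (hcrit ▸ h)⟩, fun v w hw => ?_⟩
    refine Eq.trans ?_ (hl (fderiv ℝ φ b v) w fun t => ?_)
    · rw [ContinuousLinearMap.comp_apply, hφ.symm_fderiv_comp hb]
    · refine (hF.df_eq hφ (γ t) (w t)).trans ?_
      rw [hw, (hγb t).1, φ.left_inv hb]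

end FibrationTriple

/-- As `φ ∘ (φ⁻¹ ∘ f) = f`, the symplectic normal form of `f` serves unchanged, now with the
coordinates `φ`. -/
theorem IsFibrationOfType.comp_symm {κ : SingularityType} {b₀ : E3}
    (hF : IsFibrationOfType κ φ.target b₀ id F) (hφ : IsSmoothDiffeo φ) (hb₀ : φ b₀ = b₀)
    (hb₀s : b₀ ∈ φ.source) (hdom : ∀ b ∈ φ.source, φ b ∈ κ.disc ↔ b ∈ κ.disc)
    (hconn : IsPreconnected (φ.source ∩ κ.disc)) :
    IsFibrationOfType κ φ.source b₀ φ (F.comp φ.symm) where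
  admissible := hF.admissible.comp_symm hφ
  coord_smooth := hφ.1
  coord_injOn := φ.injOn
  coord_fderiv b hb :=
    ⟨Function.LeftInverse.injective (hφ.symm_fderiv_comp hb),
      Function.RightInverse.surjective (hφ.fderiv_comp_symm hb)⟩
  base_mem := hb₀s
  base_mem_disc := hb₀.symm ▸ hF.base_mem_disc
  base_vertex hκ := hb₀.trans (hF.base_vertex hκ)
  disc_eq := by
    rw [hF.admissible.comp_symm_crit hφ]
    change (φ.symm ∘ F.f) '' F.crit = _
    rw [image_comp, hF.disc_eq]
    ext b
    constructor
    · rintro ⟨c, ⟨hc, hcd⟩, rfl⟩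
      refine ⟨φ.map_target hc, ?_⟩
      rwa [φ.right_inv hc]
    · rintro ⟨hb, hbd⟩
      exact ⟨φ b, ⟨φ.map_source hb, hbd⟩, φ.left_inv hb⟩
  disc_connected := by
    have : {b | b ∈ φ.source ∧ φ b ∈ κ.disc} = φ.source ∩ κ.disc :=
      Set.ext fun b => and_congr_right (hdom b)
    rwa [this]
  normal_form := by
    obtain ⟨V, Ψ, hV, hΨ, hs, hi, hω, hy, hc, hB⟩ := hF.normal_form
    refine ⟨V, Ψ, hV, hΨ, hs, hi, hω, fun p hp => ?_, ?_, ?_⟩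
    · exact (φ.right_inv (hF.admissible.mem_target _)).trans (hy p hp)
    · rw [hF.admissible.comp_symm_crit hφ]
      exact hc
    · change (φ.symm ∘ F.f) '' (Ψ '' V) = _
      rw [image_comp, hB, φ.symm_image_target_eq_source]

theorem HasSingularPeriod.comp_symm {κ : SingularityType} {H : E3 → ℝ}
    (hF : F.IsAdmissibleLagrangianFibration φ.target) (hφ : IsSmoothDiffeo φ)
    (hH : HasSingularPeriod κ φ.target id F H) :
    HasSingularPeriod κ φ.source φ (F.comp φ.symm) (H ∘ φ) where
  smooth := hH.smooth.comp hφ.1 φ.mapsTo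
  lattice b hb hbd l := by
    have hφd := (hφ.1.contDiffAt (φ.open_source.mem_nhds hb)).differentiableAt
      (n := ∞) (by simp)
    have hHd := (hH.smooth.contDiffAt (φ.open_target.mem_nhds (φ.map_source hb))).differentiableAt
      (n := ∞) (by simp)
    rw [hF.comp_symm_isPeriod_iff hφ hb, hH.lattice _ (φ.map_source hb) hbd]
    refine exists_congr fun n => ?_
    simp only [κ.periodForm_comp hφd hHd]
    constructor
    · intro h
      ext v
      have := congrArg (fun A => A (fderiv ℝ φ b v)) h
      simpa [hφ.symm_fderiv_comp hb] using this
    · intro h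
      ext v
      have := congrArg (fun A => A (fderiv ℝ φ.symm (φ b) v)) h
      simpa [hφ.fderiv_comp_symm hb] using this

end ChangeOfBase

/-! ### The proposition. -/

theorem mainTheorem7 (κ : SingularityType) :
    (∀ (B : Set E3) (b₀ : E3) (F : FibrationTriple.{u}) (F' : FibrationTriple.{v})
        (H H' : E3 → ℝ),
      FormallyEquivalent κ B b₀ id F H id F' H' →
      ∃ φ : OpenPartialHomeomorph E3 E3, IsSmoothDiffeo φ ∧
        b₀ ∈ φ.source ∧ φ b₀ = b₀ ∧ φ.source ⊆ B ∧ φ.target ⊆ B ∧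
        IsTangentToIdAt φ (φ.source ∩ κ.disc) ∧
        MatchesPeriods κ φ.source φ H H') ∧
    (∀ (B B' : Set E3) (b₀ : E3) (F : FibrationTriple.{u}) (F' : FibrationTriple.{v})
        (H H' : E3 → ℝ) (φ : OpenPartialHomeomorph E3 E3),
      IsFibrationOfType κ B b₀ id F → HasSingularPeriod κ B id F H →
      IsFibrationOfType κ B' b₀ id F' → HasSingularPeriod κ B' id F' H' →
      IsSmoothDiffeo φ → φ.source = B → φ.target = B' →
      IsTangentToIdAt φ (B ∩ κ.disc) → MatchesPeriods κ B φ H H' →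
      FormallyEquivalent κ B b₀ id F H φ (F'.comp φ.symm) (H' ∘ φ)) := by
  refine ⟨fun B b₀ F F' H H' hFE => ?_, ?_⟩
  · obtain ⟨c, hc⟩ := hFE.flat
    rw [hFE.left.disc_eq] at hc
    exact exists_diffeo_of_flat κ hFE.left.admissible.isOpen_base hFE.left.base_mem
      hFE.left.base_mem_disc hFE.left.base_vertex hFE.left_period.smooth hFE.right_period.smooth hc
  · rintro B B' b₀ F F' H H' φ hF hH hF' hH' hφ rfl rfl htan hm
    have hdisc : F.f '' F.crit = φ.source ∩ κ.disc := hF.disc_eq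
    -- The base point lies in Δ, where order zero of the tangency condition already makes `φ` the
    -- identity.
    have hb₀ : φ b₀ = b₀ := by
      ext i
      exact sub_eq_zero.1 (isFlatAt_apply_eq_zero (htan i) ⟨hF.base_mem, hF.base_mem_disc⟩)
    have hright := hF'.comp_symm hφ hb₀ hF.base_mem hm.domain hF.disc_connected
    exact {
      left := hF
      right := hright
      left_period := hH
      right_period := hH'.comp_symm hF'.admissible hφ
      disc_eq := by
        rw [hright.disc_eq, hdisc]
        exact (Set.ext fun b => and_congr_right (hm.domain b)).symm
      coord_tangent := by
        rw [hdisc]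
        exact htan
      flat := by
        rw [hdisc]
        exact hm.exists_flat φ.open_source hφ.1 htan hH.smooth φ.open_target φ.mapsTo hH'.smooth
          hF.disc_connected }
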